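/- **Setting.** Let $m_1,\dots,m_d\ge 1$ be pairwise coprime integers, $M=\prod_{i=1}^d m_i$, let $\mathcal A_i=\{a_{i,1},\dots,a_{i,\kappa_i}\}\subseteq\mathbb Z_{m_i}=\mathbb Z/m_i\mathbb Z$ be nonempty sets with $\kappa_i=|\mathcal A_i|$ and $\kappa_1\ge\kappa_2\ge\dots\ge\kappa_d$, and let $$\mathcal A=\{x\in\mathbb Z_M : \exists (\alpha_1,\dots,\alpha_d)\in\textstyle\prod_{i=1}^d\mathcal A_i,\ x\equiv\alpha_i \bmod m_i \text{ for } 1\le i\le d\}.$$ Put $M_i=Mc_i/m_i$ with $c_i=(M/m_i)^{-1}\bmod m_i$, and $\Delta_{i,0}=(a_{i,1}-a_{i,\kappa_i})M_i \bmod M$, $\Delta_{i,l}=(a_{i,l+1}-a_{i,l})M_i\bmod M$ for $1\le l\le\kappa_i-1$. **Algorithm.** Input: the $m_i$, the $\kappa_i$ and the lists $a_{i,1},\dots,a_{i,\kappa_i}$. Set $r_i\leftarrow 0$ for all $i$ and $x_1\leftarrow a_{1,1}M_1+\dots+a_{d,1}M_d \bmod M$. For $\nu=1,\dots,\kappa_1\cdots\kappa_d-1$: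 set $r_1\leftarrow r_1+1\bmod\kappa_1$ and $\mu\leftarrow1$; while $r_\mu=0$, set $\mu\leftarrow\mu+1$ and then $r_\mu\leftarrow r_\mu+1\bmod\kappa_\mu$; finally set $x_{\nu+1}\leftarrow x_\nu+\sum_{i=1}^{\mu}\Delta_{i,r_i}\bmod M$. Output: $x_1,x_2,\dots,x_{\kappa_1\cdots\kappa_d}$. **Theorem.** 1. (Correctness.) The algorithm always terminates, and its output lists every element of $\mathcal A$ exactly once. 2. (Running time.) There are a deterministic multitape Turing machine and an absolute constant $C$ such that the machine, given any input as above (all numbers in binary, residues represented by least nonnegative integers), halts with the word encoding the algorithm's output list $x_1,x_2,\dots$ on its output tape; and whenever $M\ge2$ and $|\mathcal A|\ge\sum_{i=1}^d\kappa_i\cdot\log M$, it does so in at most $C\,|\mathcal A|\log M$ steps. 3. (Asymptotic optimality.) There is an absolute constant $c>0$ such that, for every input with $M\ge2$ and $|\mathcal A|\ge\sum_{i=1}^d\kappa_i\cdot\log M$, every deterministic multitape Turing machine which, started on this input, halts with a list of all the elements of $\mathcal A$ (in any order, in binary) on its initially blank output tape makes at least $c\,|\mathcal A|\log M$ steps.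 -/

import Mathlib

noncomputable section

/-! Chinese remaindering of sets, and the enumeration algorithm -/

/-- An input of the algorithm: pairwise coprime moduli `m 1, …, m d`, nonempty sets
`A i ⊆ ℤ/m i` whose sizes do not increase with `i`, and an enumeration
`A i = {a i 1, …, a i κᵢ}` with `κᵢ = |A i|`.
All indices start at `1`; values at indices out of range are irrelevant. -/
structure CRTInput where
  d : ℕ
  m : ℕ → ℕ
  A : (i : ℕ) → Finset (ZMod (m i))
  a : (i : ℕ) → ℕ → ZMod (m i)
  m_pos : ∀ i ∈ Finset.Icc 1 d, 0 < m i
  coprime : ∀ i ∈ Finset.Icc 1 d, ∀ j ∈ Finset.Icc 1 d, i ≠ j → Nat.Coprime (m i) (m j)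
  nonempty : ∀ i ∈ Finset.Icc 1 d, (A i).Nonempty
  enum : ∀ i ∈ Finset.Icc 1 d, Set.BijOn (a i) (Set.Icc 1 (A i).card) (A i : Set (ZMod (m i)))
  sorted : ∀ i ∈ Finset.Icc 1 d, ∀ j ∈ Finset.Icc 1 d, i ≤ j → (A j).card ≤ (A i).card

namespace CRTInput

variable (I : CRTInput)

/-- `κᵢ = |A i|`. -/
def kappa (i : ℕ) : ℕ := (I.A i).card

/-- The product `M` of all the moduli. -/
def M : ℕ := ∏ i ∈ Finset.Icc 1 I.d, I.m i

lemma dvd_M {i : ℕ} (hi : i ∈ Finset.Icc 1 I.d) : I.m i ∣ I.M :=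
  Finset.dvd_prod_of_mem I.m hi

/-- The set of all `x ∈ ℤ/M` for which there are `αᵢ ∈ A i` with `x ≡ αᵢ (mod m i)` for all `i`. -/
def crtSet : Set (ZMod I.M) :=
  {x | ∃ α : (i : ℕ) → ZMod (I.m i),
    ∀ (i : ℕ) (hi : i ∈ Finset.Icc 1 I.d),
      α i ∈ I.A i ∧ ZMod.castHom (I.dvd_M hi) (ZMod (I.m i)) x = α i}

/-- `cᵢ = (M / m i)⁻¹ mod m i`, as an integer in `[0, m i)`. -/
def c (i : ℕ) : ℕ := (((I.M / I.m i : ℕ) : ZMod (I.m i))⁻¹).val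

/-- `Mᵢ = M cᵢ / m i`, reduced modulo `M`. -/
def gaussM (i : ℕ) : ZMod I.M := ((I.M * I.c i / I.m i : ℕ) : ZMod I.M)

/-- The precomputed differences: `Δ_{i,0} = (a_{i,1} - a_{i,κᵢ}) Mᵢ mod M` and
`Δ_{i,l} = (a_{i,l+1} - a_{i,l}) Mᵢ mod M` for `1 ≤ l < κᵢ`. -/
def delta (i l : ℕ) : ZMod I.M :=
  if l = 0 then (((I.a i 1).val : ZMod I.M) - ((I.a i (I.kappa i)).val : ZMod I.M)) * I.gaussM i
  else (((I.a i (l + 1)).val : ZMod I.M) - ((I.a i l).val : ZMod I.M)) * I.gaussM i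

/-- `x₁ = a_{1,1} M₁ + … + a_{d,1} M_d mod M`. -/
def x1 : ZMod I.M := ∑ i ∈ Finset.Icc 1 I.d, ((I.a i 1).val : ZMod I.M) * I.gaussM i

/-- The assignment `rᵢ ← rᵢ + 1 mod κᵢ`. -/
def incr (r : ℕ → ℕ) (i : ℕ) : ℕ → ℕ := Function.update r i ((r i + 1) % I.kappa i)

/-- One pass through the inner loop, on the variables `(r, μ)`:
`while r_μ = 0 do μ ← μ + 1; r_μ ← r_μ + 1 mod κ_μ`. The value `none` means that the loop is left. -/
def whileStep (s : (ℕ → ℕ) × ℕ) : Option ((ℕ → ℕ) × ℕ) :=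
  if s.1 s.2 = 0 then some (I.incr s.1 (s.2 + 1), s.2 + 1) else none

/-- One run of the main loop, on the variables `(r, x)`:
`r₁ ← r₁ + 1 mod κ₁; μ ← 1;` the inner loop; `x ← x + ∑_{i ≤ μ} Δ_{i,rᵢ} mod M`.
It is undefined if the inner loop does not terminate. -/
def mainStep (s : (ℕ → ℕ) × ZMod I.M) : Part ((ℕ → ℕ) × ZMod I.M) := do
  let p ← StateTransition.eval I.whileStep (I.incr s.1 1, 1)
  pure (p.1, s.2 + ∑ i ∈ Finset.Icc 1 p.2, I.delta i (p.1 i))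

/-- The values of `x` after each of the first `n` runs of the main loop, started at `s`. -/
def mainLoop : ℕ → (ℕ → ℕ) × ZMod I.M → Part (List (ZMod I.M))
  | 0, _ => pure []
  | n + 1, s => do
    let s' ← I.mainStep s
    let xs ← mainLoop n s'
    pure (s'.2 :: xs)

/-- The algorithm. It starts with all `rᵢ = 0` and with `x₁`, runs the main loop
`κ₁ ⋯ κ_d - 1` times, and returns the list of the values `x₁, x₂, …, x_{κ₁ ⋯ κ_d}`. -/
def algorithm : Part (List (ZMod I.M)) := do
  let xs ← I.mainLoop ((∏ i ∈ Finset.Icc 1 I.d, I.kappa i) - 1) (fun _ => 0, I.x1)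
  pure (I.x1 :: xs)

end CRTInput

/-! Words -/

/-- The symbols of input and output words. -/
inductive IOSymbol
  | bit (b : Bool)
  | comma
  | semicolon

/-- A natural number in binary, followed by a comma. -/
def encodeNat (n : ℕ) : List IOSymbol := (Nat.bits n).map IOSymbol.bit ++ [IOSymbol.comma]

/-- The input word: for `i = 1, …, d` the numbers `m i`, `κᵢ`, `a_{i,1}, …, a_{i,κᵢ}` and a
semicolon. Residues are represented by integers in `[0, m i)`. -/
def CRTInput.encode (I : CRTInput) : List IOSymbol :=
  (List.range I.d).flatMap fun i =>
    encodeNat (I.m (i + 1)) ++ encodeNat (I.kappa (i + 1)) ++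
      ((List.range (I.kappa (i + 1))).flatMap fun j => encodeNat (I.a (i + 1) (j + 1)).val) ++
      [IOSymbol.semicolon]

/-- The output word: the residues in the list, represented by integers in `[0, M)`. -/
def encodeResidues {M : ℕ} (xs : List (ZMod M)) : List IOSymbol :=
  xs.flatMap fun x => encodeNat x.val

/-! Multitape Turing machines -/

/-- Content of a tape cell: `none` is the blank; the other tape symbols are the input/output
symbols and the symbols of a further alphabet `W`. -/
abbrev TapeCell (W : Type) : Type := Option (IOSymbol ⊕ W)

/-- A deterministic multitape Turing machine. Depending on its state and on the scanned symbols
it either halts or goes to a new state, writes a symbol on each tape, and moves each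
head by at most one cell. -/
structure MultitapeTM where
  /-- the tapes -/
  K : Type
  [finK : Finite K]
  [decK : DecidableEq K]
  /-- the input tape -/
  inTape : K
  /-- the output tape -/
  outTape : K
  in_ne_out : inTape ≠ outTape
  /-- further tape symbols -/
  W : Type
  [finW : Finite W]
  /-- the states -/
  Q : Type
  [finQ : Finite Q]
  start : Q
  /-- the transition function; `none` means halting -/
  trans : Q → (K → TapeCell W) → Option (Q × (K → TapeCell W × Option Turing.Dir))

namespace MultitapeTM

variable (T : MultitapeTM)

/-- A configuration: a state, and the tapes with their head positions. -/
structure Config where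
  state : T.Q
  tape : T.K → Turing.Tape (TapeCell T.W)

/-- A tape which holds only the word `w`, with the head on its first symbol. -/
def wordTape (w : List IOSymbol) : Turing.Tape (TapeCell T.W) :=
  Turing.Tape.mk₁ (w.map fun s => some (Sum.inl s))

/-- The initial configuration: `w` on the input tape, all other tapes blank. -/
def init (w : List IOSymbol) : T.Config where
  state := T.start
  tape := fun k => letI := T.decK; if k = T.inTape then T.wordTape w else default

/-- Write the symbol, then move the head. -/
def act {W : Type} (t : Turing.Tape (TapeCell W)) (p : TapeCell W × Option Turing.Dir) :
    Turing.Tape (TapeCell W) :=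
  match p.2 with
  | none => t.write p.1
  | some dir => (t.write p.1).move dir

/-- One step of the machine; `none` if it halts. -/
def step (c : T.Config) : Option T.Config :=
  (T.trans c.state fun k => (c.tape k).head).map fun p =>
    { state := p.1, tape := fun k => act (c.tape k) (p.2 k) }

/-- Started on the word `w`, the machine halts after exactly `t` steps, and then the output tape
holds the word `v`, with the head on its first symbol. -/
def Outputs (w : List IOSymbol) (t : ℕ) (v : List IOSymbol) : Prop :=
  ∃ c : T.Config, (fun o => o.bind T.step)^[t] (some (T.init w)) = some c ∧
    T.step c = none ∧ c.tape T.outTape = T.wordTape v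

end MultitapeTM

end

/-!
The algorithm counts from `0` to `κ₁ ⋯ κ_d - 1` in a mixed radix number system: after `ν` runs of
the main loop `r_i` is the `i`-th digit of `ν`, the inner loop performs the carries, and the
differences `Δ` keep `x` equal to `∑ a_{i, rᵢ + 1} Mᵢ` (`CRTInput.term`; the invariant is
`CRTInput.exists_mem_eval` and `CRTInput.mainStep_eq`, the result `CRTInput.algorithm_eq`). Since
`Mᵢ` is `1` modulo `m i` and `0` modulo the other moduli, `x` has the residues selected by the
digits, and the Chinese remainder theorem shows that every element of the set is listed once
(`CRTInput.nodup_terms`, `CRTInput.mem_terms`).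

For the running time, a small language of programs on finitely many stacks is compiled to
multitape Turing machines: each stack is a tape whose content starts at the head, and each step of
a program costs two steps of the machine (`StackProg.toTM`, `StackProg.Within.outputs`). Eight
registers share one stack of `n = O(log M)` places, each of which holds a binary digit of each
register, so that an addition of two registers modulo `M` takes `O(n)` steps
(`StackProg.steps_addMod`). Instead of following the algorithm, the program computes the same
list, in the same order, without counters. It starts with the list `0`, and for `i = d, …, 1` it
replaces every `y` on the list by the sums `y + a_{i,j} Mᵢ`. For this it finds `Mᵢ` by the
Euclidean algorithm for `M / m i` and `m i`, carried along in `ℤ/M`, where repeated doubling and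
subtracting replaces division (`StackProg.steps_gauss`, `O(n)` register operations), and the
products `a_{i,j} Mᵢ` by Horner's scheme, whose cost is linear in the length of the input. As the
`κᵢ` decrease, the lengths of the successive lists form a sequence which is constantly `1` at
first and then at least doubles, so that they add up to at most `d + 2 |A|`
(`StackProg.blocksCost_le`). Hence `O(|A| + ∑ κᵢ log M)` register operations suffice
(`CRTInput.mainCost_le`), and this is `O(|A|)` if `|A| ≥ ∑ κᵢ log M`.

For the lower bound, a machine that writes a word of length `l` makes at least `l` steps
(`MultitapeTM.Outputs.length_le`), and the list of all elements has length at least a quarter of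
`|A| log M` (`CRTInput.mul_log_le_sum_size`): if two of the sets have several elements, one of
their moduli `m i` satisfies `m i ≤ M / m i`; changing the residue modulo `m i` of an element
changes it by a multiple of `M / m i`, so at least half of the elements are at least `M / m i ≥
√M`. Otherwise `|A| ≤ ∑ κᵢ`, and then `|A| ≥ ∑ κᵢ log M` forces `log M ≤ 1`.
-/

/-! ### Programs on several stacks, and their execution by multitape Turing machines -/

/-- What a program does with one stack in one step. -/
inductive StackAct (Γ : Type) where
  | keep
  | pop
  | push (g : Γ)

/-- The effect of a stack action. The head of the list is the top of the stack. -/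
def StackAct.apply {Γ : Type} : StackAct Γ → List Γ → List Γ
  | .keep, l => l
  | .pop, l => l.tail
  | .push g, l => g :: l

/-- Structured programs working on stacks indexed by `K` with entries in `Γ`, and on a memory with
values in `S`. All decisions depend only on the memory and on the top entries of the stacks
(`none` for an empty stack). -/
inductive StackProg (K Γ S : Type) where
  | act (f : S → (K → Option Γ) → S × (K → StackAct Γ))
  | seq (p q : StackProg K Γ S)
  | ite (b : S → (K → Option Γ) → Bool) (p q : StackProg K Γ S)
  | loop (b : S → (K → Option Γ) → Bool) (p : StackProg K Γ S)

namespace StackProg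

variable {K Γ S : Type}

/-- The top entries of the stacks. -/
def tops (σ : K → List Γ) : K → Option Γ := fun k => (σ k).head?

/-- The control points of a program: one for each action, and one for each test of a condition,
which is the additional point `none` of a branching or a loop. -/
def Pt : StackProg K Γ S → Type
  | act _ => Unit
  | seq p q => p.Pt ⊕ q.Pt
  | ite _ p q => Option (p.Pt ⊕ q.Pt)
  | loop _ p => Option p.Pt

/-- The control point at which the execution of a program starts. -/
def entry : (p : StackProg K Γ S) → p.Pt
  | act _ => ()
  | seq p _ => Sum.inl p.entry
  | ite _ _ _ => none
  | loop _ _ => none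

/-- The transition function of a program. The control point `none` is its exit. -/
def next : (p : StackProg K Γ S) → p.Pt → S → (K → Option Γ) →
    Option p.Pt × S × (K → StackAct Γ)
  | act f, _, s, h => (none, f s h)
  | seq p q, Sum.inl a, s, h =>
      let r := p.next a s h
      (some ((r.1.map Sum.inl).getD (Sum.inr q.entry)), r.2)
  | seq _ q, Sum.inr a, s, h =>
      let r := q.next a s h
      (r.1.map Sum.inr, r.2)
  | ite b p q, none, s, h =>
      (some (some (if b s h then Sum.inl p.entry else Sum.inr q.entry)), s, fun _ => .keep)
  | ite _ p _, some (Sum.inl a), s, h =>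
      let r := p.next a s h
      (r.1.map fun a => some (Sum.inl a), r.2)
  | ite _ _ q, some (Sum.inr a), s, h =>
      let r := q.next a s h
      (r.1.map fun a => some (Sum.inr a), r.2)
  | loop b p, none, s, h =>
      (if b s h then some (some p.entry) else none, s, fun _ => .keep)
  | loop _ p, some a, s, h =>
      let r := p.next a s h
      (some r.1, r.2)

theorem finite_pt : (p : StackProg K Γ S) → Finite p.Pt
  | act _ => inferInstanceAs (Finite Unit)
  | seq p q => by
      have := p.finite_pt
      have := q.finite_pt
      exact inferInstanceAs (Finite (p.Pt ⊕ q.Pt))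
  | ite _ p q => by
      have := p.finite_pt
      have := q.finite_pt
      exact inferInstanceAs (Finite (Option (p.Pt ⊕ q.Pt)))
  | loop _ p => by
      have := p.finite_pt
      exact inferInstanceAs (Finite (Option p.Pt))

/-- The stacks after one step. -/
def stepStacks (p : StackProg K Γ S) (a : p.Pt) (c : S × (K → List Γ)) : S × (K → List Γ) :=
  ((p.next a c.1 (tops c.2)).2.1, fun k => ((p.next a c.1 (tops c.2)).2.2 k).apply (c.2 k))

/-- The control point after one step. -/
def stepPt (p : StackProg K Γ S) (a : p.Pt) (c : S × (K → List Γ)) : Option p.Pt :=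
  (p.next a c.1 (tops c.2)).1

/-- `p.Run a c t c'`: started at control point `a` with memory and stacks `c`, the program exits
after exactly `t` steps with memory and stacks `c'`. -/
inductive Run (p : StackProg K Γ S) : p.Pt → S × (K → List Γ) → ℕ → S × (K → List Γ) → Prop
  | exit {a c} (h : p.stepPt a c = none) : Run p a c 1 (p.stepStacks a c)
  | step {a a' c t c'} (h : p.stepPt a c = some a') (h' : Run p a' (p.stepStacks a c) t c') :
      Run p a c (t + 1) c'

theorem Run.seq_right {p q : StackProg K Γ S} {a c t c'} (h : q.Run a c t c') :
    (seq p q).Run (Sum.inr a) c t c' := by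
  induction h with
  | exit h => exact Run.exit (by simp only [stepPt, next] at h ⊢; rw [h]; rfl)
  | step h _ ih => exact Run.step (by simp only [stepPt, next] at h ⊢; rw [h]; rfl) ih

theorem Run.seq_left {p q : StackProg K Γ S} {a c t c' t' c''} (h : p.Run a c t c')
    (h' : q.Run q.entry c' t' c'') : (seq p q).Run (Sum.inl a) c (t + t') c'' := by
  induction h with
  | exit h =>
    rw [add_comm]
    exact Run.step (by simp only [stepPt, next] at h ⊢; rw [h]; rfl) h'.seq_right
  | step h _ ih =>
    rw [add_right_comm]
    exact Run.step (by simp only [stepPt, next] at h ⊢; rw [h]; rfl) (ih h')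

theorem Run.ite_left {b} {p q : StackProg K Γ S} {a c t c'} (h : p.Run a c t c') :
    (ite b p q).Run (some (Sum.inl a)) c t c' := by
  induction h with
  | exit h => exact Run.exit (by simp only [stepPt, next] at h ⊢; rw [h]; rfl)
  | step h _ ih => exact Run.step (by simp only [stepPt, next] at h ⊢; rw [h]; rfl) ih

theorem Run.ite_right {b} {p q : StackProg K Γ S} {a c t c'} (h : q.Run a c t c') :
    (ite b p q).Run (some (Sum.inr a)) c t c' := by
  induction h with
  | exit h => exact Run.exit (by simp only [stepPt, next] at h ⊢; rw [h]; rfl)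
  | step h _ ih => exact Run.step (by simp only [stepPt, next] at h ⊢; rw [h]; rfl) ih

theorem Run.loop_body {b} {p : StackProg K Γ S} {a c t c' t' c''} (h : p.Run a c t c')
    (h' : (loop b p).Run none c' t' c'') : (loop b p).Run (some a) c (t + t') c'' := by
  induction h with
  | exit h =>
    rw [add_comm]
    exact Run.step (by simp only [stepPt, next] at h ⊢; rw [h]) h'
  | step h _ ih =>
    rw [add_right_comm]
    exact Run.step (by simp only [stepPt, next] at h ⊢; rw [h]) (ih h')

/-- `p.Within c B c'`: started with memory and stacks `c`, the program exits after at most `B`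
steps with memory and stacks `c'`. -/
def Within (p : StackProg K Γ S) (c : S × (K → List Γ)) (B : ℕ) (c' : S × (K → List Γ)) : Prop :=
  ∃ t ≤ B, p.Run p.entry c t c'

theorem Within.mono {p : StackProg K Γ S} {c B c' B'} (h : p.Within c B c') (hB : B ≤ B') :
    p.Within c B' c' :=
  let ⟨t, ht, hr⟩ := h
  ⟨t, ht.trans hB, hr⟩

theorem within_act {f : S → (K → Option Γ) → S × (K → StackAct Γ)} (c) :
    (act f).Within c 1 ((f c.1 (tops c.2)).1, fun k => ((f c.1 (tops c.2)).2 k).apply (c.2 k)) :=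
  ⟨1, le_rfl, Run.exit (p := act f) rfl⟩

theorem Within.seq {p q : StackProg K Γ S} {c B c' B' c''} (h : p.Within c B c')
    (h' : q.Within c' B' c'') : (seq p q).Within c (B + B') c'' :=
  let ⟨_, ht, hr⟩ := h
  let ⟨_, ht', hr'⟩ := h'
  ⟨_, add_le_add ht ht', hr.seq_left hr'⟩

theorem Within.ite_true {b} {p q : StackProg K Γ S} {c B c'} (hb : b c.1 (tops c.2) = true)
    (h : p.Within c B c') : (ite b p q).Within c (B + 1) c' :=
  let ⟨_, ht, hr⟩ := h
  ⟨_, Nat.succ_le_succ ht, Run.step (p := ite b p q) (by simp [stepPt, next, entry, hb])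
    hr.ite_left⟩

theorem Within.ite_false {b} {p q : StackProg K Γ S} {c B c'} (hb : b c.1 (tops c.2) = false)
    (h : q.Within c B c') : (ite b p q).Within c (B + 1) c' :=
  let ⟨_, ht, hr⟩ := h
  ⟨_, Nat.succ_le_succ ht, Run.step (p := ite b p q) (by simp [stepPt, next, entry, hb])
    hr.ite_right⟩

theorem within_loop_false {b} {p : StackProg K Γ S} {c} (hb : b c.1 (tops c.2) = false) :
    (loop b p).Within c 1 c :=
  ⟨1, le_rfl, Run.exit (p := loop b p) (by simp [stepPt, next, entry, hb])⟩

theorem Within.loop_true {b} {p : StackProg K Γ S} {c B c' B' c''}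
    (hb : b c.1 (tops c.2) = true) (h : p.Within c B c') (h' : (loop b p).Within c' B' c'') :
    (loop b p).Within c (B + B' + 1) c'' :=
  let ⟨_, ht, hr⟩ := h
  let ⟨_, ht', hr'⟩ := h'
  ⟨_, Nat.succ_le_succ (add_le_add ht ht'),
    Run.step (p := loop b p) (by simp [stepPt, next, entry, hb]) (hr.loop_body hr')⟩

/-! ### Translation into Turing machines -/

instance : Finite IOSymbol :=
  Finite.of_surjective (fun o : Option (Option Bool) =>
    match o with
    | none => IOSymbol.comma
    | some none => IOSymbol.semicolon
    | some (some b) => IOSymbol.bit b) (by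
      rintro (b | _ | _)
      exacts [⟨some (some b), rfl⟩, ⟨none, rfl⟩, ⟨some none, rfl⟩])

/-- The tape action that prepares a stack action: it erases the top entry and moves to the right if
the stack is popped, and moves to the left of the top entry if something is pushed. -/
def prepare {Γ : Type} (o : Option Γ) : StackAct Γ → Option Γ × Option Turing.Dir
  | .keep => (o, none)
  | .pop => (none, some .right)
  | .push _ => (o, some .left)

/-- The symbol still to be written after `prepare`. -/
def pending {Γ : Type} : StackAct Γ → Option Γ
  | .push g => some g
  | _ => none

/-- The Turing machine of a program. The stacks are held on the tapes, with the head at the top of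
the stack, which extends to the right. Each step of the program takes two steps of the machine: the
machine looks at the tops and moves, and then writes the symbols that are pushed. The third
component of a state is the vector of symbols to be written, in the second of these steps. -/
def toTM {K W S : Type} [Finite K] [DecidableEq K] [Finite W] [Finite S] (inp out : K)
    (hne : inp ≠ out) (s₀ : S) (p : StackProg K (IOSymbol ⊕ W) S) : MultitapeTM where
  K := K
  inTape := inp
  outTape := out
  in_ne_out := hne
  W := W
  Q := Option p.Pt × S × Option (K → Option (IOSymbol ⊕ W))
  finQ := by
    have := p.finite_pt
    infer_instance
  start := (some p.entry, s₀, none)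
  trans := fun q h =>
    match q with
    | (none, _, none) => none
    | (some a, s, none) =>
        let r := p.next a s h
        some ((r.1, r.2.1, some fun k => pending (r.2.2 k)), fun k => prepare (h k) (r.2.2 k))
    | (o, s, some w) => some ((o, s, none), fun k => ((w k).or (h k), none))

/-- The tape holding a stack. -/
def stackTape {Γ : Type} (l : List Γ) : Turing.Tape (Option Γ) := Turing.Tape.mk₁ (l.map some)

theorem head_stackTape {Γ : Type} (l : List Γ) : (stackTape l).head = l.head? := by
  cases l <;> rfl

theorem act_stackTape {W : Type} (l : List (IOSymbol ⊕ W)) (x : StackAct (IOSymbol ⊕ W)) :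
    MultitapeTM.act (MultitapeTM.act (stackTape l) (prepare l.head? x))
      ((pending x).or (MultitapeTM.act (stackTape l) (prepare l.head? x)).head, none) =
      stackTape (x.apply l) := by
  -- the two forms in which a blank half-tape turns up after popping the last entry
  have blank : Turing.ListBlank.mk [(default : Option (IOSymbol ⊕ W))] = Turing.ListBlank.mk [] :=
    Turing.ListBlank.ext fun i => by cases i <;> simp [List.getI]
  have hd : Turing.Tape.write l.head? (stackTape l) = stackTape l := by
    rw [← head_stackTape, Turing.Tape.write_self]
  cases x with
  | keep => simp [MultitapeTM.act, prepare, pending, hd, StackAct.apply]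
  | pop =>
    have hblank : Turing.ListBlank.mk [(none : Option (IOSymbol ⊕ W))] = Turing.ListBlank.mk [] :=
      blank
    rcases l with _ | ⟨_, _ | _⟩ <;>
      simp [MultitapeTM.act, prepare, pending, StackAct.apply, stackTape, Turing.Tape.mk₁,
        Turing.Tape.mk₂, blank, hblank]
  | push g =>
    simp only [MultitapeTM.act, prepare, pending, hd, StackAct.apply]
    simp only [stackTape, Turing.Tape.mk₁, Turing.Tape.mk₂, Turing.Tape.move_left_mk',
      Turing.Tape.write_mk', Option.some_or, List.map_cons, List.tail_cons,
      Turing.ListBlank.tail_mk, Turing.ListBlank.cons_mk, List.tail_nil]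

section

variable {K W S : Type} [Finite K] [DecidableEq K] [Finite W] [Finite S] {inp out : K}
  {hne : inp ≠ out} {s₀ : S} {p : StackProg K (IOSymbol ⊕ W) S}

/-- The configuration of the machine that corresponds to a configuration of the program. -/
def config (o : Option p.Pt) (c : S × (K → List (IOSymbol ⊕ W))) :
    (toTM inp out hne s₀ p).Config where
  state := (o, c.1, none)
  tape := fun k => stackTape (c.2 k)

/-- Two steps of the machine simulate one step of the program. -/
theorem step_step_config (a : p.Pt) (c : S × (K → List (IOSymbol ⊕ W))) :
    ((toTM inp out hne s₀ p).step (config (some a) c)).bind (toTM inp out hne s₀ p).step =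
      some (config (p.stepPt a c) (p.stepStacks a c)) := by
  have hh : (fun k => (stackTape (c.2 k)).head) = tops c.2 := funext fun k => head_stackTape _
  simp only [MultitapeTM.step, config, toTM, hh, Option.map_some, Option.bind_some]
  refine congrArg some ?_
  simp only [MultitapeTM.Config.mk.injEq, stepPt, stepStacks, true_and]
  exact funext fun k => act_stackTape (c.2 k) _

theorem Run.iterate {a c t c'} (h : p.Run a c t c') :
    (fun o => o.bind (toTM inp out hne s₀ p).step)^[2 * t] (some (config (some a) c)) =
      some (config none c') := by
  induction h with
  | exit h =>
    rw [mul_one, Function.iterate_succ_apply, Function.iterate_succ_apply, Option.bind_some,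
      step_step_config, h]
    rfl
  | step h _ ih =>
    rw [mul_add, mul_one, Function.iterate_add_apply, Function.iterate_succ_apply,
      Function.iterate_succ_apply, Option.bind_some, step_step_config, h]
    exact ih

/-- A program that halts with the word `v` on the output stack yields a Turing machine that outputs
`v`. -/
theorem Within.outputs {w v : List IOSymbol} {B : ℕ} {c' : S × (K → List (IOSymbol ⊕ W))}
    (h : p.Within (s₀, fun k => if k = inp then w.map Sum.inl else []) B c')
    (hv : c'.2 out = v.map Sum.inl) :
    ∃ t ≤ 2 * B, (toTM inp out hne s₀ p).Outputs w t v := by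
  obtain ⟨t, ht, hr⟩ := h
  refine ⟨2 * t, by omega, config none c', ?_, rfl, ?_⟩
  · rw [← hr.iterate (inp := inp) (out := out) (hne := hne) (s₀ := s₀)]
    congr 2
    refine (MultitapeTM.Config.mk.injEq ..).mpr ⟨rfl, ?_⟩
    funext k
    by_cases hk : k = inp
    · simp [hk, toTM, MultitapeTM.wordTape, stackTape, Function.comp_def]
    · have h0 (k : K) (hk : k ≠ inp) :
          (if k = inp then w.map Sum.inl else ([] : List (IOSymbol ⊕ W))) = [] := if_neg hk
      exact (if_neg hk).trans (congrArg stackTape (h0 k hk)).symm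
  · simp [config, toTM, hv, MultitapeTM.wordTape, stackTape, Function.comp_def]

end

end StackProg

namespace StackProg

/-! ### Moving the entries of stacks -/

variable {K Γ S : Type}

theorem Within.congr {p : StackProg K Γ S} {c B s} {τ τ' : K → List Γ} (h : p.Within c B (s, τ))
    (hτ : ∀ j, τ j = τ' j) : p.Within c B (s, τ') := by
  rwa [funext hτ] at h

/-- One run of a loop whose body is a single action. -/
theorem Within.loop_act {b : S → (K → Option Γ) → Bool}
    {f : S → (K → Option Γ) → S × (K → StackAct Γ)} {c c' c'' : S × (K → List Γ)} {B : ℕ}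
    (hb : b c.1 (tops c.2) = true) (hs : (f c.1 (tops c.2)).1 = c'.1)
    (hσ : ∀ k, ((f c.1 (tops c.2)).2 k).apply (c.2 k) = c'.2 k)
    (h' : (loop b (act f)).Within c' B c'') : (loop b (act f)).Within c (B + 2) c'' := by
  have hc : ((f c.1 (tops c.2)).1, fun k => ((f c.1 (tops c.2)).2 k).apply (c.2 k)) = c' :=
    Prod.ext hs (funext hσ)
  exact (Within.loop_true hb (hc ▸ within_act c) h').mono (by omega)

variable [DecidableEq K]

/-- Empty the stack `k`, pushing the image under `e j` of each removed entry on the stack `j`,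
for each `j` with `e j ≠ none`. -/
def fan (k : K) (e : K → Option (S → Γ → Γ)) : StackProg K Γ S :=
  loop (fun _ h => (h k).isSome) <| act fun s h => (s, fun j =>
    if j = k then .pop else
      match e j, h k with
      | some g, some γ => .push (g s γ)
      | _, _ => .keep)

theorem within_fan (k : K) (e : K → Option (S → Γ → Γ)) (s : S) (σ : K → List Γ) :
    (fan k e).Within (s, σ) (2 * (σ k).length + 1) (s, fun j =>
      if j = k then [] else
        match e j with
        | some g => ((σ k).map (g s)).reverse ++ σ j
        | none => σ j) := by
  generalize hl : σ k = l
  induction l generalizing σ with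
  | nil =>
    have h0 : (fun j => if j = k then [] else
        match e j with
        | some g => (([] : List Γ).map (g s)).reverse ++ σ j
        | none => σ j) = σ := by
      funext j
      by_cases hj : j = k
      · simp [hj, hl]
      · simp only [hj, if_false]
        cases e j <;> rfl
    rw [h0]
    exact within_loop_false (by simp [tops, hl])
  | cons a l ih =>
    have := ih (fun j => if j = k then l else
        match e j with
        | some g => g s a :: σ j
        | none => σ j) (by simp)
    refine Within.mono (B := 2 * l.length + 1 + 2) (Within.loop_act (by simp [tops, hl]) rfl ?_
      (this.congr fun j => ?_)) (by simp; omega)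
    rotate_left
    · by_cases hj : j = k
      · simp [hj]
      · simp only [hj, if_false]
        cases e j <;> simp
    · intro j
      by_cases hj : j = k
      · simp [hj, hl, StackAct.apply]
      · simp only [hj, if_false, tops, hl]
        cases e j <;> simp [StackAct.apply]

/-- Empty the stack `k`, removing as many entries from the stack `k'`, and pushing the image under
`e j` of each pair of removed entries on the stack `j`, for each `j` with `e j ≠ none`. -/
def zip (k k' : K) (e : K → Option (Γ → Γ → Γ)) : StackProg K Γ S :=
  loop (fun _ h => (h k).isSome) <| act fun s h => (s, fun j =>
    if j = k ∨ j = k' then .pop else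
      match e j, h k, h k' with
      | some g, some γ, some γ' => .push (g γ γ')
      | _, _, _ => .keep)

theorem within_zip {k k' : K} (hk : k ≠ k') (e : K → Option (Γ → Γ → Γ)) (s : S) (σ : K → List Γ)
    (w rest : List Γ) (hw : σ k' = w ++ rest) (hlen : w.length = (σ k).length) :
    (zip k k' e).Within (s, σ) (2 * (σ k).length + 1) (s, fun j =>
      if j = k then [] else if j = k' then rest else
        match e j with
        | some g => (List.zipWith g (σ k) w).reverse ++ σ j
        | none => σ j) := by
  generalize hl : σ k = l
  rw [hl] at hlen
  induction l generalizing σ w with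
  | nil =>
    obtain rfl : w = [] := by simpa using hlen
    have h0 : (fun j => if j = k then [] else if j = k' then rest else
        match e j with
        | some g => (List.zipWith g ([] : List Γ) []).reverse ++ σ j
        | none => σ j) = σ := by
      funext j
      by_cases hj : j = k
      · simp [hj, hl]
      · by_cases hj' : j = k'
        · subst hj'
          simp [hj, hw]
        · simp only [hj, hj', if_false]
          cases e j <;> rfl
    rw [h0]
    exact within_loop_false (by simp [tops, hl])
  | cons a l ih =>
    obtain _ | ⟨a', w⟩ := w
    · simp at hlen
    have := ih (fun j => if j = k then l else if j = k' then w ++ rest else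
        match e j with
        | some g => g a a' :: σ j
        | none => σ j) w (by simp [hk.symm]) (by simpa using hlen) (by simp)
    refine Within.mono (B := 2 * l.length + 1 + 2) (Within.loop_act (by simp [tops, hl]) rfl ?_
      (this.congr fun j => ?_)) (by simp; omega)
    rotate_left
    · by_cases hj : j = k
      · simp [hj]
      · by_cases hj' : j = k'
        · simp [hj', hk.symm]
        · simp only [hj, hj', if_false]
          cases e j <;> simp
    · intro j
      by_cases hj : j = k
      · simp [hj, hl, StackAct.apply]
      · by_cases hj' : j = k'
        · simp [hj', hk.symm, hw, StackAct.apply]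
        · simp only [hj, hj', or_self, if_false, tops, hl, hw]
          cases e j <;> simp [StackAct.apply]

end StackProg

/-! ### A file of binary registers -/

/-- The registers. -/
inductive Reg where
  | modulus | u | s | v | t | one | zero | tmp
  deriving DecidableEq

/-- The stacks: the input and output tapes, the register file and its mirror image `back`, and
working stacks. -/
inductive Stk where
  | inp | out | file | back | hist | mods | mods' | res | vals | vals' | list | list'
  deriving DecidableEq

/-- Work symbols. A symbol holds one binary digit of each register, and two auxiliary digits. -/
abbrev WorkSymbol : Type := (Reg → Bool) × Bool × Bool

/-- The stack alphabet. -/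
abbrev Symb : Type := IOSymbol ⊕ WorkSymbol

/-- The memory of the programs: two binary digits. -/
abbrev Mem : Type := Bool × Bool

/-- Programs on the stacks `Stk`. -/
abbrev Prog : Type := StackProg Stk Symb Mem

instance : Finite Reg :=
  Finite.of_surjective (fun i : Fin 8 => match i with
    | 0 => Reg.modulus | 1 => .u | 2 => .s | 3 => .v | 4 => .t | 5 => .one | 6 => .zero
    | 7 => .tmp) (by
      rintro (_ | _ | _ | _ | _ | _ | _ | _)
      exacts [⟨0, rfl⟩, ⟨1, rfl⟩, ⟨2, rfl⟩, ⟨3, rfl⟩, ⟨4, rfl⟩, ⟨5, rfl⟩, ⟨6, rfl⟩, ⟨7, rfl⟩])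

instance : Finite Stk :=
  Finite.of_surjective (fun i : Fin 12 => match i with
    | 0 => Stk.inp | 1 => .out | 2 => .file | 3 => .back | 4 => .hist | 5 => .mods | 6 => .mods'
    | 7 => .res | 8 => .vals | 9 => .vals' | 10 => .list | 11 => .list') (by
      rintro (_ | _ | _ | _ | _ | _ | _ | _ | _ | _ | _ | _)
      exacts [⟨0, rfl⟩, ⟨1, rfl⟩, ⟨2, rfl⟩, ⟨3, rfl⟩, ⟨4, rfl⟩, ⟨5, rfl⟩, ⟨6, rfl⟩, ⟨7, rfl⟩,
        ⟨8, rfl⟩, ⟨9, rfl⟩, ⟨10, rfl⟩, ⟨11, rfl⟩])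

/-- The contents of all the stacks. -/
structure Stacks where
  inp : List Symb := []
  out : List Symb := []
  file : List Symb := []
  back : List Symb := []
  hist : List Symb := []
  mods : List Symb := []
  mods' : List Symb := []
  res : List Symb := []
  vals : List Symb := []
  vals' : List Symb := []
  list : List Symb := []
  list' : List Symb := []

/-- The contents of the stacks as a function. -/
def Stacks.get (σ : Stacks) : Stk → List Symb
  | .inp => σ.inp
  | .out => σ.out
  | .file => σ.file
  | .back => σ.back
  | .hist => σ.hist
  | .mods => σ.mods
  | .mods' => σ.mods'
  | .res => σ.res
  | .vals => σ.vals
  | .vals' => σ.vals'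
  | .list => σ.list
  | .list' => σ.list'

namespace StackProg

/-- `p.Steps s σ B s' σ'`: started with memory `s` and stacks `σ`, the program exits after at most
`B` steps with memory `s'` and stacks `σ'`. -/
def Steps (p : Prog) (s : Mem) (σ : Stacks) (B : ℕ) (s' : Mem) (σ' : Stacks) : Prop :=
  p.Within (s, σ.get) B (s', σ'.get)

theorem Steps.mono {p : Prog} {s σ B s' σ' B'} (h : p.Steps s σ B s' σ') (hB : B ≤ B') :
    p.Steps s σ B' s' σ' :=
  Within.mono h hB

theorem Steps.seq {p q : Prog} {s σ B s' σ' B' s'' σ''} (h : p.Steps s σ B s' σ')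
    (h' : q.Steps s' σ' B' s'' σ'') : (seq p q).Steps s σ (B + B') s'' σ'' :=
  Within.seq h h'

theorem steps_act {f : Mem → (Stk → Option Symb) → Mem × (Stk → StackAct Symb)} {s s' σ σ'}
    (hs : (f s (tops σ.get)).1 = s')
    (hσ : ∀ k, ((f s (tops σ.get)).2 k).apply (σ.get k) = σ'.get k) :
    (act f).Steps s σ 1 s' σ' := by
  have := within_act (f := f) (s, σ.get)
  rwa [hs, funext hσ] at this

end StackProg

/-! ### Addition modulo a register -/

/-- The lowest binary digit. -/
def lowBit (x : ℕ) : Bool := decide (x % 2 = 1)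

theorem toNat_lowBit (x : ℕ) : (lowBit x).toNat = x % 2 := by
  unfold lowBit
  rcases Nat.mod_two_eq_zero_or_one x with h | h <;> simp [h]

theorem eq_lowBit {b : Bool} {x : ℕ} (h : b.toNat = x % 2) : b = lowBit x := by
  rw [← toNat_lowBit] at h
  revert h
  cases b <;> cases lowBit x <;> simp

/-- The `n` lowest binary digits of the registers `r` and of two auxiliary numbers `p` and `q`, the
lowest ones first. -/
def cells : ℕ → (Reg → ℕ) → ℕ → ℕ → List Symb
  | 0, _, _, _ => []
  | n + 1, r, p, q =>
      .inr (fun k => lowBit (r k), lowBit p, lowBit q) :: cells n (fun k => r k / 2) (p / 2) (q / 2)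

/-- The register file with `n` digits. -/
def regs (n : ℕ) (r : Reg → ℕ) : List Symb := cells n r 0 0

/-- The word of the `n` lowest binary digits of a number, the lowest one first. -/
def digits : ℕ → ℕ → List Symb
  | 0, _ => []
  | n + 1, x => .inl (.bit (lowBit x)) :: digits n (x / 2)

@[simp] theorem length_cells (n r p q) : (cells n r p q).length = n := by
  induction n generalizing r p q <;> simp [cells, *]

@[simp] theorem length_regs (n r) : (regs n r).length = n := length_cells ..

@[simp] theorem length_digits (n x) : (digits n x).length = n := by
  induction n generalizing x <;> simp [digits, *]

/-- One place of the computation of `x + y` and of `x + y - m`, with a carry and a borrow. -/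
def addDigit (s : Mem) (x y m : Bool) : Mem × Bool × Bool :=
  let p := (x ^^ y) ^^ s.1
  (((x && y) || (s.1 && (x || y)), (!p && (m || s.2)) || (m && s.2)), p, (p ^^ m) ^^ s.2)

theorem addDigit_spec (s : Mem) (x y m : Bool) :
    2 * (addDigit s x y m).1.1.toNat + (addDigit s x y m).2.1.toNat =
        x.toNat + y.toNat + s.1.toNat ∧
      (addDigit s x y m).2.2.toNat + m.toNat + s.2.toNat =
        (addDigit s x y m).2.1.toNat + 2 * (addDigit s x y m).1.2.toNat := by
  revert s x y m
  decide

namespace StackProg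

/-- Compute `x + y` and `x + y - m`, leaving the register file on `back`. -/
def addPass (x y m : Reg) : Prog :=
  loop (fun _ h => (h .file).isSome) <| act fun s h =>
    match h .file with
    | some (.inr (c, _)) =>
        ((addDigit s (c x) (c y) (c m)).1, fun k =>
          match k with
          | .file => .pop
          | .back => .push (.inr (c, (addDigit s (c x) (c y) (c m)).2))
          | _ => .keep)
    | _ => (s, fun _ => .keep)

/-- The difference `x + y - m` is computed modulo `2 ^ n`. The carry ends as `false`, as the sum
fits in `n` digits, and the borrow tells whether the sum is less than `m`. -/
theorem steps_addPass (x y m : Reg) (n : ℕ) (r : Reg → ℕ) (p q : ℕ) (cy bw : Bool) (σ : Stacks)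
    (hf : σ.file = cells n r p q) (hxy : r x + r y + cy.toNat < 2 ^ n) (hm : r m < 2 ^ n) :
    (addPass x y m).Steps (cy, bw) σ (2 * n + 1)
      (false, decide (r x + r y + cy.toNat < r m + bw.toNat))
      { σ with
        file := []
        back := (cells n r (r x + r y + cy.toNat)
          (2 ^ n + (r x + r y + cy.toNat) - r m - bw.toNat)).reverse ++ σ.back } := by
  induction n generalizing r p q cy bw σ with
  | zero =>
    have hx : r x = 0 := by simp at hxy; omega
    have hy : r y = 0 := by simp at hxy; omega
    have hm : r m = 0 := by simpa using hm
    obtain rfl : cy = false := by simp at hxy; simp [hxy]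
    have hσ : { σ with file := [], back := [] ++ σ.back } = σ := by
      cases σ
      simpa [cells] using hf.symm
    have hb : decide (0 + 0 + false.toNat < 0 + bw.toNat) = bw := by cases bw <;> rfl
    simp only [hx, hy, hm, cells, List.reverse_nil, hσ, hb]
    exact within_loop_false (by simp [tops, Stacks.get, hf, cells])
  | succ n ih =>
    have hs := addDigit_spec (cy, bw) (lowBit (r x)) (lowBit (r y)) (lowBit (r m))
    generalize hD : addDigit (cy, bw) (lowBit (r x)) (lowBit (r y)) (lowBit (r m)) = D at hs
    obtain ⟨⟨cy', bw'⟩, a, b⟩ := D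
    simp only [toNat_lowBit] at hs
    have hbw : bw.toNat ≤ 1 := Bool.toNat_le bw
    have hbw' : bw'.toNat ≤ 1 := Bool.toNat_le bw'
    have ha : a.toNat ≤ 1 := Bool.toNat_le a
    have hb : b.toNat ≤ 1 := Bool.toNat_le b
    rw [pow_succ] at hxy hm
    have key := ih (fun k => r k / 2) (p / 2) (q / 2) cy' bw'
      { σ with
        file := cells n (fun k => r k / 2) (p / 2) (q / 2)
        back := .inr (fun k => lowBit (r k), a, b) :: σ.back } rfl (by omega) (by omega)
    have e1 : r x / 2 + r y / 2 + cy'.toNat = (r x + r y + cy.toNat) / 2 := by omega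
    have e2 : 2 ^ n + (r x / 2 + r y / 2 + cy'.toNat) - r m / 2 - bw'.toNat =
        (2 ^ (n + 1) + (r x + r y + cy.toNat) - r m - bw.toNat) / 2 := by
      rw [pow_succ]; omega
    have e3 : decide (r x / 2 + r y / 2 + cy'.toNat < r m / 2 + bw'.toNat) =
        decide (r x + r y + cy.toNat < r m + bw.toNat) := by
      congr 1
      apply propext
      omega
    have e4 : a = lowBit (r x + r y + cy.toNat) := eq_lowBit (by omega)
    have e5 : b = lowBit (2 ^ (n + 1) + (r x + r y + cy.toNat) - r m - bw.toNat) :=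
      eq_lowBit (by rw [pow_succ]; omega)
    simp only [e2, e3] at key
    simp only [e1] at key
    have fin := Within.loop_act (b := fun (_ : Mem) (h : Stk → Option Symb) => (h .file).isSome)
      (c := ((cy, bw), σ.get)) (by simp [tops, Stacks.get, hf, cells])
      (by simp only [tops, Stacks.get, hf, cells, List.head?_cons, hD])
      (by
        intro k
        simp only [tops, Stacks.get, hf, cells, List.head?_cons, hD]
        cases k <;> simp [StackAct.apply]) key
    refine (show (addPass x y m).Within _ _ _ from fin).mono (by omega) |>.congr ?_
    intro k
    cases k <;> simp [Stacks.get, cells, e4, e5]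

/-- The second pass of `addMod`: move the register file back from `back`, assigning `x + y` or
`x + y - m` to the register `dst`, depending on the borrow. -/
def selectPass (dst : Reg) : Prog :=
  fan .back fun k => match k with
    | .file => some fun s γ => match γ with
      | .inr (c, p, q) => .inr (Function.update c dst (if s.2 then p else q), false, false)
      | γ => γ
    | _ => none

theorem map_select (dst : Reg) (cy bw : Bool) (n r p q) :
    (cells n r p q).map (fun γ => match γ with
      | .inr (c, p, q) => .inr (Function.update c dst (if (cy, bw).2 then p else q), false, false)
      | γ => γ) = regs n (Function.update r dst (if bw then p else q)) := by
  induction n generalizing r p q with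
  | zero => rfl
  | succ n ih =>
    simp only [cells, List.map_cons, ih, regs]
    congr 1
    · congr 3
      funext k
      by_cases hk : k = dst
      · subst hk
        cases bw <;> simp
      · simp [hk]
    · congr 1
      funext k
      by_cases hk : k = dst
      · subst hk
        cases bw <;> simp
      · simp [hk]

/-- A register file with `n` digits holds its registers modulo `2 ^ n`. -/
theorem regs_congr {n : ℕ} {r r' : Reg → ℕ} (h : ∀ k, r k % 2 ^ n = r' k % 2 ^ n) :
    regs n r = regs n r' := by
  unfold regs
  suffices ∀ p q, cells n r p q = cells n r' p q from this 0 0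
  intro p q
  induction n generalizing r r' p q with
  | zero => rfl
  | succ n ih =>
    have h2 (k) : r k % 2 = r' k % 2 := by
      have := congrArg (· % 2) (h k)
      simpa [Nat.mod_mod_of_dvd _ (dvd_pow_self 2 (Nat.succ_ne_zero n))] using this
    simp only [cells, lowBit, h2]
    congr 1
    refine ih (fun k => ?_) _ _
    have := h k
    rw [pow_succ', Nat.mod_mul, Nat.mod_mul, h2 k] at this
    omega

/-- Set the memory. -/
def setMem (s : Mem) : Prog := act fun _ _ => (s, fun _ => .keep)

/-- Assign `x + y` or, if this is at least `m`, `x + y - m`, to the register `dst`. Whether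
`x + y < m` is recorded in the memory. -/
def addMod (dst x y m : Reg) : Prog :=
  seq (setMem (false, false)) (seq (addPass x y m) (selectPass dst))

/-- The number of steps that suffices for one operation on the register file. -/
def unit (n : ℕ) : ℕ := 4 * n + 4

/-- The program decides nothing but whether to subtract `m` once: for a register `m` that is `0`,
the sum is not reduced. -/
theorem steps_addMod (dst x y m : Reg) (n : ℕ) (r : Reg → ℕ) (s : Mem) (σ : Stacks)
    (hf : σ.file = regs n r) (hb : σ.back = []) (hxy : r x + r y < 2 ^ n) (hm : r m < 2 ^ n) :
    (addMod dst x y m).Steps s σ (unit n) (false, decide (r x + r y < r m))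
      { σ with file := regs n (Function.update r dst
          (if r x + r y < r m then r x + r y else r x + r y - r m)) } := by
  have h1 : (setMem (false, false)).Steps s σ 1 (false, false) σ := steps_act rfl fun _ => rfl
  have h2 := steps_addPass x y m n r 0 0 false false σ hf hxy hm
  have h3 := fun (bw : Bool) (τ : Stacks) => within_fan (S := Mem) (K := Stk) .back (fun k => match k with
    | .file => some fun (s : Mem) (γ : Symb) => match γ with
      | .inr (c, p, q) => .inr (Function.update c dst (if s.2 then p else q), false, false)
      | γ => γ
    | _ => none) (false, bw) τ.get
  refine (h1.seq (h2.seq ((h3 _ _).congr (τ' := Stacks.get _) ?_))).mono ?_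
  · intro k
    cases k
    case file =>
      simp only [Stacks.get, reduceCtorEq, if_false, hb, List.append_nil, List.map_reverse,
        List.reverse_reverse]
      rw [map_select]
      refine regs_congr fun k => ?_
      by_cases hk : k = dst
      · subst hk
        by_cases hlt : r x + r y < r m
        · simp [hlt]
        · have : 2 ^ n + (r x + r y) - r m = (r x + r y - r m) + 2 ^ n := by omega
          simp [hlt, this]
      · simp [hk]
    all_goals simp [Stacks.get, hb]
  · simp [Stacks.get, hb, unit]
    omega

end StackProg

/-! ### Copying registers -/

theorem half_update (r : Reg → ℕ) (k : Reg) (x : ℕ) :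
    (fun j => Function.update r k x j / 2) = Function.update (fun j => r j / 2) k (x / 2) := by
  funext j
  by_cases hj : j = k
  · subst hj; simp
  · simp [hj]

theorem lowBit_update (r : Reg → ℕ) (k : Reg) (x : ℕ) :
    (fun j => lowBit (Function.update r k x j)) =
      Function.update (fun j => lowBit (r j)) k (lowBit x) := by
  funext j
  by_cases hj : j = k
  · subst hj; simp
  · simp [hj]

/-- The digit of the register `k` in a symbol of the register file. -/
def digitOf (k : Reg) : Symb → Symb
  | .inr (c, _) => .inl (.bit (c k))
  | γ => γ

/-- Replace the digit of the register `k` in a symbol of the register file. -/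
def setDigit (k : Reg) : Symb → Symb → Symb
  | .inr (c, _), .inl (.bit b) => .inr (Function.update c k b, false, false)
  | γ, _ => γ

/-- Replace the digits of the registers `v` and `t` in a symbol of the register file. -/
def setVT : Symb → Symb → Symb
  | .inr (c, _), .inr (c', _) =>
      .inr (Function.update (Function.update c .v (c' .v)) .t (c' .t), false, false)
  | γ, _ => γ

theorem map_digitOf (k : Reg) (n : ℕ) (r : Reg → ℕ) :
    (regs n r).map (digitOf k) = digits n (r k) := by
  unfold regs
  induction n generalizing r with
  | zero => rfl
  | succ n ih => simp [cells, digits, ih, digitOf]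

theorem zipWith_setDigit (k : Reg) (n : ℕ) (r : Reg → ℕ) (x : ℕ) :
    List.zipWith (setDigit k) (regs n r) (digits n x) = regs n (Function.update r k x) := by
  unfold regs
  induction n generalizing r x with
  | zero => rfl
  | succ n ih =>
    simp only [cells, digits, List.zipWith_cons_cons, setDigit, Nat.zero_div, ih, half_update,
      lowBit_update]
    rfl

theorem zipWith_setVT (n : ℕ) (r r' : Reg → ℕ) :
    List.zipWith setVT (regs n r) (regs n r') =
      regs n (Function.update (Function.update r .v (r' .v)) .t (r' .t)) := by
  unfold regs
  induction n generalizing r r' with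
  | zero => rfl
  | succ n ih =>
    simp only [cells, List.zipWith_cons_cons, setVT, Nat.zero_div, ih, half_update, lowBit_update]
    rfl

theorem zipWith_snd {α β : Type*} : ∀ {l : List α} {w : List β}, l.length = w.length →
    List.zipWith (fun _ b => b) l w = w
  | [], [], _ => rfl
  | _ :: _, _ :: _, h => by simp [zipWith_snd (Nat.succ.inj h)]

namespace StackProg

/-- Move the register file from `back` to its place. -/
def fromBack : Prog := fan .back fun k => match k with
  | .file => some fun _ γ => γ
  | _ => none

/-- Push a copy of the register file on `hist`. -/
def saveRegs : Prog :=
  seq (fan .file fun k => match k with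
    | .back => some fun _ γ => γ
    | _ => none)
  (fan .back fun k => match k with
    | .file => some fun _ γ => γ
    | .hist => some fun _ γ => γ
    | _ => none)

/-- Remove a copy of the register file from `hist`, restoring the registers `v` and `t`. -/
def restoreVT : Prog :=
  seq (zip .file .hist fun k => match k with
    | .back => some setVT
    | _ => none) fromBack

/-- Remove a number from `list`, assigning it to `u`. -/
def loadU : Prog :=
  seq (zip .file .list fun k => match k with
    | .back => some (setDigit .u)
    | _ => none) fromBack

/-- Move a number from `vals` to `vals'`, assigning it to `v`. -/
def loadV : Prog :=
  seq (zip .file .vals fun k => match k with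
    | .back => some (setDigit .v)
    | .vals' => some fun _ γ => γ
    | _ => none) fromBack

/-- Push the digits of `t` on `list'`, the lowest one first. -/
def emitT : Prog :=
  seq (fan .file fun k => match k with
    | .back => some fun _ γ => γ
    | .list' => some fun _ γ => digitOf .t γ
    | _ => none) fromBack

/-- Push the digits of `u` on `vals`, the highest one first. -/
def emitU : Prog :=
  seq (fan .file fun k => match k with
    | .back => some fun _ γ => γ
    | _ => none)
  (fan .back fun k => match k with
    | .file => some fun _ γ => γ
    | .vals => some fun _ γ => digitOf .u γ
    | _ => none)

variable {n : ℕ} {r : Reg → ℕ} {s : Mem} {σ : Stacks}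

theorem steps_saveRegs (hf : σ.file = regs n r) (hb : σ.back = []) :
    saveRegs.Steps s σ (unit n) s { σ with hist := regs n r ++ σ.hist } := by
  refine (Within.seq (within_fan ..) ((within_fan ..).congr fun k => ?_)).mono ?_
  · cases k <;> simp [Stacks.get, hf, hb]
  · simp [Stacks.get, hf, hb, unit]; omega

theorem steps_emitU (hf : σ.file = regs n r) (hb : σ.back = []) :
    emitU.Steps s σ (unit n) s { σ with vals := digits n (r .u) ++ σ.vals } := by
  refine (Within.seq (within_fan ..) ((within_fan ..).congr fun k => ?_)).mono ?_
  · cases k <;> simp [Stacks.get, hf, hb, map_digitOf]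
  · simp [Stacks.get, hf, hb, unit]; omega

theorem steps_emitT (hf : σ.file = regs n r) (hb : σ.back = []) :
    emitT.Steps s σ (unit n) s { σ with list' := (digits n (r .t)).reverse ++ σ.list' } := by
  refine (Within.seq (within_fan ..) ((within_fan ..).congr fun k => ?_)).mono ?_
  · cases k <;> simp [Stacks.get, hf, hb, map_digitOf]
  · simp [Stacks.get, hf, hb, unit]; omega

theorem steps_restoreVT {r' : Reg → ℕ} {rest : List Symb} (hf : σ.file = regs n r)
    (hb : σ.back = []) (hh : σ.hist = regs n r' ++ rest) :
    restoreVT.Steps s σ (unit n) s { σ with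
      file := regs n (Function.update (Function.update r .v (r' .v)) .t (r' .t))
      hist := rest } := by
  refine (Within.seq (within_zip (by simp) _ _ _ (regs n r') rest (by simp [Stacks.get, hh])
    (by simp [Stacks.get, hf])) ((within_fan ..).congr fun k => ?_)).mono ?_
  · cases k <;> simp [Stacks.get, hf, hb, zipWith_setVT]
  · simp [Stacks.get, hf, hb, unit]; omega

theorem steps_loadU {x : ℕ} {rest : List Symb} (hf : σ.file = regs n r)
    (hb : σ.back = []) (hh : σ.list = digits n x ++ rest) :
    loadU.Steps s σ (unit n) s { σ with
      file := regs n (Function.update r .u x)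
      list := rest } := by
  refine (Within.seq (within_zip (by simp) _ _ _ (digits n x) rest (by simp [Stacks.get, hh])
    (by simp [Stacks.get, hf])) ((within_fan ..).congr fun k => ?_)).mono ?_
  · cases k <;> simp [Stacks.get, hf, hb, zipWith_setDigit]
  · simp [Stacks.get, hf, hb, unit]; omega

theorem steps_loadV {x : ℕ} {rest : List Symb} (hf : σ.file = regs n r)
    (hb : σ.back = []) (hh : σ.vals = digits n x ++ rest) :
    loadV.Steps s σ (unit n) s { σ with
      file := regs n (Function.update r .v x)
      vals := rest
      vals' := (digits n x).reverse ++ σ.vals' } := by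
  refine (Within.seq (within_zip (by simp) _ _ _ (digits n x) rest (by simp [Stacks.get, hh])
    (by simp [Stacks.get, hf])) ((within_fan ..).congr fun k => ?_)).mono ?_
  · cases k <;> simp [Stacks.get, hf, hb, zipWith_setDigit, zipWith_snd]
  · simp [Stacks.get, hf, hb, unit]; omega

end StackProg

namespace StackProg

/-! ### Comparison -/

/-- Record in the memory whether `x + y < m`. -/
def compare (x y m : Reg) : Prog :=
  seq (setMem (false, false)) (seq (addPass x y m) (fan .back fun k => match k with
    | .file => some fun _ γ => match γ with
      | .inr (c, _) => .inr (c, false, false)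
      | γ => γ
    | _ => none))

theorem map_clear (n r p q) :
    (cells n r p q).map (fun γ => match γ with
      | .inr (c, _) => .inr (c, false, false)
      | γ => γ) = regs n r := by
  unfold regs
  induction n generalizing r p q with
  | zero => rfl
  | succ n ih => simp only [cells, List.map_cons, ih, Nat.zero_div]; rfl

variable {n : ℕ} {r : Reg → ℕ} {s : Mem} {σ : Stacks}

theorem steps_compare (x y m : Reg) (hf : σ.file = regs n r) (hb : σ.back = [])
    (hxy : r x + r y < 2 ^ n) (hm : r m < 2 ^ n) :
    (compare x y m).Steps s σ (unit n) (false, decide (r x + r y < r m)) σ := by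
  have h1 : (setMem (false, false)).Steps s σ 1 (false, false) σ := steps_act rfl fun _ => rfl
  have h2 := steps_addPass x y m n r 0 0 false false σ hf hxy hm
  refine (h1.seq (h2.seq ((within_fan ..).congr fun k => ?_))).mono ?_
  · cases k
    case file =>
      simp only [Stacks.get, reduceCtorEq, if_false, hb, hf, List.append_nil, List.map_reverse,
        List.reverse_reverse]
      exact map_clear ..
    all_goals simp [Stacks.get, hb]
  · simp [Stacks.get, hb, unit]
    omega

/-- Do nothing. -/
def skip : Prog := act fun s _ => (s, fun _ => .keep)

theorem steps_skip : skip.Steps s σ 1 s σ := steps_act rfl fun _ => rfl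

/-! ### Division with remainder -/

/-- Save and double `v` and `t`, as long as `v ≤ u`. -/
def doubling : Prog :=
  loop (fun s _ => !s.2) (seq saveRegs (seq (addMod .v .v .v .zero)
    (seq (addMod .t .t .t .modulus) (compare .u .zero .v))))

/-- Restore the saved values of `v` and `t`, subtracting `v` from `u` and adding `t` to `s` whenever
`v ≤ u`. -/
def subtracting : Prog :=
  loop (fun _ h => (h .hist).isSome) (seq restoreVT (seq (addMod .u .u .zero .v)
    (ite (fun s _ => !s.2) (addMod .s .s .t .modulus) skip)))

/-- Replace `u` by `u % v` and `s` by `s + u / v * t`, modulo `modulus`. -/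
def divide : Prog := seq (compare .u .zero .v) (seq doubling subtracting)

/-- The registers after `j` runs of the loop of `doubling`. -/
def doubled (r : Reg → ℕ) (j : ℕ) : Reg → ℕ :=
  Function.update (Function.update r .v (2 ^ j * r .v)) .t (2 ^ j * r .t % r .modulus)

/-- The copies of the register file saved in `j` runs of the loop of `doubling`. -/
def saved (n : ℕ) (r : Reg → ℕ) : ℕ → List Symb
  | 0 => []
  | j + 1 => regs n (doubled r j) ++ saved n r j

theorem mod_eq_ite {x M : ℕ} (h : x < 2 * M) : (if x < M then x else x - M) = x % M := by
  split_ifs with h'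
  · exact (Nat.mod_eq_of_lt h').symm
  · rw [Nat.mod_eq_sub_mod (by omega), Nat.mod_eq_of_lt (by omega)]

/-- After `k` runs, where `k` is least with `u < 2 ^ k * v`, the doubling ends. -/
theorem steps_doubling (hu : 2 * r .u < 2 ^ n) (hM : 2 * r .modulus < 2 ^ n)
    (hz : r .zero = 0) (hM0 : 0 < r .modulus) (hb : σ.back = []) {k : ℕ}
    (hk : r .u < 2 ^ k * r .v) (hk' : ∀ j < k, 2 ^ j * r .v ≤ r .u) (d j : ℕ) (hj : j + d = k)
    (c : Bool) : ∃ s',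
    doubling.Steps (c, decide (r .u < 2 ^ j * r .v))
      { σ with file := regs n (doubled r j), hist := saved n r j } (d * (5 * unit n) + 1) s'
      { σ with file := regs n (doubled r k), hist := saved n r k } := by
  induction d generalizing j c with
  | zero =>
    obtain rfl : j = k := hj
    exact ⟨_, (within_loop_false (by simp [hk])).mono (by omega)⟩
  | succ d ih =>
    have hle := hk' j (by omega)
    have hpow : 2 ^ (j + 1) * r .v = 2 * (2 ^ j * r .v) := by ring
    have ht : 2 ^ j * r .t % r .modulus < r .modulus := Nat.mod_lt _ hM0
    obtain ⟨s', key⟩ := ih (j + 1) (by omega) false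
    have h1 := steps_saveRegs (n := n) (r := doubled r j) (s := (c, decide (r .u < 2 ^ j * r .v)))
      (σ := { σ with file := regs n (doubled r j), hist := saved n r j }) rfl hb
    have h2 := fun s => steps_addMod .v .v .v .zero n (doubled r j) s
      { σ with file := regs n (doubled r j), hist := saved n r (j + 1) } rfl hb
      (by simp [doubled]; omega) (by simp [doubled, hz])
    have h3 := fun s => steps_addMod .t .t .t .modulus n
      (Function.update (doubled r j) .v (2 ^ (j + 1) * r .v)) s
      { σ with
        file := regs n (Function.update (doubled r j) .v (2 ^ (j + 1) * r .v))
        hist := saved n r (j + 1) } rfl hb (by simp [doubled]; omega) (by simp [doubled]; omega)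
    have h4 := fun s => steps_compare (s := s) (n := n) (r := doubled r (j + 1)) .u .zero .v
      (σ := { σ with file := regs n (doubled r (j + 1)), hist := saved n r (j + 1) }) rfl hb
      (by simp [doubled, hz]; omega) (by simp [doubled]; omega)
    have e2 : Function.update (doubled r j) .v (if doubled r j .v + doubled r j .v < doubled r j .zero
        then doubled r j .v + doubled r j .v
        else doubled r j .v + doubled r j .v - doubled r j .zero) =
        Function.update (doubled r j) .v (2 ^ (j + 1) * r .v) := by
      congr 1
      simp [doubled, hz, pow_succ]
      ring
    have e3 : ∀ r' : Reg → ℕ, r' = Function.update (doubled r j) .v (2 ^ (j + 1) * r .v) →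
        Function.update r' .t (if r' .t + r' .t < r' .modulus then r' .t + r' .t
          else r' .t + r' .t - r' .modulus) = doubled r (j + 1) := by
      rintro r' rfl
      rw [mod_eq_ite (by simp [doubled]; omega)]
      funext k
      cases k <;> simp [doubled]
      congr 1
      ring
    simp only [e2] at h2
    simp only [e3 _ rfl] at h3
    -- the memory after the comparison is the one with which the next run starts
    have e4 : decide (doubled r (j + 1) .u + doubled r (j + 1) .zero < doubled r (j + 1) .v) =
        decide (r .u < 2 ^ (j + 1) * r .v) := by simp [doubled, hz]
    simp only [e4] at h4
    refine ⟨s', (Within.loop_true (by simpa using hle)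
      (h1.seq ((h2 _).seq ((h3 _).seq (h4 _)))) key).mono ?_⟩
    unfold unit
    rw [add_mul]
    omega

/-- Undoing the last doubling, one digit of the quotient of the number `U` in `u` is found, and the
multiple of `t` that belongs to this digit is added to the number `S` in `s`. -/
theorem steps_subtracting (hM : 2 * r .modulus < 2 ^ n)
    (hz : r .zero = 0) (hM0 : 0 < r .modulus) (hb : σ.back = [])
    (hn : σ.hist = []) (k : ℕ) (hk' : ∀ j < k, 2 ^ j * r .v < 2 ^ n) (U S : ℕ)
    (hU : U < 2 ^ n) (hk : U < 2 ^ k * r .v) (hS : S < r .modulus) : ∃ s',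
    subtracting.Steps s
      { σ with
        file := regs n (Function.update (Function.update (doubled r k) .u U) .s S)
        hist := saved n r k } (k * (5 * unit n) + 1) s'
      { σ with file := regs n (Function.update (Function.update (doubled r 0) .u (U % r .v)) .s
          ((S + U / r .v * r .t) % r .modulus)) } := by
  induction k generalizing U S s with
  | zero =>
    have hU' : U < r .v := by simpa using hk
    simp only [Nat.mod_eq_of_lt hU', Nat.div_eq_of_lt hU', zero_mul, add_zero, saved, ← hn,
      Nat.mod_eq_of_lt hS]
    exact ⟨_, within_loop_false (by simp [tops, Stacks.get, hn])⟩
  | succ k ih =>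
    have ht : 2 ^ k * r .t % r .modulus < r .modulus := Nat.mod_lt _ hM0
    have hv := hk' k (by omega)
    have hv0 : 0 < r .v := Nat.pos_of_mul_pos_left (by omega : 0 < 2 ^ (k + 1) * r .v)
    have hne : (tops (Stacks.get { σ with
        file := regs n (Function.update (Function.update (doubled r (k + 1)) .u U) .s S)
        hist := saved n r (k + 1) }) .hist).isSome = true := by
      obtain _ | n := n
      · omega
      · rfl
    set ρ := Function.update (Function.update (doubled r k) .u U) .s S with hρ
    have e1 : Function.update (Function.update (Function.update (Function.update
        (doubled r (k + 1)) .u U) .s S) .v (doubled r k .v)) .t (doubled r k .t) = ρ := by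
      funext j
      cases j <;> simp [hρ, doubled]
    have h1 := steps_restoreVT (s := s) (n := n) (r' := doubled r k) (rest := saved n r k)
      (σ := { σ with
        file := regs n (Function.update (Function.update (doubled r (k + 1)) .u U) .s S)
        hist := saved n r (k + 1) }) rfl hb rfl
    rw [e1] at h1
    have h2 := steps_addMod .u .u .zero .v n ρ s
      { σ with file := regs n ρ, hist := saved n r k } rfl hb
      (by simp [hρ, doubled, hz]; omega) (by simp [hρ, doubled]; omega)
    by_cases hlt : U < 2 ^ k * r .v
    · obtain ⟨s', key⟩ := ih (fun j hj => hk' j (by omega)) U S hU hlt hS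
        (s := (false, decide (ρ .u + ρ .zero < ρ .v)))
      have hc : ρ .u + ρ .zero < ρ .v := by simpa [hρ, doubled, hz] using hlt
      have e2 : Function.update ρ .u (ρ .u + ρ .zero) = ρ := by
        funext j
        cases j <;> simp [hρ, doubled, hz]
      rw [if_pos hc, e2] at h2
      refine ⟨s', (Within.loop_true hne (h1.seq (h2.seq
        (Within.ite_false (by simp [hc]) steps_skip))) key).mono ?_⟩
      unfold unit
      rw [add_mul]
      omega
    · have hc : ¬ ρ .u + ρ .zero < ρ .v := by simpa [hρ, doubled, hz] using hlt
      set U' := U - 2 ^ k * r .v with hU'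
      set S' := (S + 2 ^ k * r .t % r .modulus) % r .modulus with hS'
      obtain ⟨s', key⟩ := ih (fun j hj => hk' j (by omega)) U' S' (by omega)
        (by rw [pow_succ] at hk; rw [mul_right_comm] at hk; omega) (Nat.mod_lt _ hM0)
        (s := (false, decide (S + 2 ^ k * r .t % r .modulus < r .modulus)))
      rw [if_neg hc] at h2
      set ρ' := Function.update ρ .u (ρ .u + ρ .zero - ρ .v) with hρ'
      have h3 := fun s => steps_addMod .s .s .t .modulus n ρ' s
        { σ with file := regs n ρ', hist := saved n r k } rfl hb
        (by simp [hρ, hρ', doubled]; omega) (by simp [hρ, hρ', doubled]; omega)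
      have e3 : Function.update ρ' .s (if ρ' .s + ρ' .t < ρ' .modulus then ρ' .s + ρ' .t
          else ρ' .s + ρ' .t - ρ' .modulus) =
          Function.update (Function.update (doubled r k) .u U') .s S' := by
        rw [mod_eq_ite (by simp [hρ, hρ', doubled]; omega)]
        funext j
        cases j <;> simp [hρ, hρ', hU', hS', doubled, hz]
      rw [e3] at h3
      have e4 : decide (ρ' .s + ρ' .t < ρ' .modulus) =
          decide (S + 2 ^ k * r .t % r .modulus < r .modulus) := by
        simp [hρ, hρ', doubled]
      rw [e4] at h3
      have e5 : U' % r .v = U % r .v := by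
        rw [hU', mul_comm, Nat.sub_mul_mod (by rw [mul_comm]; omega)]
      have e6 : (S' + U' / r .v * r .t) % r .modulus =
          (S + U / r .v * r .t) % r .modulus := by
        have hq : U / r .v = U' / r .v + 2 ^ k := by
          rw [← Nat.add_mul_div_right _ _ hv0]
          congr 1
          omega
        have hS'' : S' ≡ S + 2 ^ k * r .t [MOD r .modulus] :=
          (Nat.mod_modEq _ _).trans ((Nat.mod_modEq _ _).add_left S)
        rw [hq, show S + (U' / r .v + 2 ^ k) * r .t = S + 2 ^ k * r .t + U' / r .v * r .t by ring]
        exact hS''.add_right _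
      rw [e5, e6] at key
      refine ⟨s', (Within.loop_true hne (h1.seq (h2.seq
        (Within.ite_true (by simp [hc]) (h3 _)))) key).mono ?_⟩
      unfold unit
      rw [add_mul]
      omega

/-- The number of doublings is the length of the quotient, so the cost of a division is proportional
to this length. -/
theorem steps_divide (hu : 2 * r .u < 2 ^ n) (hM : 2 * r .modulus < 2 ^ n)
    (hv : r .v < 2 ^ n) (hv0 : 0 < r .v) (hs : r .s < r .modulus) (ht : r .t < r .modulus)
    (hz : r .zero = 0) (hf : σ.file = regs n r) (hb : σ.back = []) (hh : σ.hist = []) :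
    ∃ s', divide.Steps s σ ((10 * (r .u / r .v).size + 2) * unit n) s'
      { σ with file := regs n (Function.update (Function.update r .u (r .u % r .v)) .s
          ((r .s + r .u / r .v * r .t) % r .modulus)) } := by
  have hM0 : 0 < r .modulus := by omega
  have hk : r .u < 2 ^ (r .u / r .v).size * r .v :=
    (Nat.div_lt_iff_lt_mul hv0).mp (Nat.lt_size_self _)
  have hk' : ∀ j < (r .u / r .v).size, 2 ^ j * r .v ≤ r .u := fun j hj =>
    (Nat.le_div_iff_mul_le hv0).mp (Nat.lt_size.mp hj)
  have e0 : doubled r 0 = r := by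
    funext j
    cases j <;> simp [doubled, Nat.mod_eq_of_lt ht]
  have h1 := steps_compare (s := s) .u .zero .v hf hb (by omega) (by omega)
  obtain ⟨s2, h2⟩ := steps_doubling hu hM hz hM0 hb hk hk' _ 0 (zero_add _) false
  obtain ⟨s3, h3⟩ := steps_subtracting (s := s2) hM hz hM0 hb hh _
    (fun j hj => (hk' j hj).trans_lt (by omega)) (r .u) (r .s) (by omega) hk hs
  have e1 : Function.update (Function.update (doubled r (r .u / r .v).size) .u (r .u)) .s (r .s) =
      doubled r (r .u / r .v).size := by
    funext j
    cases j <;> simp [doubled]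
  have e2 : { σ with file := regs n r, hist := saved n r 0 } = σ := by
    cases σ
    simp_all [saved]
  rw [e0, e2] at h2
  rw [e0, e1] at h3
  simp only [hz, add_zero, pow_zero, one_mul] at h1 h2
  refine ⟨s3, (h1.seq (h2.seq h3)).mono ?_⟩
  have : 2 ≤ unit n := by unfold unit; omega
  nlinarith

end StackProg

namespace StackProg

variable {n : ℕ} {r : Reg → ℕ} {s : Mem} {σ : Stacks}

/-- The effect of `addMod`, with a given value of the result. -/
theorem steps_assign {dst x y m : Reg} (val : ℕ) (hf : σ.file = regs n r) (hb : σ.back = [])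
    (hxy : r x + r y < 2 ^ n) (hm : r m < 2 ^ n)
    (hval : (if r x + r y < r m then r x + r y else r x + r y - r m) = val) :
    (addMod dst x y m).Steps s σ (unit n) (false, decide (r x + r y < r m))
      { σ with file := regs n (Function.update r dst val) } :=
  hval ▸ steps_addMod dst x y m n r s σ hf hb hxy hm

/-! ### The Euclidean algorithm and the Gauss idempotents -/

/-- Exchange `u` and `v`, and replace `(s, t)` by `(-t, -s)`, modulo `modulus`. The signs alternate
because a division adds a multiple of `t` to `s`. -/
def exchange : Prog :=
  seq (addMod .tmp .u .zero .zero) <| seq (addMod .u .v .zero .zero) <|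
  seq (addMod .v .tmp .zero .zero) <| seq (addMod .tmp .modulus .zero .t) <|
  seq (addMod .tmp .tmp .zero .modulus) <| seq (addMod .t .modulus .zero .s) <|
  seq (addMod .t .t .zero .modulus) (addMod .s .tmp .zero .zero)

/-- The registers after `exchange`. -/
def exchanged (r : Reg → ℕ) : Reg → ℕ
  | .u => r .v
  | .v => r .u
  | .s => (r .modulus - r .t) % r .modulus
  | .t => (r .modulus - r .s) % r .modulus
  | .tmp => (r .modulus - r .t) % r .modulus
  | k => r k

theorem steps_exchange (hu : r .u < 2 ^ n) (hv : r .v < 2 ^ n) (hM : 2 * r .modulus < 2 ^ n)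
    (hs : r .s < r .modulus) (ht : r .t < r .modulus)
    (hz : r .zero = 0) (hf : σ.file = regs n r) (hb : σ.back = []) :
    ∃ s', exchange.Steps s σ (8 * unit n) s' { σ with file := regs n (exchanged r) } := by
  have hM0 : 0 < r .modulus := by omega
  have hmt := Nat.mod_lt (r .modulus - r .t) hM0
  have hms := Nat.mod_lt (r .modulus - r .s) hM0
  have h1 := steps_assign (s := s) (dst := .tmp) (x := .u) (y := .zero) (m := .zero) (r .u) hf hb
    (by simp [hz]; omega) (by simp [hz]) (by simp [hz])
  have h2 := fun r' (hr' : r' = Function.update r .tmp (r .u)) s =>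
    steps_assign (s := s) (dst := .u) (x := .v) (y := .zero) (m := .zero)
    (r := r') (σ := { σ with file := regs n r' }) (r .v) rfl hb
    (by simp [hz, hr']; omega) (by simp [hz, hr']) (by simp [hz, hr'])
  have h3 := fun r' (hr' : r' = Function.update (Function.update r .tmp (r .u)) .u (r .v)) s =>
    steps_assign (s := s) (dst := .v) (x := .tmp) (y := .zero) (m := .zero)
    (r := r') (σ := { σ with file := regs n r' }) (r .u) rfl hb
    (by simp [hz, hr']; omega) (by simp [hz, hr']) (by simp [hz, hr'])
  have h4 := fun r' (hr' : r' = Function.update (Function.update (Function.update r .tmp (r .u))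
      .u (r .v)) .v (r .u)) s =>
    steps_assign (s := s) (dst := .tmp) (x := .modulus) (y := .zero) (m := .t)
    (r := r') (σ := { σ with file := regs n r' }) (r .modulus - r .t) rfl hb
    (by simp [hz, hr']; omega) (by simp [hr']; omega) (by simp [hz, hr']; omega)
  have h5 := fun r' (hr' : r' = Function.update (Function.update (Function.update (Function.update r
      .tmp (r .u)) .u (r .v)) .v (r .u)) .tmp (r .modulus - r .t)) s =>
    steps_assign (s := s) (dst := .tmp) (x := .tmp) (y := .zero) (m := .modulus)
    (r := r') (σ := { σ with file := regs n r' }) ((r .modulus - r .t) % r .modulus) rfl hb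
    (by simp [hz, hr']; omega) (by simp [hr']; omega)
    (by rw [mod_eq_ite (by simp [hz, hr']; omega)]; simp [hz, hr'])
  have h6 := fun r' (hr' : r' = Function.update (Function.update (Function.update (Function.update
      (Function.update r .tmp (r .u)) .u (r .v)) .v (r .u)) .tmp (r .modulus - r .t))
      .tmp ((r .modulus - r .t) % r .modulus)) s =>
    steps_assign (s := s) (dst := .t) (x := .modulus) (y := .zero) (m := .s)
    (r := r') (σ := { σ with file := regs n r' }) (r .modulus - r .s) rfl hb
    (by simp [hz, hr']; omega) (by simp [hr']; omega) (by simp [hz, hr']; omega)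
  have h7 := fun r' (hr' : r' = Function.update (Function.update (Function.update (Function.update
      (Function.update (Function.update r .tmp (r .u)) .u (r .v)) .v (r .u))
      .tmp (r .modulus - r .t)) .tmp ((r .modulus - r .t) % r .modulus)) .t (r .modulus - r .s)) s =>
    steps_assign (s := s) (dst := .t) (x := .t) (y := .zero) (m := .modulus)
    (r := r') (σ := { σ with file := regs n r' }) ((r .modulus - r .s) % r .modulus) rfl hb
    (by simp [hz, hr']; omega) (by simp [hr']; omega)
    (by rw [mod_eq_ite (by simp [hz, hr']; omega)]; simp [hz, hr'])
  have h8 := fun r' (hr' : r' = Function.update (Function.update (Function.update (Function.update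
      (Function.update (Function.update (Function.update r .tmp (r .u)) .u (r .v)) .v (r .u))
      .tmp (r .modulus - r .t)) .tmp ((r .modulus - r .t) % r .modulus)) .t (r .modulus - r .s))
      .t ((r .modulus - r .s) % r .modulus)) s =>
    steps_assign (s := s) (dst := .s) (x := .tmp) (y := .zero) (m := .zero)
    (r := r') (σ := { σ with file := regs n r' }) ((r .modulus - r .t) % r .modulus) rfl hb
    (by simp [hz, hr']; omega) (by simp [hz, hr']) (by simp [hz, hr'])
  refine ⟨_, ((h1.seq ((h2 _ rfl _).seq ((h3 _ rfl _).seq ((h4 _ rfl _).seq ((h5 _ rfl _).seq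
    ((h6 _ rfl _).seq ((h7 _ rfl _).seq (h8 _ rfl _)))))))).mono ?_).congr ?_⟩
  · omega
  · have e : ∀ r' : Reg → ℕ, r' = exchanged r → ∀ k, Stacks.get { σ with file := regs n r' } k =
        Stacks.get { σ with file := regs n (exchanged r) } k := by
      rintro _ rfl k
      rfl
    refine e _ (funext fun j => ?_)
    cases j <;> simp [exchanged]

/-- The invariant of the Euclidean algorithm that computes `G` modulo `M`, if `u` and `v` are
coprime: `s = u * G` and `t = -(v * G)`. -/
structure EuclidInv (n M : ℕ) (G : ZMod M) (r : Reg → ℕ) : Prop where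
  modulus : r .modulus = M
  zero : r .zero = 0
  one : r .one = 1
  hM : 2 * M < 2 ^ n
  hu : 2 * r .u < 2 ^ n
  hv : 2 * r .v < 2 ^ n
  hs : r .s < M
  ht : r .t < M
  coprime : Nat.Coprime (r .u) (r .v)
  s_eq : (r .s : ZMod M) = r .u * G
  t_eq : (r .t : ZMod M) = -(r .v * G)

/-- The body of the loop of the Euclidean algorithm. -/
def euclidBody : Prog := seq divide (seq exchange (compare .zero .zero .v))

theorem steps_euclidBody {M : ℕ} {G : ZMod M} (h : EuclidInv n M G r) (hv0 : 0 < r .v)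
    (hf : σ.file = regs n r) (hb : σ.back = []) (hh : σ.hist = []) :
    ∃ r', EuclidInv n M G r' ∧ r' .u = r .v ∧ r' .v = r .u % r .v ∧
      euclidBody.Steps s σ ((10 * (r .u / r .v).size + 11) * unit n) (false, decide (0 < r' .v))
        { σ with file := regs n r' } := by
  obtain ⟨rfl, hz, ho, hM, hu, hv, hs, ht, hc, hse, hte⟩ := h
  have hM0 : 0 < r .modulus := by omega
  set r1 := Function.update (Function.update r .u (r .u % r .v)) .s
    ((r .s + r .u / r .v * r .t) % r .modulus) with hr1
  obtain ⟨s1, h1⟩ := steps_divide (s := s) hu hM (by omega) hv0 hs ht hz hf hb hh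
  have hmod := Nat.mod_lt (r .u) hv0
  have hs1 : (r .s + r .u / r .v * r .t) % r .modulus < r .modulus := Nat.mod_lt _ hM0
  obtain ⟨s2, h2⟩ := steps_exchange (s := s1) (r := r1) (σ := { σ with file := regs n r1 })
    (n := n) (by simp [hr1]; omega) (by simp [hr1]; omega) (by simp [hr1]; omega)
    (by simp [hr1]; omega) (by simp [hr1]; omega) (by simp [hr1]; omega) rfl hb
  have h3 := steps_compare (s := s2) (r := exchanged r1) (n := n)
    (σ := { σ with file := regs n (exchanged r1) }) .zero .zero .v rfl hb
    (by simp [hr1, exchanged, hz]) (by simp [hr1, exchanged]; omega)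
  have h4 := h1.seq (h2.seq h3)
  simp only [show exchanged r1 .zero = 0 from by simp [hr1, exchanged, hz], add_zero] at h4
  have hs1e : ((r .s + r .u / r .v * r .t) % r .modulus : ℕ) =
      (((r .u % r .v : ℕ) : ZMod (r .modulus)) * G) := by
    have hdm : ((r .u : ℕ) : ZMod (r .modulus)) =
        (r .v : ZMod (r .modulus)) * (r .u / r .v : ℕ) + (r .u % r .v : ℕ) := by
      rw [← Nat.cast_mul, ← Nat.cast_add, Nat.div_add_mod]
    rw [ZMod.natCast_mod, Nat.cast_add, Nat.cast_mul, hse, hte, hdm]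
    ring
  refine ⟨exchanged r1, ⟨?_, ?_, ?_, hM, ?_, ?_, ?_, ?_, ?_, ?_, ?_⟩, ?_, ?_, h4.mono ?_⟩
  · simp [exchanged, hr1]
  · simp [exchanged, hr1, hz]
  · simp [exchanged, hr1, ho]
  · simp [exchanged, hr1]; omega
  · simp [exchanged, hr1]; omega
  · simp only [exchanged, hr1]
    exact Nat.mod_lt _ (by simpa using hM0)
  · simp only [exchanged, hr1]
    exact Nat.mod_lt _ (by simpa using hM0)
  · simp only [exchanged, hr1]
    simp only [ne_eq, reduceCtorEq, not_false_eq_true, Function.update_of_ne, Function.update_self]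
    rw [Nat.Coprime, Nat.gcd_comm, ← Nat.gcd_rec, Nat.gcd_comm]
    exact hc
  · simp [exchanged, hr1, Nat.cast_sub ht.le, hte]
  · have e : exchanged r1 .t =
        (r .modulus - (r .s + r .u / r .v * r .t) % r .modulus) % r .modulus := by
      simp [exchanged, hr1]
    have e' : exchanged r1 .v = r .u % r .v := by simp [exchanged, hr1]
    rw [e, e', ZMod.natCast_mod, Nat.cast_sub hs1.le, hs1e, ZMod.natCast_self, zero_sub]
  · simp [exchanged, hr1]
  · simp [exchanged, hr1]
  · have : 1 ≤ unit n := by unfold unit; omega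
    nlinarith

/-- The loop of the Euclidean algorithm. -/
def euclidLoop : Prog := loop (fun s _ => s.2) euclidBody

theorem size_div_le {u v : ℕ} (hv : 0 < v) (huv : v ≤ u) :
    (u / v).size + v.size ≤ u.size + 1 := by
  have h1 : u < 2 ^ u.size := Nat.lt_size_self u
  have hv1 : 0 < v.size := Nat.size_pos.mpr hv
  have h2 : 2 ^ (v.size - 1) ≤ v := Nat.lt_size.mp (by omega)
  have h3 : v.size ≤ u.size := Nat.size_le_size huv
  have : (u / v).size ≤ u.size + 1 - v.size := by
    rw [Nat.size_le, Nat.div_lt_iff_lt_mul hv]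
    calc u < 2 ^ u.size := h1
      _ = 2 ^ (u.size + 1 - v.size) * 2 ^ (v.size - 1) := by rw [← pow_add]; congr 1; omega
      _ ≤ _ := Nat.mul_le_mul_left _ h2
  omega

theorem size_mod_lt {u v : ℕ} (hv : 0 < v) (huv : v ≤ u) : (u % v).size + 1 ≤ u.size := by
  have h0 : 0 < u.size := Nat.size_pos.mpr (hv.trans_le huv)
  have h1 : u < 2 ^ u.size := Nat.lt_size_self u
  have h2 : 2 * (u % v) < u := by
    have := Nat.mod_lt u hv
    have := Nat.mod_add_div u v
    have : v * 1 ≤ v * (u / v) := Nat.mul_le_mul_left _ (Nat.div_pos huv hv)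
    omega
  have : (u % v).size ≤ u.size - 1 := by
    rw [Nat.size_le]
    have : 2 ^ u.size = 2 * 2 ^ (u.size - 1) := by rw [← pow_succ']; congr 1; omega
    omega
  omega

theorem add_units_le {a b U : ℕ} (hU : 1 ≤ U) : a * U + b * U + 1 ≤ (a + b + 1) * U := by
  rw [add_mul, add_mul]
  omega

/-- A division of `u` by `v` takes a time proportional to the length of the quotient, which is about
`size u - size v`. The weight `size u + 2 * size v` decreases by enough to pay for it, so the whole
Euclidean algorithm takes only `O(n)` register operations. -/
theorem steps_euclidLoop_of_le {M : ℕ} {G : ZMod M} (hb : σ.back = []) (hh : σ.hist = []) (c : Bool)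
    (h : EuclidInv n M G r) (hvu : r .v ≤ r .u) :
    ∃ r' s', r' .modulus = M ∧ r' .zero = 0 ∧ r' .one = 1 ∧ r' .s < M ∧
      (r' .s : ZMod M) = G ∧
      euclidLoop.Steps (c, decide (0 < r .v)) { σ with file := regs n r }
        ((32 * ((r .u).size + 2 * (r .v).size) + 1) * unit n) s' { σ with file := regs n r' } := by
  induction hv : r .v using Nat.strong_induction_on generalizing r c with
  | _ v ih =>
    subst hv
    have hunit : 1 ≤ unit n := by unfold unit; omega
    rcases Nat.eq_zero_or_pos (r .v) with hv0 | hv0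
    · have hu : r .u = 1 := by simpa [hv0] using h.coprime
      refine ⟨r, _, h.modulus, h.zero, h.one, h.hs, by rw [h.s_eq, hu]; simp,
        Within.mono (within_loop_false (by simp [hv0])) ?_⟩
      nlinarith
    · obtain ⟨r1, h1, hu1, hv1, hr1⟩ := steps_euclidBody (s := (c, decide (0 < r .v)))
        (σ := { σ with file := regs n r }) h hv0 rfl hb hh
      have hlt : r .u % r .v < r .v := Nat.mod_lt _ hv0
      obtain ⟨r2, s2, a1, a2, a3, a4, a5, hr2⟩ := ih (r1 .v) (by omega) false h1 (by omega) rfl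
      refine ⟨r2, s2, a1, a2, a3, a4, a5, (Within.loop_true (by simpa using hv0) hr1 hr2).mono ?_⟩
      have k1 := size_div_le hv0 hvu
      have k2 := size_mod_lt hv0 hvu
      have k3 : (r .u % r .v).size ≤ (r .v).size := Nat.size_le_size hlt.le
      rw [hu1, hv1]
      exact (add_units_le hunit).trans (Nat.mul_le_mul_right _ (by omega))

/-- If `u < v`, a first division exchanges the two numbers. -/
theorem steps_euclidLoop {M : ℕ} {G : ZMod M} (hb : σ.back = []) (hh : σ.hist = []) (c : Bool)
    (h : EuclidInv n M G r) :
    ∃ r' s', r' .modulus = M ∧ r' .zero = 0 ∧ r' .one = 1 ∧ r' .s < M ∧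
      (r' .s : ZMod M) = G ∧
      euclidLoop.Steps (c, decide (0 < r .v)) { σ with file := regs n r }
        ((96 * n + 13) * unit n) s' { σ with file := regs n r' } := by
  have hu : (r .u).size ≤ n := Nat.size_le.mpr (by have := h.hu; omega)
  have hv : (r .v).size ≤ n := Nat.size_le.mpr (by have := h.hv; omega)
  rcases le_or_gt (r .v) (r .u) with hvu | huv
  · obtain ⟨r2, s2, a1, a2, a3, a4, a5, hr2⟩ := steps_euclidLoop_of_le hb hh c h hvu
    exact ⟨r2, s2, a1, a2, a3, a4, a5, hr2.mono (Nat.mul_le_mul_right _ (by omega))⟩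
  · obtain ⟨r1, h1, hu1, hv1, hr1⟩ := steps_euclidBody (s := (c, decide (0 < r .v)))
      (σ := { σ with file := regs n r }) h (by omega) rfl hb hh
    rw [Nat.mod_eq_of_lt huv] at hv1
    obtain ⟨r2, s2, a1, a2, a3, a4, a5, hr2⟩ :=
      steps_euclidLoop_of_le (σ := { σ with file := regs n r }) hb hh false h1 (by omega)
    refine ⟨r2, s2, a1, a2, a3, a4, a5,
      (Within.loop_true (by simp; omega) hr1 hr2).mono ?_⟩
    rw [hu1, hv1, Nat.div_eq_of_lt huv]
    exact (add_units_le (by unfold unit; omega)).trans (Nat.mul_le_mul_right _ (by simp; omega))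

/-- If `v` divides `modulus` and is coprime to the quotient, assign to `s` the residue that is `1`
modulo `v` and `0` modulo the quotient. The division yields the quotient `modulus / v` in `s`; the
Euclidean algorithm starts with this quotient in `u` and `s`, and with `0` in `t`. -/
def gauss : Prog :=
  seq (addMod .u .modulus .zero .zero) <| seq (addMod .s .zero .zero .zero) <|
  seq (addMod .t .one .zero .modulus) <| seq divide <|
  seq (addMod .u .s .zero .zero) <| seq (addMod .t .zero .zero .zero) <|
  seq (compare .zero .zero .v) euclidLoop

/-- The idempotent `G` enters only through the products `(M / v) * G` and `v * G`: these two
equations are the invariant at the start of the Euclidean algorithm, and at its end `u = 1` and `s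
= G`. -/
theorem steps_gauss {M : ℕ} {G : ZMod M} (hM0 : 0 < M) (hM : 2 * M < 2 ^ n)
    (hmod : r .modulus = M) (hz : r .zero = 0) (ho : r .one = 1) (hdvd : r .v ∣ M)
    (hc : Nat.Coprime (M / r .v) (r .v)) (hG : ((M / r .v : ℕ) : ZMod M) * G = (M / r .v : ℕ))
    (hG' : (r .v : ZMod M) * G = 0)
    (hf : σ.file = regs n r) (hb : σ.back = []) (hh : σ.hist = []) :
    ∃ r' s', r' .modulus = M ∧ r' .zero = 0 ∧ r' .one = 1 ∧ r' .s < M ∧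
      (r' .s : ZMod M) = G ∧
      gauss.Steps s σ ((106 * n + 21) * unit n) s' { σ with file := regs n r' } := by
  subst hmod
  have hv0 : 0 < r .v := Nat.pos_of_dvd_of_pos hdvd hM0
  have hvM : r .v ≤ r .modulus := Nat.le_of_dvd hM0 hdvd
  have h12 : 1 < 2 ^ n := by omega
  have h1M : 1 % r .modulus < r .modulus := Nat.mod_lt _ hM0
  set r1 := Function.update r .u (r .modulus) with hr1
  set r2 := Function.update r1 .s 0 with hr2
  set r3 := Function.update r2 .t (1 % r .modulus) with hr3
  have h1 := steps_assign (s := s) (dst := .u) (x := .modulus) (y := .zero) (m := .zero)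
    (r .modulus) hf hb (by simp [hz]; omega) (by simp [hz]) (by simp [hz])
  have h2 := fun s => steps_assign (s := s) (dst := .s) (x := .zero) (y := .zero) (m := .zero)
    (r := r1) (n := n) (σ := { σ with file := regs n r1 }) 0 rfl hb
    (by simp [hz, hr1]) (by simp [hz, hr1]) (by simp [hz, hr1])
  have h3 := fun s => steps_assign (s := s) (dst := .t) (x := .one) (y := .zero) (m := .modulus)
    (r := r2) (n := n) (σ := { σ with file := regs n r2 }) (1 % r .modulus) rfl hb
    (by simpa [hz, hr1, hr2, ho] using h12) (by simp [hr1, hr2]; omega)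
    (by rw [mod_eq_ite (by simp [hz, hr1, hr2, ho]; omega)]; simp [hz, hr1, hr2, ho])
  obtain ⟨s4, h4⟩ := steps_divide (n := n) (r := r3) (s := (false, decide (1 < r .modulus)))
    (σ := { σ with file := regs n r3 })
    (by simp [hr1, hr2, hr3]; omega) (by simp [hr1, hr2, hr3]; omega)
    (by simp [hr1, hr2, hr3]; omega) (by simp [hr1, hr2, hr3]; omega)
    (by simp [hr1, hr2, hr3]; omega) (by simpa [hr1, hr2, hr3] using h1M)
    (by simp [hr1, hr2, hr3, hz]) rfl hb hh
  have ediv : (r3 .s + r3 .u / r3 .v * r3 .t) % r3 .modulus =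
      (r .modulus / r .v) % r .modulus := by
    simp only [hr1, hr2, hr3]
    simp
  have e0 : r3 .u % r3 .v = 0 := by
    simp only [hr1, hr2, hr3]
    simpa using Nat.mod_eq_zero_of_dvd hdvd
  have esz : r3 .u / r3 .v = r .modulus / r .v := by simp [hr1, hr2, hr3]
  have eb : r2 .one + r2 .zero = 1 := by simp [hr1, hr2, ho, hz]
  have eb' : r2 .modulus = r .modulus := by simp [hr1, hr2]
  simp only [eb, eb'] at h3
  rw [ediv, e0, esz] at h4
  -- `modulus / v` is reduced modulo `modulus`, which matters only for `v = 1`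
  set U := (r .modulus / r .v) % r .modulus with hU
  have hUM : U < r .modulus := Nat.mod_lt _ hM0
  set r4 := Function.update (Function.update r3 .u 0) .s U with hr4
  set r5 := Function.update r4 .u U with hr5
  set r6 := Function.update r5 .t 0 with hr6
  have h5 := fun s => steps_assign (s := s) (dst := .u) (x := .s) (y := .zero) (m := .zero)
    (r := r4) (n := n) (σ := { σ with file := regs n r4 }) U rfl hb
    (by simp [hz, hr1, hr2, hr3, hr4]; omega) (by simp [hz, hr1, hr2, hr3, hr4])
    (by simp [hz, hr1, hr2, hr3, hr4])
  have h6 := fun s => steps_assign (s := s) (dst := .t) (x := .zero) (y := .zero) (m := .zero)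
    (r := r5) (n := n) (σ := { σ with file := regs n r5 }) 0 rfl hb
    (by simp [hz, hr1, hr2, hr3, hr4, hr5]) (by simp [hz, hr1, hr2, hr3, hr4, hr5])
    (by simp [hz, hr1, hr2, hr3, hr4, hr5])
  have h7 := fun s => steps_compare (s := s) .zero .zero .v
    (r := r6) (n := n) (σ := { σ with file := regs n r6 }) rfl hb
    (by simp [hz, hr1, hr2, hr3, hr4, hr5, hr6]) (by simp [hr1, hr2, hr3, hr4, hr5, hr6]; omega)
  have hdv : U % r .v = (r .modulus / r .v) % r .v := by
    rw [hU, Nat.mod_mod_of_dvd _ hdvd]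
  have inv : EuclidInv n (r .modulus) G r6 := by
    have eu : r6 .u = U := by simp [hr1, hr2, hr3, hr4, hr5, hr6]
    have es : r6 .s = U := by simp [hr1, hr2, hr3, hr4, hr5, hr6]
    have ev : r6 .v = r .v := by simp [hr1, hr2, hr3, hr4, hr5, hr6]
    have et : r6 .t = 0 := by simp [hr6]
    refine ⟨by simp [hr1, hr2, hr3, hr4, hr5, hr6], by simp [hr1, hr2, hr3, hr4, hr5, hr6, hz],
      by simp [hr1, hr2, hr3, hr4, hr5, hr6, ho], hM, by omega, by omega, by omega, by omega, ?_,
      ?_, ?_⟩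
    · rw [eu, ev, Nat.Coprime, Nat.gcd_comm, Nat.gcd_rec, hdv, ← Nat.gcd_rec, Nat.gcd_comm]
      exact hc
    · rw [es, eu, hU, ZMod.natCast_mod, hG]
    · rw [et, ev, hG', Nat.cast_zero, neg_zero]
  obtain ⟨r', s', b1, b2, b3, b4, b5, h8⟩ :=
    steps_euclidLoop (σ := { σ with file := regs n r6 }) hb hh false inv
  have ez : r6 .zero = 0 := inv.zero
  simp only [ez, add_zero] at h7
  refine ⟨r', s', b1, b2, b3, b4, b5, (h1.seq ((h2 _).seq ((h3 _).seq (h4.seq ((h5 _).seq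
    ((h6 _).seq ((h7 _).seq h8))))))).mono ?_⟩
  have hsz : (r .modulus / r .v).size ≤ n := by
    rw [Nat.size_le]
    exact (Nat.div_le_self _ _).trans_lt (by omega)
  calc _ = (10 * (r .modulus / r .v).size + (96 * n + 21)) * unit n := by ring
    _ ≤ _ := Nat.mul_le_mul_right _ (by omega)

end StackProg

/-- The number with the binary digits `w`, the highest one first, preceded by the digits of `a`. -/
def binVal (a : ℕ) (w : List Bool) : ℕ := w.foldl (fun a b => 2 * a + b.toNat) a

theorem le_binVal (a : ℕ) (w : List Bool) : a ≤ binVal a w := by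
  induction w generalizing a with
  | nil => exact le_rfl
  | cons b w ih => exact le_trans (by omega) (ih (2 * a + b.toNat))

theorem binVal_reverse_bits (x : ℕ) : binVal 0 (Nat.bits x).reverse = x := by
  rw [binVal, List.foldl_reverse]
  induction x using Nat.binaryRec' with
  | zero => simp
  | bit b n h ih =>
    rw [Nat.bits_append_bit n b h, List.foldr_cons, ih, Nat.bit_val]

namespace StackProg

variable {n : ℕ} {r : Reg → ℕ} {s : Mem} {σ : Stacks}

/-! ### Horner's scheme -/

/-- Whether the top of a stack is a binary digit. -/
def isBit : Option Symb → Bool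
  | some (.inl (.bit _)) => true
  | _ => false

/-- Whether the top of a stack is the binary digit `1`. -/
def isOne : Option Symb → Bool
  | some (.inl (.bit b)) => b
  | _ => false

/-- Whether the top of a stack is a comma. -/
def isComma : Option Symb → Bool
  | some (.inl .comma) => true
  | _ => false

/-- For each binary digit on top of the stack `k`, which is removed by `pop`, double the register
`acc`, and add the register `mul` if the digit is `1`, modulo the register `md`. -/
def horner (k : Stk) (pop : Prog) (acc mul md : Reg) : Prog :=
  loop (fun _ h => isBit (h k)) <| ite (fun _ h => isOne (h k))
    (seq pop (seq (addMod acc acc acc md) (addMod acc acc mul md)))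
    (seq pop (addMod acc acc acc md))

theorem ite_eq_mod {x m : ℕ} (h : m = 0 ∨ x < 2 * m) : (if x < m then x else x - m) = x % m := by
  rcases h with rfl | h
  · simp
  · exact mod_eq_ite h

/-- The modulus `0` stands for the absence of a reduction. The function `st` describes the stacks
when the digits `w` remain and the registers are `ρ`, and `a` is the number whose digits have been
read before. -/
theorem steps_horner {k : Stk} {pop : Prog} {acc mul md : Reg}
    (st : List Bool → (Reg → ℕ) → Stacks) (hfile : ∀ w ρ, (st w ρ).file = regs n ρ)
    (hback : ∀ w ρ, (st w ρ).back = [])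
    (hset : ∀ w ρ ρ', { st w ρ with file := regs n ρ' } = st w ρ')
    (hpop : ∀ b w ρ s, pop.Steps s (st (b :: w) ρ) 1 s (st w ρ))
    (htop : ∀ b w ρ, tops (st (b :: w) ρ).get k = some (.inl (.bit b)))
    (hend : ∀ ρ, isBit (tops (st [] ρ).get k) = false) (hmul : mul ≠ acc) (hmd : md ≠ acc)
    (w : List Bool) (a : ℕ) (ha : r acc = a * r mul % r md)
    (hfit : (r md = 0 ∧ binVal a w * r mul < 2 ^ n) ∨
      (2 * r md < 2 ^ n ∧ r mul < r md)) :
    ∃ s', (horner k pop acc mul md).Steps s (st w r) ((3 * w.length + 1) * unit n) s'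
      (st [] (Function.update r acc (binVal a w * r mul % r md))) := by
  induction w generalizing a r s with
  | nil =>
    have e : Function.update r acc (binVal a [] * r mul % r md) = r := by
      rw [show binVal a [] = a from rfl, ← ha, Function.update_eq_self]
    rw [e]
    exact ⟨s, Within.mono (within_loop_false (hend r)) (by unfold unit; simp)⟩
  | cons b w ih =>
    have hb1 : b.toNat ≤ 1 := Bool.toNat_le b
    have hle : (2 * a + b.toNat) * r mul ≤ binVal a (b :: w) * r mul :=
      Nat.mul_le_mul_right _ (le_binVal (2 * a + b.toNat) w)
    have hexp : (2 * a + b.toNat) * r mul = a * r mul + a * r mul + b.toNat * r mul := by ring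
    have hmd2 : r md = 0 ∨ a * r mul % r md < r md := by
      rcases hfit with h | h
      · exact Or.inl h.1
      · exact Or.inr (Nat.mod_lt _ (by omega))
    have hA : a * r mul % r md + a * r mul % r md < 2 ^ n := by
      have := Nat.mod_le (a * r mul) (r md)
      rcases hfit with h | h <;> omega
    have hmdn : r md < 2 ^ n := by
      have : 0 < 2 ^ n := by positivity
      rcases hfit with h | h <;> omega
    set r1 := Function.update r acc (2 * a * r mul % r md) with hr1
    have h2 := fun s => steps_assign (s := s) (dst := acc) (x := acc) (y := acc) (m := md) (n := n)
      (r := r) (σ := st w r) (2 * a * r mul % r md) (hfile w r) (hback w r)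
      (by rw [ha]; exact hA) hmdn
      (by
        rw [ite_eq_mod (by rw [ha]; omega), ha, ← Nat.add_mod]
        congr 1
        ring)
    simp only [hset] at h2
    have hunit : 4 ≤ unit n := by unfold unit; omega
    cases b with
    | false =>
      obtain ⟨s', key⟩ := ih (r := r1) (s := (false, decide (r acc + r acc < r md))) (2 * a)
        (by simp [hr1, hmul, hmd])
        (by simpa [hr1, hmul, hmd, binVal] using hfit)
      have e : Function.update r1 acc (binVal (2 * a) w * r1 mul % r1 md) =
          Function.update r acc (binVal a (false :: w) * r mul % r md) := by
        simp [hr1, hmul, hmd, binVal]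
      rw [e] at key
      refine ⟨s', (Within.loop_true (by rw [htop]; rfl) (Within.ite_false (by rw [htop]; rfl)
        ((hpop false w r s).seq (h2 _))) key).mono ?_⟩
      simp only [List.length_cons]
      ring_nf
      omega
    | true =>
      have h2m : 2 * a * r mul = a * r mul + a * r mul := by ring
      have hA2 : 2 * a * r mul % r md + r mul < 2 ^ n := by
        have h1 := Nat.mod_le (2 * a * r mul) (r md)
        rcases hfit with h | h
        · simp at hle hexp; omega
        · have := Nat.mod_lt (2 * a * r mul) (show r md > 0 by omega)
          omega
      set r2 := Function.update r acc ((2 * a + 1) * r mul % r md) with hr2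
      have h3 := fun s => steps_assign (s := s) (dst := acc) (x := acc) (y := mul) (m := md) (n := n)
        (r := r1) (σ := st w r1) ((2 * a + 1) * r mul % r md) (hfile w r1) (hback w r1)
        (by simpa [hr1, hmul] using hA2) (by simpa [hr1, hmd] using hmdn)
        (by
          have e1 : r1 acc = 2 * a * r mul % r md := by simp [hr1]
          have e2 : r1 mul = r mul := by simp [hr1, hmul]
          have e3 : r1 md = r md := by simp [hr1, hmd]
          rw [e1, e2, e3, ite_eq_mod (by
            rcases hfit with h | h
            · exact Or.inl h.1
            · have := Nat.mod_lt (2 * a * r mul) (show r md > 0 by omega)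
              omega), Nat.mod_add_mod]
          congr 1
          ring)
      simp only [hset] at h3
      have e0 : Function.update r1 acc ((2 * a + 1) * r mul % r md) = r2 := by
        simp [hr1, hr2]
      simp only [e0] at h3
      obtain ⟨s', key⟩ := ih (r := r2) (s := (false, decide (r1 acc + r1 mul < r1 md))) (2 * a + 1)
        (by simp [hr2, hmul, hmd])
        (by simpa [hr2, hmul, hmd, binVal] using hfit)
      have e : Function.update r2 acc (binVal (2 * a + 1) w * r2 mul % r2 md) =
          Function.update r acc (binVal a (true :: w) * r mul % r md) := by
        simp [hr2, hmul, hmd, binVal]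
      rw [e] at key
      refine ⟨s', (Within.loop_true (by rw [htop]; rfl) (Within.ite_true (by rw [htop]; rfl)
        ((hpop true w r s).seq ((h2 _).seq (h3 _)))) key).mono ?_⟩
      simp only [List.length_cons]
      ring_nf
      omega

end StackProg

/-- A number in binary, the highest digit first, preceded by a comma: the encoding of a number as it
is found on a stack after having been read. -/
def numWord (x : ℕ) : List Symb :=
  .inl .comma :: (Nat.bits x).reverse.map fun b => .inl (.bit b)

theorem length_numWord (x : ℕ) : (numWord x).length = x.size + 1 := by
  simp [numWord, Nat.size_eq_bits_len]

namespace StackProg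

variable {n : ℕ} {r : Reg → ℕ} {s : Mem} {σ : Stacks}

/-- Remove the top of the stack `k`. -/
def popFrom (k : Stk) : Prog := act fun s _ => (s, fun j => if j = k then .pop else .keep)

theorem steps_popFrom {k : Stk} {σ' : Stacks} (hk : σ'.get k = (σ.get k).tail)
    (hj : ∀ j, j ≠ k → σ'.get j = σ.get j) : (popFrom k).Steps s σ 1 s σ' :=
  steps_act rfl fun j => by
    by_cases h : j = k
    · subst h
      simp [StackAct.apply, hk]
    · simp [StackAct.apply, h, hj j h]

theorem isBit_head {l : List ℕ} {rest : List Symb} (h : isBit rest.head? = false) :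
    isBit (l.flatMap numWord ++ rest).head? = false := by
  cases l
  · simpa using h
  · rfl

/-! ### The product of the moduli -/

/-- Multiply `u` by all the numbers on the stack `mods'`. -/
def multiplyAll : Prog :=
  loop (fun _ h => (h .mods').isSome) <| seq (popFrom .mods') <| seq (addMod .s .u .zero .zero) <|
    seq (addMod .u .zero .zero .zero) (horner .mods' (popFrom .mods') .u .s .modulus)

/-- As the register `modulus` is `0`, the products are not reduced. -/
theorem steps_multiplyAll (l : List ℕ) (hl : ∀ x ∈ l, 0 < x) (hp : r .u * l.prod < 2 ^ n)
    (hz : r .zero = 0) (ho : r .one = 1) (hmod : r .modulus = 0) (hb : σ.back = []) :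
    ∃ r' s', r' .u = r .u * l.prod ∧ r' .zero = 0 ∧ r' .one = 1 ∧ r' .modulus = 0 ∧
      multiplyAll.Steps s { σ with file := regs n r, mods' := l.flatMap numWord }
        ((6 * (l.flatMap numWord).length + 1) * unit n) s'
        { σ with file := regs n r', mods' := [] } := by
  have hunit : 4 ≤ unit n := by unfold unit; omega
  induction l generalizing r s with
  | nil =>
    exact ⟨r, s, by simp, hz, ho, hmod,
      Within.mono (within_loop_false rfl) (by simp; omega)⟩
  | cons x l ih =>
    have hx : 0 < x := hl x (by simp)
    have hl' : 0 < l.prod := List.prod_pos fun y hy => hl y (by simp [hy])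
    rw [List.prod_cons, ← mul_assoc] at hp
    have hux : r .u * x < 2 ^ n := lt_of_le_of_lt (Nat.le_mul_of_pos_right _ hl') hp
    have hu : r .u < 2 ^ n := lt_of_le_of_lt (Nat.le_mul_of_pos_right _ hx) hux
    set τ : Stacks := { σ with
      mods' := (Nat.bits x).reverse.map (fun b => .inl (.bit b)) ++ l.flatMap numWord } with hτ
    have h1 : (popFrom .mods').Steps s
        { σ with file := regs n r, mods' := (x :: l).flatMap numWord } 1 s
        { τ with file := regs n r } :=
      steps_popFrom (by simp [Stacks.get, numWord, hτ]) (fun j hj => by cases j <;> first | rfl | simp at hj)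
    set r1 := Function.update r .s (r .u) with hr1
    have h2 := steps_assign (s := s) (dst := .s) (x := .u) (y := .zero) (m := .zero) (n := n)
      (r := r) (σ := { τ with file := regs n r }) (r .u) rfl hb
      (by simp [hz, hu]) (by simp [hz]) (by simp [hz])
    set r2 := Function.update r1 .u 0 with hr2
    have h3 := fun s => steps_assign (s := s) (dst := .u) (x := .zero) (y := .zero) (m := .zero)
      (n := n) (r := r1) (σ := { τ with file := regs n r1 }) 0 rfl hb
      (by simp [hz, hr1]) (by simp [hz, hr1]) (by simp [hz, hr1])
    have h4 := fun s => steps_horner (s := s) (n := n) (k := .mods') (pop := popFrom .mods')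
      (acc := .u) (mul := .s) (md := .modulus)
      (fun w ρ => { σ with
        file := regs n ρ
        mods' := w.map (fun b => .inl (.bit b)) ++ l.flatMap numWord }) (fun _ _ => rfl)
      (fun _ _ => hb) (fun _ _ _ => rfl)
      (fun b w ρ s => steps_popFrom rfl (fun j hj => by cases j <;> first | rfl | simp at hj))
      (fun _ _ _ => rfl)
      (fun ρ => by simpa [tops, Stacks.get] using isBit_head (l := l) (rest := []) rfl)
      (by simp) (by simp) (Nat.bits x).reverse 0 (r := r2) (by simp [hr2])
      (Or.inl ⟨by simp [hr1, hr2, hmod], by rw [binVal_reverse_bits]; simp [hr1, hr2]; rwa [mul_comm]⟩)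
    simp only [binVal_reverse_bits] at h4
    set r3 := Function.update r2 .u (x * r2 .s % r2 .modulus) with hr3
    have hu3 : r3 .u = r .u * x := by simp [hr1, hr2, hr3, hmod, mul_comm]
    obtain ⟨s4, h4⟩ := h4 (false, decide (r1 .zero + r1 .zero < r1 .zero))
    obtain ⟨r', s', a1, a2, a3, a4, key⟩ := ih (r := r3) (s := s4) (fun y hy => hl y (by simp [hy]))
      (by rw [hu3]; exact hp) (by simp [hr1, hr2, hr3, hz]) (by simp [hr1, hr2, hr3, ho])
      (by simp [hr1, hr2, hr3, hmod])
    refine ⟨r', s', by rw [a1, hu3, List.prod_cons, mul_assoc], a2, a3, a4,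
      (Within.loop_true rfl (h1.seq (h2.seq ((h3 _).seq h4))) key).mono ?_⟩
    simp only [List.flatMap_cons, List.length_append, length_numWord, List.length_reverse,
      Nat.size_eq_bits_len]
    ring_nf
    omega

/-! ### Reading numbers, and multiplying them by an idempotent -/

/-- Remove a number from the stack `mods`, assigning it to `v`. -/
def loadMod : Prog :=
  seq (popFrom .mods) (seq (addMod .v .zero .zero .zero) (horner .mods (popFrom .mods) .v .one .zero))

theorem steps_loadMod {x : ℕ} {l : List ℕ} (hx : x < 2 ^ n) (hz : r .zero = 0) (ho : r .one = 1)
    (hb : σ.back = []) : ∃ s',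
    loadMod.Steps s { σ with file := regs n r, mods := (x :: l).flatMap numWord }
      ((3 * n + 3) * unit n) s'
      { σ with file := regs n (Function.update r .v x), mods := l.flatMap numWord } := by
  set τ : Stacks := { σ with
    mods := (Nat.bits x).reverse.map (fun b => .inl (.bit b)) ++ l.flatMap numWord } with hτ
  have h1 : (popFrom .mods).Steps s
      { σ with file := regs n r, mods := (x :: l).flatMap numWord } 1 s
      { τ with file := regs n r } :=
    steps_popFrom (by simp [Stacks.get, numWord, hτ]) (fun j hj => by cases j <;> first | rfl | simp at hj)
  set r1 := Function.update r .v 0 with hr1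
  have h2 := steps_assign (s := s) (dst := .v) (x := .zero) (y := .zero) (m := .zero)
    (n := n) (r := r) (σ := { τ with file := regs n r }) 0 rfl hb
    (by simp [hz]) (by simp [hz]) (by simp [hz])
  obtain ⟨s', h3⟩ := steps_horner (s := (false, decide (r .zero + r .zero < r .zero))) (n := n)
    (k := .mods) (pop := popFrom .mods) (acc := .v) (mul := .one) (md := .zero)
    (fun w ρ => { σ with
      file := regs n ρ
      mods := w.map (fun b => .inl (.bit b)) ++ l.flatMap numWord }) (fun _ _ => rfl)
    (fun _ _ => hb) (fun _ _ _ => rfl)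
    (fun b w ρ s => steps_popFrom rfl (fun j hj => by cases j <;> first | rfl | simp at hj))
    (fun _ _ _ => rfl)
    (fun ρ => by simpa [tops, Stacks.get] using isBit_head (l := l) (rest := []) rfl)
    (by simp) (by simp) (Nat.bits x).reverse 0 (r := r1) (by simp [hr1])
    (Or.inl ⟨by simp [hr1, hz], by rw [binVal_reverse_bits]; simp [hr1, ho, hx]⟩)
  simp only [binVal_reverse_bits] at h3
  have e : Function.update r1 .v (x * r1 .one % r1 .zero) = Function.update r .v x := by
    simp [hr1, ho, hz]
  rw [e] at h3
  refine ⟨s', (h1.seq (h2.seq h3)).mono ?_⟩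
  have hsz : x.size ≤ n := Nat.size_le.mpr hx
  have hunit : 4 ≤ unit n := by unfold unit; omega
  simp only [List.length_reverse, Nat.size_eq_bits_len]
  calc _ = (3 * x.size + 2) * unit n + 1 := by ring
    _ ≤ (3 * n + 2) * unit n + 1 := by gcongr
    _ ≤ _ := by ring_nf; omega

/-- Multiply the numbers on top of the stack `res` by `s`, modulo `modulus`, and push the products
on the stack `vals`. -/
def products : Prog :=
  loop (fun _ h => isComma (h .res)) <| seq (popFrom .res) <| seq (addMod .u .zero .zero .zero) <|
    seq (horner .res (popFrom .res) .u .s .modulus) emitU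

/-- The products of the numbers in `l` end on `vals` in the reverse order. -/
theorem steps_products (l : List ℕ) {rest : List Symb} (hrest : isBit rest.head? = false)
    (hrest' : isComma rest.head? = false)
    (hz : r .zero = 0) (hM : 2 * r .modulus < 2 ^ n) (hs : r .s < r .modulus)
    (hb : σ.back = []) :
    ∃ U s', products.Steps s { σ with file := regs n r, res := l.flatMap numWord ++ rest }
        ((6 * (l.flatMap numWord).length + 1) * unit n) s'
        { σ with
          file := regs n (Function.update r .u U)
          res := rest
          vals := (l.reverse.flatMap fun x => digits n (x * r .s % r .modulus)) ++ σ.vals } := by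
  have hunit : 4 ≤ unit n := by unfold unit; omega
  induction l generalizing r s σ with
  | nil =>
    refine ⟨r .u, s, ?_⟩
    rw [Function.update_eq_self]
    exact Within.mono (within_loop_false (by simpa [tops, Stacks.get] using hrest')) (by simp; omega)
  | cons x l ih =>
    set τ : Stacks := { σ with
      res := (Nat.bits x).reverse.map (fun b => .inl (.bit b)) ++
        (l.flatMap numWord ++ rest) } with hτ
    have h1 : (popFrom .res).Steps s
        { σ with file := regs n r, res := (x :: l).flatMap numWord ++ rest } 1 s
        { τ with file := regs n r } :=
      steps_popFrom (by simp [Stacks.get, numWord, hτ]) (fun j hj => by cases j <;> first | rfl | simp at hj)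
    set r1 := Function.update r .u 0 with hr1
    have h2 := steps_assign (s := s) (dst := .u) (x := .zero) (y := .zero) (m := .zero)
      (n := n) (r := r) (σ := { τ with file := regs n r }) 0 rfl hb
      (by simp [hz]) (by simp [hz]) (by simp [hz])
    obtain ⟨s3, h3⟩ := steps_horner (s := (false, decide (r .zero + r .zero < r .zero))) (n := n)
      (k := .res) (pop := popFrom .res) (acc := .u) (mul := .s) (md := .modulus)
      (fun w ρ => { σ with
        file := regs n ρ
        res := w.map (fun b => .inl (.bit b)) ++ (l.flatMap numWord ++ rest) }) (fun _ _ => rfl)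
      (fun _ _ => hb) (fun _ _ _ => rfl)
      (fun b w ρ s => steps_popFrom rfl (fun j hj => by cases j <;> first | rfl | simp at hj))
      (fun _ _ _ => rfl)
      (fun ρ => by simpa [tops, Stacks.get] using isBit_head (l := l) hrest)
      (by simp) (by simp) (Nat.bits x).reverse 0 (r := r1) (by simp [hr1])
      (Or.inr ⟨by simp [hr1, hM], by simp [hr1, hs]⟩)
    simp only [binVal_reverse_bits] at h3
    have e : Function.update r1 .u (x * r1 .s % r1 .modulus) =
        Function.update r .u (x * r .s % r .modulus) := by
      simp [hr1]
    rw [e] at h3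
    set r2 := Function.update r .u (x * r .s % r .modulus) with hr2
    have h4 := steps_emitU (n := n) (r := r2) (s := s3)
      (σ := { σ with file := regs n r2, res := l.flatMap numWord ++ rest }) rfl hb
    obtain ⟨U, s', key⟩ := ih (r := r2) (s := s3)
      (σ := { σ with vals := digits n (r2 .u) ++ σ.vals }) (by simp [hr2, hz]) (by simp [hr2, hM])
      (by simp [hr2, hs]) hb
    have e1 : Function.update r2 .u U = Function.update r .u U := by simp [hr2]
    have e2 : r2 .s = r .s := by simp [hr2]
    have e3 : r2 .modulus = r .modulus := by simp [hr2]
    have e4 : r2 .u = x * r .s % r .modulus := by simp [hr2]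
    simp only [e1, e2, e3, e4] at key h4
    refine ⟨U, s', ((Within.loop_true rfl (h1.seq (h2.seq (h3.seq h4))) key).mono ?_).congr ?_⟩
    · simp only [List.flatMap_cons, List.length_append, length_numWord, List.length_reverse,
        Nat.size_eq_bits_len]
      ring_nf
      omega
    · intro k
      cases k <;> simp [Stacks.get]

/-! ### Sums of all pairs -/

/-- Push `u + x`, modulo `modulus`, on `list'`, for all the numbers `x` on `vals`. -/
def translates : Prog :=
  seq (loop (fun _ h => (h .vals).isSome) (seq loadV (seq (addMod .t .u .v .modulus) emitT)))
    (fan .vals' fun k => match k with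
      | .vals => some fun _ γ => γ
      | _ => none)

/-- Push `y + x`, modulo `modulus`, on `list'`, for all `y` on `list` and `x` on `vals`. -/
def sums : Prog := loop (fun _ h => (h .list).isSome) (seq loadU translates)

theorem digits_append_isSome {x : ℕ} {l : List Symb} (hn : 0 < n) :
    (digits n x ++ l).head?.isSome = true := by
  obtain _ | n := n
  · omega
  · rfl

theorem length_flatMap_digits (l : List ℕ) : (l.flatMap (digits n)).length = l.length * n := by
  induction l with
  | nil => simp
  | cons x l ih => simp [ih, add_mul, add_comm]

/-- The numbers on `vals` are moved to `vals'`, so that they can be used again. -/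
theorem steps_translates_loop (l : List ℕ) (hl : ∀ x ∈ l, x < r .modulus) (hu : r .u < r .modulus)
    (hM : 2 * r .modulus < 2 ^ n) (hb : σ.back = []) :
    ∃ V T s', (loop (fun _ h => (h .vals).isSome)
        (seq loadV (seq (addMod .t .u .v .modulus) emitT)) : Prog).Steps s
      { σ with file := regs n r, vals := l.flatMap (digits n) } ((4 * l.length + 1) * unit n) s'
      { σ with
        file := regs n (Function.update (Function.update r .v V) .t T)
        vals := []
        vals' := (l.flatMap (digits n)).reverse ++ σ.vals'
        list' := (l.flatMap fun x => digits n ((r .u + x) % r .modulus)).reverse ++ σ.list' } := by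
  have hunit : 4 ≤ unit n := by unfold unit; omega
  induction l generalizing r s σ with
  | nil =>
    refine ⟨r .v, r .t, s, ?_⟩
    simp only [Function.update_eq_self]
    exact Within.mono (within_loop_false rfl) (by simp; omega)
  | cons x l ih =>
    have hn : 0 < n := by
      rcases Nat.eq_zero_or_pos n with rfl | h
      · simp at hM; omega
      · exact h
    have hx := hl x (by simp)
    set r1 := Function.update r .v x with hr1
    have h1 := steps_loadV (s := s) (n := n) (r := r) (x := x) (rest := l.flatMap (digits n))
      (σ := { σ with file := regs n r, vals := (x :: l).flatMap (digits n) }) rfl hb rfl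
    set τ : Stacks := { σ with
      vals := l.flatMap (digits n)
      vals' := (digits n x).reverse ++ σ.vals' } with hτ
    set r2 := Function.update r1 .t ((r .u + x) % r .modulus) with hr2
    have h2 := steps_assign (s := s) (dst := .t) (x := .u) (y := .v) (m := .modulus) (n := n)
      (r := r1) (σ := { τ with file := regs n r1 }) ((r .u + x) % r .modulus) rfl hb
      (by simp [hr1]; omega) (by simp [hr1]; omega)
      (by rw [mod_eq_ite (by simp [hr1]; omega)]; simp [hr1])
    have h3 := fun s => steps_emitT (s := s) (n := n) (r := r2)
      (σ := { τ with file := regs n r2 }) rfl hb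
    obtain ⟨V, T, s', key⟩ := ih (r := r2) (s := (false, decide (r1 .u + r1 .v < r1 .modulus)))
      (σ := { τ with list' := (digits n (r2 .t)).reverse ++ σ.list' })
      (by simpa [hr1, hr2] using fun y hy => hl y (by simp [hy])) (by simpa [hr1, hr2] using hu)
      (by simpa [hr1, hr2] using hM) hb
    refine ⟨V, T, s', ((Within.loop_true (digits_append_isSome hn) (h1.seq (h2.seq (h3 _)))
      key).mono ?_).congr ?_⟩
    · simp only [List.length_cons]
      ring_nf
      omega
    · have e1 : Function.update (Function.update r2 .v V) .t T =
          Function.update (Function.update r .v V) .t T := by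
        funext j
        cases j <;> simp [hr1, hr2]
      have e2 : r2 .t = (r .u + x) % r .modulus := by simp [hr2]
      have e3 : r2 .u = r .u := by simp [hr1, hr2]
      have e4 : r2 .modulus = r .modulus := by simp [hr1, hr2]
      intro k
      cases k <;> simp [Stacks.get, e1, e2, e3, e4, hτ]

theorem steps_translates (l : List ℕ) (hl : ∀ x ∈ l, x < r .modulus) (hu : r .u < r .modulus)
    (hM : 2 * r .modulus < 2 ^ n) (hb : σ.back = []) (hv' : σ.vals' = []) :
    ∃ V T s', translates.Steps s { σ with file := regs n r, vals := l.flatMap (digits n) }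
      ((5 * l.length + 2) * unit n) s'
      { σ with
        file := regs n (Function.update (Function.update r .v V) .t T)
        vals := l.flatMap (digits n)
        list' := (l.flatMap fun x => digits n ((r .u + x) % r .modulus)).reverse ++ σ.list' } := by
  obtain ⟨V, T, s', h⟩ := steps_translates_loop (s := s) l hl hu hM hb
  refine ⟨V, T, s', (h.seq ((within_fan ..).congr fun k => ?_)).mono ?_⟩
  · cases k <;> simp [Stacks.get, hv']
  · have : 2 * (l.length * n) + 1 ≤ (l.length + 1) * unit n := by
      unfold unit
      ring_nf
      omega
    have e : (5 * l.length + 2) * unit n =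
        (4 * l.length + 1) * unit n + (l.length + 1) * unit n := by ring
    simp only [Stacks.get, hv', List.append_nil, List.length_reverse, length_flatMap_digits]
    omega

theorem steps_sums (ys l : List ℕ) (hys : ∀ y ∈ ys, y < r .modulus) (hl : ∀ x ∈ l, x < r .modulus)
    (hM : 2 * r .modulus < 2 ^ n) (hb : σ.back = []) (hv' : σ.vals' = []) :
    ∃ U V T s', sums.Steps s
      { σ with file := regs n r, vals := l.flatMap (digits n), list := ys.flatMap (digits n) }
      ((ys.length * (5 * l.length + 4) + 1) * unit n) s'
      { σ with
        file := regs n (Function.update (Function.update (Function.update r .u U) .v V) .t T)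
        vals := l.flatMap (digits n)
        list := []
        list' := ((ys.flatMap fun y => l.map fun x => (y + x) % r .modulus).flatMap
          (digits n)).reverse ++ σ.list' } := by
  have hunit : 4 ≤ unit n := by unfold unit; omega
  induction ys generalizing r s σ with
  | nil =>
    refine ⟨r .u, r .v, r .t, s, ?_⟩
    simp only [Function.update_eq_self]
    exact Within.mono (within_loop_false rfl) (by simp; omega)
  | cons y ys ih =>
    have hy := hys y (by simp)
    have hn : 0 < n := by
      rcases Nat.eq_zero_or_pos n with rfl | h
      · simp at hM; omega
      · exact h
    set r1 := Function.update r .u y with hr1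
    have h1 := steps_loadU (s := s) (n := n) (r := r) (x := y) (rest := ys.flatMap (digits n))
      (σ := { σ with
        file := regs n r, vals := l.flatMap (digits n), list := (y :: ys).flatMap (digits n) })
      rfl hb rfl
    obtain ⟨V, T, s2, h2⟩ := steps_translates (s := s) (n := n) (r := r1)
      (σ := { σ with list := ys.flatMap (digits n) })
      l (by simpa [hr1] using hl) (by simpa [hr1] using hy) (by simpa [hr1] using hM) hb hv'
    set r2 := Function.update (Function.update r1 .v V) .t T with hr2
    obtain ⟨U', V', T', s', key⟩ := ih (r := r2) (s := s2)
      (σ := { σ with list' := (l.flatMap fun x => digits n ((r1 .u + x) % r1 .modulus)).reverse ++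
        σ.list' })
      (by simpa [hr1, hr2] using fun y hy => hys y (by simp [hy])) (by simpa [hr1, hr2] using hl)
      (by simpa [hr1, hr2] using hM) hb hv'
    refine ⟨U', V', T', s', ((Within.loop_true (digits_append_isSome hn) (h1.seq h2)
      key).mono ?_).congr ?_⟩
    · simp only [List.length_cons]
      ring_nf
      omega
    · have e1 : Function.update (Function.update (Function.update r2 .u U') .v V') .t T' =
          Function.update (Function.update (Function.update r .u U') .v V') .t T' := by
        funext j
        cases j <;> simp [hr1, hr2]
      have e3 : r1 .u = y := by simp [hr1]
      have e4 : r1 .modulus = r .modulus := by simp [hr1]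
      have e5 : r2 .modulus = r .modulus := by simp [hr1, hr2]
      intro k
      cases k <;> simp [Stacks.get, e1, e3, e4, e5, List.flatMap_map]

end StackProg

/-- The part of the input belonging to one modulus: the modulus, the number of residues, and the
residues. -/
structure Block where
  modulus : ℕ
  size : ℕ
  residues : List ℕ

/-- The residues of a block, as they are found on a stack after having been read. -/
def Block.resWord (b : Block) : List Symb :=
  .inl .semicolon :: b.residues.reverse.flatMap numWord

/-- All sums `y + x * g` modulo `M`, for `y` in `ys` and `x` in `xs`. -/
def shifts (M g : ℕ) (xs ys : List ℕ) : List ℕ :=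
  ys.flatMap fun y => xs.map fun x => (y + x * g % M) % M

theorem length_shifts (M g : ℕ) (xs ys : List ℕ) :
    (shifts M g xs ys).length = ys.length * xs.length := by
  simp [shifts, List.length_flatMap]

namespace StackProg

variable {n : ℕ} {r : Reg → ℕ} {s : Mem} {σ : Stacks}

/-! ### The main loop -/

/-- Move `list'` to `list`. -/
def listBack : Prog := fan .list' fun k => match k with
  | .list => some fun _ γ => γ
  | _ => none

theorem steps_listBack {τ : Stacks} (hτ : τ = { σ with list := σ.list'.reverse ++ σ.list, list' := [] }) :
    listBack.Steps s σ (2 * σ.list'.length + 1) s τ := by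
  subst hτ
  refine (within_fan ..).congr fun k => ?_
  cases k <;> simp [Stacks.get]

/-- Replace the numbers on `list` by their sums with the multiples of a Gauss idempotent by the
residues of a block. -/
def processBlock : Prog :=
  seq loadMod <| seq gauss <| seq (popFrom .res) <| seq products <| seq sums <| seq listBack <|
    fan .vals fun _ => none

/-- A bound for the number of operations in `processBlock`, if there are `y` numbers on `list`. -/
def blockCost (n : ℕ) (b : Block) (y : ℕ) : ℕ :=
  109 * n + 30 + 6 * (b.residues.flatMap numWord).length + b.residues.length +
    6 * (y * b.residues.length) + 4 * y

theorem length_flatMap_reverse {α β : Type*} (l : List α) (f : α → List β) :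
    (l.reverse.flatMap f).length = (l.flatMap f).length := by
  simp [List.length_flatMap, List.sum_reverse]

/-- `G` is the Gauss idempotent of the block, which `gauss` finds. -/
theorem steps_processBlock {M : ℕ} {G : ZMod M} (b : Block) (bs : List Block) (ys : List ℕ)
    (hM0 : 0 < M) (hM : 2 * M < 2 ^ n)
    (hmod : r .modulus = M) (hz : r .zero = 0) (ho : r .one = 1) (hdvd : b.modulus ∣ M)
    (hc : Nat.Coprime (M / b.modulus) b.modulus)
    (hG : ((M / b.modulus : ℕ) : ZMod M) * G = (M / b.modulus : ℕ))
    (hG' : (b.modulus : ZMod M) * G = 0) (hys : ∀ y ∈ ys, y < M)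
    (hb : σ.back = []) (hh : σ.hist = []) (hv' : σ.vals' = []) (hl' : σ.list' = []) :
    ∃ r' s', r' .modulus = M ∧ r' .zero = 0 ∧ r' .one = 1 ∧
      processBlock.Steps s
        { σ with
          file := regs n r
          mods := ((b :: bs).map Block.modulus).flatMap numWord
          res := (b :: bs).flatMap Block.resWord
          vals := []
          list := ys.flatMap (digits n) }
        (blockCost n b ys.length * unit n) s'
        { σ with
          file := regs n r'
          mods := (bs.map Block.modulus).flatMap numWord
          res := bs.flatMap Block.resWord
          vals := []
          list := (shifts M G.val b.residues ys).flatMap (digits n) } := by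
  have hunit : 4 ≤ unit n := by unfold unit; omega
  have hbM : b.modulus ≤ M := Nat.le_of_dvd hM0 hdvd
  set τ : Stacks := { σ with
    mods := (bs.map Block.modulus).flatMap numWord
    res := (b :: bs).flatMap Block.resWord
    vals := []
    list := ys.flatMap (digits n) } with hτ
  obtain ⟨s1, h1⟩ := steps_loadMod (s := s) (n := n) (r := r) (x := b.modulus)
    (l := bs.map Block.modulus) (σ := τ) (by omega) hz ho hb
  set r1 := Function.update r .v b.modulus with hr1
  have e1 : r1 .v = b.modulus := by simp [hr1]
  obtain ⟨r2, s2, m2, z2, o2, l2, g2, h2⟩ := steps_gauss (s := s1) (n := n) (r := r1) (G := G)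
    (σ := { τ with file := regs n r1 }) hM0 hM (by simp [hr1, hmod]) (by simp [hr1, hz])
    (by simp [hr1, ho]) (by rwa [e1]) (by rwa [e1]) (by rwa [e1]) (by rwa [e1]) rfl hb hh
  have hg : r2 .s = G.val := by
    rw [← g2, ZMod.val_cast_of_lt l2]
  have h3 : (popFrom .res).Steps s2 { τ with file := regs n r2 } 1 s2
      { τ with
        file := regs n r2
        res := b.residues.reverse.flatMap numWord ++ bs.flatMap Block.resWord } :=
    steps_popFrom rfl (fun j hj => by cases j <;> first | rfl | simp at hj)
  obtain ⟨U, s4, h4⟩ := steps_products (s := s2) (n := n) (r := r2) b.residues.reverse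
    (rest := bs.flatMap Block.resWord) (σ := τ) (by cases bs <;> rfl) (by cases bs <;> rfl)
    z2 (by rw [m2]; exact hM) (by rw [m2]; exact l2) hb
  rw [List.reverse_reverse, hg, m2] at h4
  set r4 := Function.update r2 .u U with hr4
  set xs := b.residues.map fun x => x * G.val % M with hxs
  obtain ⟨U5, V5, T5, s5, h5⟩ := steps_sums (s := s4) (n := n) (r := r4) ys xs
    (σ := { τ with res := bs.flatMap Block.resWord }) (by simpa [hr4, m2] using hys)
    (by
      simp only [hxs, hr4, List.mem_map]
      rintro _ ⟨x, _, rfl⟩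
      simpa [m2] using Nat.mod_lt _ hM0)
    (by simpa [hr4, m2] using hM) hb hv'
  have hm4 : r4 .modulus = M := by simp [hr4, m2]
  have exs : (b.residues.flatMap fun x => digits n (x * G.val % M)) = xs.flatMap (digits n) := by
    simp [hxs, List.flatMap_map]
  have esh : (ys.flatMap fun y => xs.map fun x => (y + x) % M) = shifts M G.val b.residues ys := by
    simp [hxs, shifts, Function.comp_def]
  rw [hm4, esh] at h5
  rw [exs] at h4
  set r5 := Function.update (Function.update (Function.update r4 .u U5) .v V5) .t T5 with hr5
  have h6 := steps_listBack (s := s5) (σ := { τ with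
      file := regs n r5
      res := bs.flatMap Block.resWord
      vals := xs.flatMap (digits n)
      list := []
      list' := ((shifts M G.val b.residues ys).flatMap (digits n)).reverse ++ σ.list' }) (τ := { τ with
      file := regs n r5
      res := bs.flatMap Block.resWord
      vals := xs.flatMap (digits n)
      list := (shifts M G.val b.residues ys).flatMap (digits n)
      list' := [] }) (by simp [hl'])
  refine ⟨r5, s5, by simp [hr5, hm4], by simp [hr5, hr4, z2], by simp [hr5, hr4, o2],
    (h1.seq (h2.seq (h3.seq (Within.seq (c' := (s4, _)) (h4.congr fun k => ?_)
      (h5.seq (h6.seq ((within_fan ..).congr fun k => ?_))))))).mono ?_⟩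
  · cases k <;> simp [Stacks.get, hτ]
  · cases k <;> simp [Stacks.get, hτ, hl']
  · have f1 : (((shifts M G.val b.residues ys).flatMap (digits n)).reverse ++ σ.list').length =
        ys.length * b.residues.length * n := by
      rw [hl', List.append_nil, List.length_reverse, length_flatMap_digits, length_shifts]
    have f2 : (xs.flatMap (digits n)).length = b.residues.length * n := by
      rw [length_flatMap_digits, hxs, List.length_map]
    have f3 : xs.length = b.residues.length := by simp [hxs]
    simp only [Stacks.get, f1, f2, f3, length_flatMap_reverse, blockCost]
    generalize (b.residues.flatMap numWord).length = w
    generalize b.residues.length = κ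
    generalize ys.length = y
    have g1 : 2 * (y * κ * n) ≤ y * κ * unit n := by
      unfold unit
      nlinarith [Nat.zero_le (y * κ * n), Nat.zero_le (y * κ)]
    have g2 : 2 * (κ * n) ≤ κ * unit n := by
      unfold unit
      nlinarith [Nat.zero_le (κ * n), Nat.zero_le κ]
    have g3 : (109 * n + 30 + 6 * w + κ + 6 * (y * κ) + 4 * y) * unit n =
        (3 * n + 3) * unit n + (106 * n + 21) * unit n + (6 * w + 1) * unit n +
        (y * (5 * κ + 4) + 1) * unit n + y * κ * unit n + κ * unit n + 4 * unit n := by ring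
    omega

/-- The loop over all blocks. -/
def processBlocks : Prog := loop (fun _ h => (h .mods).isSome) processBlock

/-- A bound for the number of operations in `processBlocks`, if there are `y` numbers on `list`. -/
def blocksCost (n : ℕ) : List Block → ℕ → ℕ
  | [], _ => 1
  | b :: bs, y => blockCost n b y + 1 + blocksCost n bs (y * b.residues.length)

theorem shifts_lt {M g : ℕ} (hM0 : 0 < M) (xs ys : List ℕ) : ∀ z ∈ shifts M g xs ys, z < M := by
  simp only [shifts, List.mem_flatMap, List.mem_map]
  rintro _ ⟨y, _, x, _, rfl⟩
  exact Nat.mod_lt _ hM0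

theorem steps_processBlocks {M : ℕ} (G : Block → ZMod M) (bs : List Block) (ys : List ℕ)
    (hM0 : 0 < M) (hM : 2 * M < 2 ^ n)
    (hmod : r .modulus = M) (hz : r .zero = 0) (ho : r .one = 1)
    (hdvd : ∀ b ∈ bs, b.modulus ∣ M)
    (hc : ∀ b ∈ bs, Nat.Coprime (M / b.modulus) b.modulus)
    (hG : ∀ b ∈ bs, ((M / b.modulus : ℕ) : ZMod M) * G b = (M / b.modulus : ℕ))
    (hG' : ∀ b ∈ bs, (b.modulus : ZMod M) * G b = 0) (hys : ∀ y ∈ ys, y < M)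
    (hb : σ.back = []) (hh : σ.hist = []) (hv' : σ.vals' = []) (hl' : σ.list' = []) :
    ∃ r' s', processBlocks.Steps s
        { σ with
          file := regs n r
          mods := (bs.map Block.modulus).flatMap numWord
          res := bs.flatMap Block.resWord
          vals := []
          list := ys.flatMap (digits n) }
        (blocksCost n bs ys.length * unit n) s'
        { σ with
          file := regs n r'
          mods := []
          res := []
          vals := []
          list := (bs.foldl (fun ys b => shifts M (G b).val b.residues ys) ys).flatMap
            (digits n) } := by
  have hunit : 4 ≤ unit n := by unfold unit; omega
  induction bs generalizing r s ys with
  | nil => exact ⟨r, s, Within.mono (within_loop_false rfl) (by simp [blocksCost]; omega)⟩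
  | cons b bs ih =>
    obtain ⟨r1, s1, m1, z1, o1, h1⟩ := steps_processBlock (s := s) (σ := σ) b bs ys hM0 hM hmod hz ho
      (hdvd b (by simp)) (hc b (by simp)) (hG b (by simp)) (hG' b (by simp)) hys hb hh hv' hl'
    obtain ⟨r', s', key⟩ := ih (s := s1) (shifts M (G b).val b.residues ys) m1 z1 o1
      (fun b hb => hdvd b (by simp [hb])) (fun b hb => hc b (by simp [hb]))
      (fun b hb => hG b (by simp [hb])) (fun b hb => hG' b (by simp [hb])) (shifts_lt hM0 _ _)
    refine ⟨r', s', (Within.loop_true rfl h1 key).mono ?_⟩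
    rw [length_shifts]
    simp only [blocksCost, add_mul]
    omega

end StackProg

/-- The symbol of a binary digit. -/
def bitSym (b : Bool) : Symb := .inl (.bit b)

theorem digits_eq_bits {n x : ℕ} (hx : x < 2 ^ n) :
    digits n x = (Nat.bits x).map bitSym ++ List.replicate (n - x.size) (bitSym false) := by
  induction n generalizing x with
  | zero =>
    obtain rfl : x = 0 := by simpa using hx
    rfl
  | succ n ih =>
    rw [digits, ih (by rw [pow_succ] at hx; omega)]
    rcases Nat.even_or_odd' x with ⟨y, rfl | rfl⟩
    · rcases Nat.eq_zero_or_pos y with rfl | hy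
      · simp [lowBit, bitSym, List.replicate_succ]
      · have e : 2 * y / 2 = y := by omega
        have e' : (2 * y).size = y.size + 1 := by
          rw [← Nat.size_eq_bits_len, Nat.bit0_bits y (by omega), List.length_cons,
            Nat.size_eq_bits_len]
        rw [e, Nat.bit0_bits y (by omega), e']
        simp [lowBit, bitSym]
    · have e : (2 * y + 1) / 2 = y := by omega
      have e' : (2 * y + 1).size = y.size + 1 := by
        rw [← Nat.size_eq_bits_len, Nat.bit1_bits y, List.length_cons, Nat.size_eq_bits_len]
      rw [e, Nat.bit1_bits y, e']
      simp [lowBit, bitSym]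

theorem bits_reverse_eq (x : ℕ) : (Nat.bits x).reverse = [] ∨
    ∃ w, (Nat.bits x).reverse = true :: w := by
  induction x using Nat.binaryRec' with
  | zero => simp
  | bit b n h ih =>
    rw [Nat.bits_append_bit n b h, List.reverse_cons]
    rcases ih with ih | ⟨w, ih⟩
    · rw [ih]
      have : n.size = 0 := by
        rw [← Nat.size_eq_bits_len, ← List.length_reverse, ih, List.length_nil]
      rw [h (Nat.size_eq_zero.mp this)]
      simp
    · rw [ih]
      exact Or.inr ⟨_, rfl⟩

namespace StackProg

variable {n : ℕ} {r : Reg → ℕ} {s : Mem} {σ : Stacks}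

/-! ### Output -/

/-- Move one number from `list'` to `out`, omitting leading zeros. The register file, which is moved
to `back`, serves to count the digits. -/
def strip : Prog :=
  loop (fun _ h => (h .file).isSome) <| act fun s h =>
    ((isOne (h .list') || s.1, false), fun k => match k, h .file, h .list' with
      | .file, _, _ => .pop
      | .list', _, _ => .pop
      | .back, some γ, _ => .push γ
      | .out, _, some γ => if isOne (h .list') || s.1 then .push γ else .keep
      | _, _, _ => .keep)

theorem steps_strip_step {seen b : Bool} {γ : Symb} {f l : List Symb} {B : ℕ} {s' : Mem} {τ : Stacks}
    (h : strip.Steps (b || seen, false) { σ with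
      file := f
      list' := l
      back := γ :: σ.back
      out := if b || seen then bitSym b :: σ.out else σ.out } B s' τ) :
    strip.Steps (seen, false) { σ with file := γ :: f, list' := bitSym b :: l } (B + 2) s' τ := by
  refine Within.loop_act rfl rfl (fun k => ?_) h
  cases k <;> first | rfl | skip
  simp only [tops, Stacks.get, List.head?_cons, bitSym, isOne]
  cases b <;> cases seen <;> rfl

/-- Once a digit `1` has been seen, all further digits are copied. -/
theorem steps_strip_seen (w : List Bool) (f rest : List Symb) (hf : f.length = w.length) :
    strip.Steps (true, false) { σ with file := f, list' := w.map bitSym ++ rest }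
      (2 * f.length + 1) (true, false) { σ with
        file := []
        list' := rest
        back := f.reverse ++ σ.back
        out := (w.map bitSym).reverse ++ σ.out } := by
  induction w generalizing f σ with
  | nil =>
    obtain rfl : f = [] := by simpa using hf
    exact within_loop_false rfl
  | cons b w ih =>
    obtain _ | ⟨γ, f⟩ := f
    · simp at hf
    have := steps_strip_step (seen := true) (b := b) (γ := γ) (σ := σ) (by
      have := ih f (σ := { σ with back := γ :: σ.back, out := bitSym b :: σ.out }) (by simpa using hf)
      simpa only [Bool.or_true, if_true] using this)
    refine (this.mono (by simp; omega)).congr fun k => ?_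
    cases k <;> simp [Stacks.get]

/-- The register file is used as a ruler: one of its places is moved for each digit. -/
theorem steps_strip (x : ℕ) (f : List Symb) (rest : List Symb) (hx : x < 2 ^ f.length) :
    ∃ s', strip.Steps (false, false) { σ with file := f, list' := (digits f.length x).reverse ++ rest }
      (2 * f.length + 1) s' { σ with
        file := []
        list' := rest
        back := f.reverse ++ σ.back
        out := (Nat.bits x).map bitSym ++ σ.out } := by
  rw [digits_eq_bits hx, List.reverse_append, List.reverse_replicate, ← List.map_reverse,
    List.append_assoc]
  have hsz : x.size ≤ f.length := Nat.size_le.mpr hx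
  generalize hk : f.length - x.size = k
  induction k generalizing f σ with
  | zero =>
    have hlen : f.length = (Nat.bits x).reverse.length := by
      rw [List.length_reverse, Nat.size_eq_bits_len]; omega
    rcases bits_reverse_eq x with h | ⟨w, h⟩
    · rw [h] at hlen ⊢
      obtain rfl : f = [] := by simpa using hlen
      refine ⟨_, (within_loop_false rfl : strip.Within _ _ _).congr fun k => ?_⟩
      rw [List.reverse_eq_nil_iff] at h
      cases k <;> simp [Stacks.get, h]
    · rw [h] at hlen ⊢
      obtain _ | ⟨γ, f⟩ := f
      · simp at hlen
      have := steps_strip_step (seen := false) (b := true) (γ := γ) (σ := σ)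
        (steps_strip_seen (σ := { σ with back := γ :: σ.back, out := bitSym true :: σ.out }) w f rest
          (by simpa using hlen))
      refine ⟨_, (this.mono (by simp; omega)).congr fun k => ?_⟩
      rw [← List.reverse_reverse (Nat.bits x), h]
      cases k <;> simp [Stacks.get]
  | succ k ih =>
    obtain _ | ⟨γ, f⟩ := f
    · simp at hk
    obtain ⟨s', h⟩ := ih f (σ := { σ with back := γ :: σ.back })
      (Nat.size_le.mp (by simp at hk; omega)) (by simp at hk; omega) (by simp at hk; omega)
    have := steps_strip_step (seen := false) (b := false) (γ := γ) (σ := σ) h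
    refine ⟨s', (this.mono (by simp; omega)).congr fun k => ?_⟩
    cases k <;> simp [Stacks.get]

/-- Write the numbers on `list'` on the output tape. -/
def output : Prog :=
  loop (fun _ h => (h .list').isSome) <|
    seq (act fun _ _ => ((false, false), fun k => if k = .out then .push (.inl .comma) else .keep))
      (seq strip fromBack)

theorem steps_output (zs : List ℕ) (hzs : ∀ z ∈ zs, z < 2 ^ n) (hn : 0 < n) (hb : σ.back = []) :
    ∃ s', output.Steps s
      { σ with file := regs n r, list' := zs.flatMap fun z => (digits n z).reverse }
      ((2 * zs.length + 1) * unit n) s'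
      { σ with
        file := regs n r
        list' := []
        out := (zs.reverse.flatMap encodeNat).map .inl ++ σ.out } := by
  induction zs generalizing s σ with
  | nil => exact ⟨s, Within.mono (within_loop_false rfl) (by unfold unit; simp)⟩
  | cons z zs ih =>
    set rest := zs.flatMap fun z => (digits n z).reverse with hrest
    set τ : Stacks := { σ with out := .inl .comma :: σ.out } with hτ
    have h1 : (act fun _ _ => ((false, false),
        fun k => if k = .out then .push (.inl .comma) else .keep) : Prog).Steps s
        { σ with file := regs n r, list' := (digits n z).reverse ++ rest } 1 (false, false)
        { τ with file := regs n r, list' := (digits n z).reverse ++ rest } :=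
      steps_act rfl fun k => by cases k <;> rfl
    obtain ⟨s2, h2⟩ := steps_strip z (regs n r) rest (σ := τ) (by simpa using hzs z (by simp))
    simp only [length_regs] at h2
    obtain ⟨s', key⟩ := ih (s := s2) (σ := { τ with out := (Nat.bits z).map bitSym ++ τ.out })
      (fun y hy => hzs y (by simp [hy])) hb
    refine ⟨s', ((Within.loop_true ?_ (h1.seq (h2.seq (Within.congr
      (τ' := Stacks.get { τ with
        file := regs n r
        list' := rest
        out := (Nat.bits z).map bitSym ++ τ.out }) (within_fan ..) fun k => ?_))) key).mono ?_).congr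
      fun k => ?_⟩
    · simp only [tops, Stacks.get]
      cases h : (digits n z).reverse ++ rest with
      | nil => simpa [hn.ne'] using congrArg List.length (List.append_eq_nil_iff.mp h).1
      | cons => rfl
    · cases k <;> simp [Stacks.get, hτ, hb]
    · simp [Stacks.get, hτ, hb, unit]
      ring_nf
      omega
    · cases k <;> simp [Stacks.get, hτ, encodeNat, bitSym, Function.comp_def]

end StackProg

/-- The part of the input word belonging to a block. -/
def Block.word (b : Block) : List IOSymbol :=
  encodeNat b.modulus ++ encodeNat b.size ++ b.residues.flatMap encodeNat ++ [.semicolon]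

namespace StackProg

variable {n : ℕ} {r : Reg → ℕ} {s : Mem} {σ : Stacks}

/-! ### Reading the input -/

/-- A place of the register file with all digits equal to `0`. -/
def zeroCell : Symb := .inr (fun _ => false, false, false)

/-- The action of `scan` on a symbol of the input. The memory tells whether the machine expects the
first digit of a modulus, further digits of a modulus, the number of residues, or residues. -/
def scanStep : Mem → IOSymbol → Mem × (Stk → StackAct Symb)
  | (false, false), .bit b => ((false, true), fun k => match k with
      | .mods | .mods' => .push (bitSym b)
      | _ => .keep)
  | (false, true), .bit b => ((false, true), fun k => match k with
      | .mods | .mods' => .push (bitSym b)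
      | .file | .back => .push zeroCell
      | _ => .keep)
  | (false, _), _ => ((true, false), fun k => match k with
      | .mods | .mods' => .push (.inl .comma)
      | _ => .keep)
  | (true, false), .bit _ => ((true, false), fun _ => .keep)
  | (true, false), _ => ((true, true), fun _ => .keep)
  | (true, true), .semicolon => ((false, false), fun k => match k with
      | .res => .push (.inl .semicolon)
      | _ => .keep)
  | (true, true), γ => ((true, true), fun k => match k with
      | .res => .push (.inl γ)
      | _ => .keep)

/-- Read the input. The moduli are pushed on `mods` and `mods'`, the residues on `res`, and for
each digit of a modulus except the lowest one a place is added to the register file and to its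
mirror image. -/
def scan : Prog :=
  loop (fun _ h => (h .inp).isSome) <| act fun s h => match h .inp with
    | some (.inl γ) => ((scanStep s γ).1, fun k => if k = .inp then .pop else (scanStep s γ).2 k)
    | _ => (s, fun k => if k = .inp then .pop else .keep)

/-- One run of the loop. The lemmas on `scan` are stated for the input that remains, so that they
can be chained. -/
theorem scan_cons (s : Mem) {γ : IOSymbol} {w : List Symb} {B : ℕ} {s' : Mem} {τ σ' : Stacks}
    (hσ : ∀ k, k ≠ .inp → ((scanStep s γ).2 k).apply (σ.get k) = σ'.get k)
    (h : scan.Steps (scanStep s γ).1 { σ' with inp := w } B s' τ) :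
    scan.Steps s { σ with inp := .inl γ :: w } (B + 2) s' τ := by
  refine Within.loop_act rfl rfl (fun k => ?_) h
  by_cases hk : k = .inp
  · subst hk
    rfl
  · have := hσ k hk
    cases k <;> first | exact this | exact absurd rfl hk

theorem scan_modulus (w : List Bool) {rest : List Symb} {B : ℕ} {s' : Mem} {τ : Stacks}
    (h : scan.Steps (false, true) { σ with
      inp := rest
      mods := (w.map bitSym).reverse ++ σ.mods
      mods' := (w.map bitSym).reverse ++ σ.mods'
      file := List.replicate w.length zeroCell ++ σ.file
      back := List.replicate w.length zeroCell ++ σ.back } B s' τ) :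
    scan.Steps (false, true) { σ with inp := w.map bitSym ++ rest } (B + 2 * w.length) s' τ := by
  induction w generalizing σ with
  | nil => exact h
  | cons b w ih =>
    refine (scan_cons (false, true) (γ := .bit b) (σ' := { σ with
        mods := bitSym b :: σ.mods
        mods' := bitSym b :: σ.mods'
        file := zeroCell :: σ.file
        back := zeroCell :: σ.back }) (fun k hk => by cases k <;> rfl)
      (ih (σ := { σ with
        mods := bitSym b :: σ.mods
        mods' := bitSym b :: σ.mods'
        file := zeroCell :: σ.file
        back := zeroCell :: σ.back }) ?_)).mono (by simp; omega)
    have e (l : List Symb) : List.replicate (w.length + 1) zeroCell ++ l =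
        List.replicate w.length zeroCell ++ zeroCell :: l := by
      rw [List.replicate_succ', List.append_assoc]; rfl
    simpa [e] using h

theorem scan_size (w : List Bool) {rest : List Symb} {B : ℕ} {s' : Mem} {τ : Stacks}
    (h : scan.Steps (true, false) { σ with inp := rest } B s' τ) :
    scan.Steps (true, false) { σ with inp := w.map bitSym ++ rest } (B + 2 * w.length) s' τ := by
  induction w with
  | nil => exact h
  | cons b w ih =>
    exact (scan_cons (true, false) (γ := .bit b) (σ' := σ) (fun k hk => by cases k <;> rfl) ih).mono
      (by simp; omega)

theorem scan_residues (w : List IOSymbol) (hw : .semicolon ∉ w) {rest : List Symb} {B : ℕ} {s' : Mem}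
    {τ : Stacks}
    (h : scan.Steps (true, true) { σ with inp := rest, res := (w.map .inl).reverse ++ σ.res } B s' τ) :
    scan.Steps (true, true) { σ with inp := w.map .inl ++ rest } (B + 2 * w.length) s' τ := by
  induction w generalizing σ with
  | nil => exact h
  | cons γ w ih =>
    have hs : scanStep (true, true) γ = ((true, true), fun k => match k with
      | .res => .push (.inl γ)
      | _ => .keep) := by
      cases γ <;> first | rfl | simp at hw
    refine (scan_cons (true, true) (γ := γ) (σ' := { σ with res := .inl γ :: σ.res })
      (fun k hk => by rw [hs]; cases k <;> rfl) ?_).mono (B := B + 2 * w.length + 2)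
      (by simp; omega)
    rw [hs]
    exact ih (σ := { σ with res := .inl γ :: σ.res }) (fun h => hw (by simp [h])) (by simpa using h)

theorem numWord_eq (x : ℕ) : numWord x = .inl .comma :: ((Nat.bits x).map bitSym).reverse := by
  simp [numWord, bitSym]

theorem map_encodeNat (x : ℕ) :
    (encodeNat x).map .inl = (Nat.bits x).map bitSym ++ [(.inl .comma : Symb)] := by
  simp [encodeNat, bitSym, Function.comp_def]

theorem reverse_flatMap_encodeNat (l : List ℕ) :
    ((l.flatMap encodeNat).map .inl).reverse = l.reverse.flatMap numWord := by
  induction l with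
  | nil => rfl
  | cons x l ih =>
    simp only [List.flatMap_cons, List.map_append, List.reverse_append, ih, List.reverse_cons,
      List.flatMap_append, map_encodeNat, numWord_eq]
    simp

theorem scan_block (b : Block) {rest : List Symb} {B : ℕ} {s' : Mem} {τ : Stacks}
    (h : scan.Steps (false, false) { σ with
      inp := rest
      mods := numWord b.modulus ++ σ.mods
      mods' := numWord b.modulus ++ σ.mods'
      res := b.resWord ++ σ.res
      file := List.replicate (b.modulus.size - 1) zeroCell ++ σ.file
      back := List.replicate (b.modulus.size - 1) zeroCell ++ σ.back } B s' τ) :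
    scan.Steps (false, false) { σ with inp := b.word.map .inl ++ rest }
      (B + 2 * b.word.length) s' τ := by
  have hres : IOSymbol.semicolon ∉ b.residues.flatMap encodeNat := by
    simp [encodeNat, List.mem_flatMap]
  have hword : b.word.map .inl ++ rest = (Nat.bits b.modulus).map bitSym ++ .inl .comma ::
      ((Nat.bits b.size).map bitSym ++ .inl .comma ::
        ((b.residues.flatMap encodeNat).map .inl ++ .inl .semicolon :: rest)) := by
    simp only [Block.word, List.map_append, map_encodeNat, List.append_assoc, List.map_cons,
      List.map_nil, List.cons_append, List.nil_append]
  have hlen : b.word.length = (Nat.bits b.modulus).length + 1 + ((Nat.bits b.size).length + 1) +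
      (b.residues.flatMap encodeNat).length + 1 := by
    simp [Block.word, encodeNat]
    omega
  -- the part after the digits of the modulus
  have h1 {ρ : Stacks} {q : Bool} (hρ : scan.Steps (false, false) { ρ with
        inp := rest
        mods := .inl .comma :: ρ.mods
        mods' := .inl .comma :: ρ.mods'
        res := b.resWord ++ ρ.res } B s' τ) :
      scan.Steps (false, q) { ρ with inp := .inl .comma ::
      ((Nat.bits b.size).map bitSym ++ .inl .comma ::
        ((b.residues.flatMap encodeNat).map .inl ++ .inl .semicolon :: rest)) }
      (B + 2 + 2 * (b.residues.flatMap encodeNat).length + 2 + 2 * (Nat.bits b.size).length + 2)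
      s' τ := by
    refine scan_cons (false, q) (γ := .comma) (σ' := { ρ with
        mods := .inl .comma :: ρ.mods
        mods' := .inl .comma :: ρ.mods' }) (fun k hk => by cases q <;> cases k <;> rfl) ?_
    have : (scanStep (false, q) .comma).1 = (true, false) := by cases q <;> rfl
    rw [this]
    refine scan_size _ (σ := { ρ with
        mods := .inl .comma :: ρ.mods
        mods' := .inl .comma :: ρ.mods' })
      (scan_cons (true, false) (γ := .comma) (σ' := { ρ with
        mods := .inl .comma :: ρ.mods
        mods' := .inl .comma :: ρ.mods' }) (fun k hk => by cases k <;> rfl)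
      (scan_residues _ hres (σ := { ρ with
        mods := .inl .comma :: ρ.mods
        mods' := .inl .comma :: ρ.mods' }) ?_))
    refine scan_cons (true, true) (γ := .semicolon) (σ := { ρ with
        mods := .inl .comma :: ρ.mods
        mods' := .inl .comma :: ρ.mods'
        res := ((b.residues.flatMap encodeNat).map .inl).reverse ++ ρ.res }) (σ' := { ρ with
        mods := .inl .comma :: ρ.mods
        mods' := .inl .comma :: ρ.mods'
        res := b.resWord ++ ρ.res }) (fun k hk => ?_) hρ
    rw [reverse_flatMap_encodeNat]
    cases k <;> rfl
  rw [hword, hlen]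
  rcases hb : Nat.bits b.modulus with _ | ⟨c, w⟩
  · have hsz : b.modulus.size = 0 := by rw [← Nat.size_eq_bits_len, hb]; rfl
    refine (h1 (q := false) (ρ := σ) ?_).mono (by simp; omega)
    simpa [hsz, numWord_eq, hb] using h
  · have hsz : b.modulus.size = w.length + 1 := by rw [← Nat.size_eq_bits_len, hb]; rfl
    refine (scan_cons (false, false) (γ := .bit c) (σ' := { σ with
        mods := bitSym c :: σ.mods
        mods' := bitSym c :: σ.mods' }) (fun k hk => by cases k <;> rfl)
      (scan_modulus w (σ := { σ with
        mods := bitSym c :: σ.mods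
        mods' := bitSym c :: σ.mods' }) (h1 (ρ := { σ with
          mods := (w.map bitSym).reverse ++ bitSym c :: σ.mods
          mods' := (w.map bitSym).reverse ++ bitSym c :: σ.mods'
          file := List.replicate w.length zeroCell ++ σ.file
          back := List.replicate w.length zeroCell ++ σ.back }) ?_))).mono (by simp; omega)
    simpa [hsz, numWord_eq, hb] using h

/-- The number of digits of all moduli, without the lowest digits. Leaving these out, moduli that
are equal to `1` do not count, and `2 ^ places bs` is at most the product of the moduli. -/
def places (bs : List Block) : ℕ := (bs.map fun b => b.modulus.size - 1).sum

theorem steps_scan (bs : List Block) :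
    scan.Steps (false, false) { σ with inp := (bs.flatMap Block.word).map .inl }
      (2 * (bs.flatMap Block.word).length + 1) (false, false)
      { σ with
        inp := []
        mods := (bs.reverse.map Block.modulus).flatMap numWord ++ σ.mods
        mods' := (bs.reverse.map Block.modulus).flatMap numWord ++ σ.mods'
        res := bs.reverse.flatMap Block.resWord ++ σ.res
        file := List.replicate (places bs) zeroCell ++ σ.file
        back := List.replicate (places bs) zeroCell ++ σ.back } := by
  induction bs generalizing σ with
  | nil => exact (within_loop_false rfl : scan.Within ((false, false), Stacks.get { σ with inp := [] }) _ _)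
  | cons b bs ih =>
    have key := ih (σ := { σ with
      mods := numWord b.modulus ++ σ.mods
      mods' := numWord b.modulus ++ σ.mods'
      res := b.resWord ++ σ.res
      file := List.replicate (b.modulus.size - 1) zeroCell ++ σ.file
      back := List.replicate (b.modulus.size - 1) zeroCell ++ σ.back })
    have h0 := scan_block (σ := σ) b key
    have := h0.mono (B' := 2 * ((b :: bs).flatMap Block.word).length + 1)
      (by rw [List.flatMap_cons, List.length_append]; omega)
    rw [← List.map_append, ← List.flatMap_cons] at this
    refine Within.congr this fun k => ?_
    have e (l : List Symb) : List.replicate (places (b :: bs)) zeroCell ++ l =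
        List.replicate (places bs) zeroCell ++
          (List.replicate (b.modulus.size - 1) zeroCell ++ l) := by
      rw [← List.append_assoc, List.replicate_append_replicate, Nat.add_comm]
      rfl
    cases k <;> simp [Stacks.get, e]

end StackProg

namespace StackProg

variable {n : ℕ} {s : Mem} {σ : Stacks}

/-! ### The program -/

/-- The lowest place of the register file if `one` is `1` and the other registers are `0`. -/
def oneCell : Symb := .inr (fun k => k = .one, false, false)

/-- Add two places to the register file, so that it can hold twice the product of the moduli, and
set the register `one` to `1`. -/
def growFile : Prog :=
  seq (act fun s _ => (s, fun k => if k = .file then .push zeroCell else .keep))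
    (act fun s _ => (s, fun k => if k = .file then .push oneCell else .keep))

theorem cells_zero (n : ℕ) : cells n (fun _ => 0) 0 0 = List.replicate n zeroCell := by
  induction n with
  | zero => rfl
  | succ n ih =>
    simp only [cells, Nat.zero_div, ih]
    rfl

theorem regs_one (n : ℕ) :
    regs (n + 1) (fun k => if k = .one then 1 else 0) = oneCell :: List.replicate n zeroCell := by
  have : (fun k : Reg => (if k = .one then 1 else 0) / 2) = fun _ => 0 := by
    funext k
    split_ifs <;> rfl
  simp only [regs, cells, Nat.zero_div, this, cells_zero]
  congr 2
  ext k
  · simp only [lowBit]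
    by_cases h : k = .one <;> simp [h]
  all_goals rfl

theorem steps_growFile (k : ℕ) :
    growFile.Steps s { σ with file := List.replicate (2 * k) zeroCell } 2 s
      { σ with file := regs (2 * k + 2) fun k => if k = .one then 1 else 0 } := by
  refine Steps.seq (B := 1) (B' := 1) (σ' := { σ with file := List.replicate (2 * k + 1) zeroCell })
    (steps_act rfl fun j => ?_) (steps_act rfl fun j => ?_)
  · cases j <;> rfl
  · rw [regs_one]
    cases j <;> rfl

/-- The program: read the input, compute the product of the moduli, and process the blocks,
beginning with the number `0` on the list; write the list on the output tape. -/
def main : Prog :=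
  seq scan <| seq fromBack <| seq growFile <| seq emitT <| seq listBack <|
  seq (addMod .u .one .zero .zero) <| seq multiplyAll <| seq (addMod .modulus .u .zero .zero) <|
  seq processBlocks <| seq (fan .list fun k => match k with
    | .list' => some fun _ γ => γ
    | _ => none) output

/-- The number of digits of a number is at most twice the number without the lowest digit, except
for the number `1`, which does not contribute to the product. -/
theorem prod_le_two_pow (bs : List Block) : (bs.map Block.modulus).prod ≤ 2 ^ (2 * places bs) := by
  induction bs with
  | nil => simp [places]
  | cons b bs ih =>
    have h : b.modulus ≤ 2 ^ (2 * (b.modulus.size - 1)) := by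
      rcases Nat.lt_or_ge b.modulus 2 with h | h
      · exact (Nat.le_of_lt_succ h).trans Nat.one_le_two_pow
      · have h2 : 2 ≤ b.modulus.size := by
          by_contra hlt
          have := Nat.lt_size_self b.modulus
          have h3 := Nat.pow_le_pow_right (n := 2) (by omega) (show b.modulus.size ≤ 1 by omega)
          omega
        exact (Nat.lt_size_self _).le.trans (Nat.pow_le_pow_right (by omega) (by omega))
    have e : places (b :: bs) = (b.modulus.size - 1) + places bs := by simp [places]
    rw [List.map_cons, List.prod_cons, e, mul_add, pow_add]
    exact Nat.mul_le_mul h ih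

theorem length_moduli_le (bs : List Block) :
    ((bs.reverse.map Block.modulus).flatMap numWord).length ≤ (bs.flatMap Block.word).length := by
  rw [List.map_reverse, length_flatMap_reverse]
  induction bs with
  | nil => simp
  | cons b bs ih =>
    have : b.modulus.size + 1 ≤ b.word.length := by
      simp [Block.word, encodeNat, Nat.size_eq_bits_len]
    simp only [List.map_cons, List.flatMap_cons, List.length_append, length_numWord]
    omega

/-- The numbers which the program lists. -/
def combine {M : ℕ} (G : Block → ZMod M) (bs : List Block) : List ℕ :=
  bs.reverse.foldl (fun ys b => shifts M (G b).val b.residues ys) [0]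

theorem combine_lt {M : ℕ} (hM : 0 < M) (G : Block → ZMod M) (bs : List Block) :
    ∀ z ∈ combine G bs, z < M := by
  rw [combine, List.foldl_reverse]
  cases bs with
  | nil => simpa using hM
  | cons b bs => exact shifts_lt hM _ _

/-- A bound for the number of steps of the program. -/
def mainCost (bs : List Block) (z : ℕ) : ℕ :=
  (8 * (bs.flatMap Block.word).length + blocksCost (2 * places bs + 2) bs.reverse 1 + 4 * z + 10) *
    unit (2 * places bs + 2)

theorem steps_main {M : ℕ} (G : Block → ZMod M) (bs : List Block)
    (hM : (bs.map Block.modulus).prod = M) (hpos : ∀ b ∈ bs, 0 < b.modulus)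
    (hc : ∀ b ∈ bs, Nat.Coprime (M / b.modulus) b.modulus)
    (hG : ∀ b ∈ bs, ((M / b.modulus : ℕ) : ZMod M) * G b = (M / b.modulus : ℕ))
    (hG' : ∀ b ∈ bs, (b.modulus : ZMod M) * G b = 0) :
    ∃ s' τ, main.Steps (false, false) { inp := (bs.flatMap Block.word).map .inl }
      (mainCost bs (combine G bs).length) s' τ ∧
      τ.out = ((combine G bs).flatMap encodeNat).map .inl := by
  set k := places bs with hk
  set n := 2 * k + 2 with hn
  have hM0 : 0 < M := by
    rw [← hM]
    exact List.prod_pos (by simpa using hpos)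
  have hMn : 2 * M < 2 ^ n := by
    have := prod_le_two_pow bs
    rw [hM] at this
    rw [hn, pow_add, ← hk] at *
    omega
  have hMr : (bs.reverse.map Block.modulus).prod = M := by
    rw [← hM, List.map_reverse, List.prod_reverse]
  have h1n : 1 < 2 ^ n := by omega
  set r0 : Reg → ℕ := fun k => if k = .one then 1 else 0 with hr0
  have h1 := steps_scan (σ := {}) bs
  rw [← hk] at h1
  set mo := (bs.reverse.map Block.modulus).flatMap numWord with hmo
  set re := bs.reverse.flatMap Block.resWord with hre
  simp only [List.append_nil] at h1
  have h2 : fromBack.Steps (false, false)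
      { file := List.replicate k zeroCell
        back := List.replicate k zeroCell
        mods := mo
        mods' := mo
        res := re } (2 * k + 1)
      (false, false)
      { mods := mo, mods' := mo, res := re, file := List.replicate (2 * k) zeroCell } := by
    refine ((within_fan ..).congr fun j => ?_).mono (by simp [Stacks.get])
    rw [two_mul, ← List.replicate_append_replicate]
    cases j <;> simp [Stacks.get]
  have h3 := steps_growFile (s := (false, false)) (σ := { mods := mo, mods' := mo, res := re }) k
  have h4 := steps_emitT (n := n) (r := r0) (s := (false, false))
    (σ := { mods := mo, mods' := mo, res := re, file := regs n r0 }) rfl rfl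
  rw [List.append_nil] at h4
  have h5 := steps_listBack (s := (false, false))
    (σ := { mods := mo, mods' := mo, res := re, file := regs n r0, list' := (digits n 0).reverse })
    (τ := { mods := mo, mods' := mo, res := re, file := regs n r0, list := [0].flatMap (digits n) })
    (by simp)
  have h6 := steps_assign (n := n) (r := r0) (dst := .u) (x := .one) (y := .zero) (m := .zero)
    (s := (false, false))
    (σ := { mods := mo, mods' := mo, res := re, file := regs n r0, list := [0].flatMap (digits n) })
    1 rfl rfl (by simp [hr0]) (by simp [hr0]) (by simp [hr0])
  obtain ⟨r7, s7, u7, z7, o7, m7, h7⟩ := steps_multiplyAll (n := n)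
    (r := Function.update r0 .u 1) (s := (false, decide (r0 .one + r0 .zero < r0 .zero)))
    (σ := { mods := mo, res := re, list := [0].flatMap (digits n) })
    (bs.reverse.map Block.modulus) (by simpa using hpos)
    (by rw [hMr]; simp; omega) (by simp [hr0]) (by simp [hr0]) (by simp [hr0]) rfl
  rw [hMr] at u7
  have u7' : r7 .u = M := by simpa using u7
  have h8 := steps_assign (n := n) (r := r7) (dst := .modulus) (x := .u) (y := .zero) (m := .zero)
    (s := s7) (σ := { mods := mo, res := re, list := [0].flatMap (digits n), file := regs n r7 })
    M rfl rfl (by rw [z7, u7']; omega) (by rw [z7]; omega) (by simp [z7, u7'])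
  obtain ⟨r9, s9, h9⟩ := steps_processBlocks (n := n) (r := Function.update r7 .modulus M)
    (s := (false, decide (r7 .u + r7 .zero < r7 .zero))) (σ := {}) G bs.reverse [0] hM0 hMn
    (by simp) (by simp [z7]) (by simp [o7])
    (fun b hb => hM ▸ List.dvd_prod (List.mem_map_of_mem (by simpa using hb)))
    (by simpa using hc) (by simpa using hG) (by simpa using hG') (by simpa using hM0)
    rfl rfl rfl rfl
  set zs := combine G bs with hzs
  obtain ⟨s', h10⟩ := steps_output (n := n) (r := r9) (s := s9) (σ := {}) zs.reverse
    (fun z hz => by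
      have := combine_lt hM0 G bs z (by simpa using hz)
      omega) (by omega) rfl
  have h9' : (fan .list fun k => match k with
      | .list' => some fun _ γ => γ
      | _ => none : Prog).Steps s9 { file := regs n r9, list := zs.flatMap (digits n) }
      (2 * (zs.length * n) + 1) s9
      { file := regs n r9, list' := zs.reverse.flatMap fun z => (digits n z).reverse } := by
    refine ((within_fan ..).congr fun j => ?_).mono (by simp [Stacks.get])
    cases j <;> simp [Stacks.get, List.reverse_flatMap, Function.comp_def]
  have e78 := h7.seq (h8.seq (h9.seq (h9'.seq h10)))
  have e56 := h5.seq (h6.seq e78)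
  have e := h1.seq (h2.seq (h3.seq (h4.seq e56)))
  refine ⟨s', _, e.mono ?_, ?_⟩
  · have hW : mo.length ≤ (bs.flatMap Block.word).length := length_moduli_le bs
    simp only [mainCost, ← hk, ← hn, ← hmo, List.length_reverse, length_digits,
      List.length_singleton]
    generalize (bs.flatMap Block.word).length = W at *
    generalize blocksCost n bs.reverse 1 = c
    generalize zs.length = z
    have g0 : unit n = 4 * n + 4 := rfl
    have g1 : 2 * (z * n) + 2 * z ≤ z * unit n := by rw [g0]; linarith [Nat.zero_le (z * n)]
    have g2 : 2 * W ≤ W * unit n := by rw [g0]; linarith [Nat.zero_le (W * n)]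
    have g3 : mo.length * unit n ≤ W * unit n := Nat.mul_le_mul_right _ hW
    have g4 : (8 * W + c + 4 * z + 10) * unit n = 8 * (W * unit n) + c * unit n +
      4 * (z * unit n) + 10 * unit n := by ring
    have g5 : (6 * mo.length + 1) * unit n = 6 * (mo.length * unit n) + unit n := by ring
    have g6 : (2 * z + 1) * unit n = 2 * (z * unit n) + unit n := by ring
    omega
  · simp [hzs]

end StackProg

namespace StackProg

/-- The Turing machine of the program. -/
def machine : MultitapeTM :=
  toTM (K := Stk) (W := WorkSymbol) .inp .out (by simp) ((false, false) : Mem) main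

theorem machine_outputs {M : ℕ} (G : Block → ZMod M) (bs : List Block)
    (hM : (bs.map Block.modulus).prod = M) (hpos : ∀ b ∈ bs, 0 < b.modulus)
    (hc : ∀ b ∈ bs, Nat.Coprime (M / b.modulus) b.modulus)
    (hG : ∀ b ∈ bs, ((M / b.modulus : ℕ) : ZMod M) * G b = (M / b.modulus : ℕ))
    (hG' : ∀ b ∈ bs, (b.modulus : ZMod M) * G b = 0) :
    ∃ t ≤ 2 * mainCost bs (combine G bs).length,
      machine.Outputs (bs.flatMap Block.word) t ((combine G bs).flatMap encodeNat) := by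
  obtain ⟨s', τ, h, hout⟩ := steps_main G bs hM hpos hc hG hG'
  refine Within.outputs (c' := (s', τ.get)) (?_) hout
  refine cast ?_ h
  unfold Steps
  congr
  funext k
  cases k <;> rfl

end StackProg

namespace CRTInput

variable (I : CRTInput)

/-! ### Mixed radix digits -/

/-- The place value `κ₁ ⋯ κ_{i-1}`. -/
def place (i : ℕ) : ℕ := ∏ j ∈ Finset.Ico 1 i, I.kappa j

/-- The `i`-th digit of `ν` in the number system with the place values `place i`. -/
def digit (i ν : ℕ) : ℕ := ν / I.place i % I.kappa i

theorem place_one : I.place 1 = 1 := by simp [place]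

theorem place_succ {i : ℕ} (hi : 1 ≤ i) : I.place (i + 1) = I.place i * I.kappa i :=
  Finset.prod_Ico_succ_top hi _

theorem prod_kappa : ∏ i ∈ Finset.Icc 1 I.d, I.kappa i = I.place (I.d + 1) := by
  rw [place, ← Finset.Ico_add_one_right_eq_Icc]

theorem kappa_pos {i : ℕ} (hi : i ∈ Finset.Icc 1 I.d) : 0 < I.kappa i :=
  Finset.card_pos.mpr (I.nonempty i hi)

theorem place_pos {i : ℕ} (hi : i ≤ I.d + 1) : 0 < I.place i :=
  Finset.prod_pos fun j hj => I.kappa_pos (by simp at hj ⊢; omega)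

theorem digit_lt {i : ℕ} (hi : i ∈ Finset.Icc 1 I.d) (ν : ℕ) : I.digit i ν < I.kappa i :=
  Nat.mod_lt _ (I.kappa_pos hi)

theorem digit_zero (i : ℕ) : I.digit i 0 = 0 := by simp [digit]

/-- The digit `i` is incremented if all lower digits overflow. -/
theorem digit_succ_of_dvd {i ν : ℕ} (h : I.place i ∣ ν + 1) :
    I.digit i (ν + 1) = (I.digit i ν + 1) % I.kappa i := by
  simp [digit, Nat.succ_div, h]

theorem digit_succ_of_not_dvd {i ν : ℕ} (h : ¬ I.place i ∣ ν + 1) :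
    I.digit i (ν + 1) = I.digit i ν := by
  simp [digit, Nat.succ_div, h]

theorem place_dvd {i j : ℕ} (h : i ≤ j) : I.place i ∣ I.place j :=
  Finset.prod_dvd_prod_of_subset _ _ _ (Finset.Ico_subset_Ico_right h)

/-- If all digits below the `i`-th are `0`, then the next place value divides `ν` if and only if the
`i`-th digit is `0` too. -/
theorem place_succ_dvd_iff {i ν : ℕ} (hi : i ∈ Finset.Icc 1 I.d) (h : I.place i ∣ ν) :
    I.place (i + 1) ∣ ν ↔ I.digit i ν = 0 := by
  have hi' := Finset.mem_Icc.mp hi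
  obtain ⟨x, rfl⟩ := h
  rw [place_succ _ hi'.1, digit, Nat.mul_div_cancel_left _ (I.place_pos (by omega)),
    Nat.mul_dvd_mul_iff_left (I.place_pos (by omega)), Nat.dvd_iff_mod_eq_zero]

theorem eq_of_digit_eq {ν ν' : ℕ} (hν : ν < I.place (I.d + 1)) (hν' : ν' < I.place (I.d + 1))
    (h : ∀ i ∈ Finset.Icc 1 I.d, I.digit i ν = I.digit i ν') : ν = ν' := by
  have key : ∀ k ≤ I.d, ν % I.place (k + 1) = ν' % I.place (k + 1) := by
    intro k hk
    induction k with
    | zero => simp [place_one, Nat.mod_one]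
    | succ k ih =>
      have := h (k + 1) (by simp; omega)
      unfold digit at this
      rw [place_succ _ (by omega), Nat.mod_mul, Nat.mod_mul, this, ih (by omega)]
  simpa [Nat.mod_eq_of_lt, hν, hν'] using key I.d le_rfl

theorem exists_digit_eq {l : ℕ → ℕ} (hl : ∀ i ∈ Finset.Icc 1 I.d, l i < I.kappa i) :
    ∃ ν < I.place (I.d + 1), ∀ i ∈ Finset.Icc 1 I.d, I.digit i ν = l i := by
  have key : ∀ k ≤ I.d, ∃ ν < I.place (k + 1), ∀ i ∈ Finset.Icc 1 k, I.digit i ν = l i := by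
    intro k hk
    induction k with
    | zero => exact ⟨0, I.place_pos (by omega), by simp⟩
    | succ k ih =>
      obtain ⟨ν, hν, h⟩ := ih (by omega)
      have hp : 0 < I.place (k + 1) := I.place_pos (by omega)
      have hlk := hl (k + 1) (by simp; omega)
      refine ⟨ν + I.place (k + 1) * l (k + 1), ?_, fun i hi => ?_⟩
      · rw [I.place_succ (i := k + 1) (by omega)]
        have := Nat.mul_le_mul_left (I.place (k + 1)) hlk
        rw [Nat.mul_succ] at this
        omega
      · rcases (Finset.mem_Icc.mp hi).2.lt_or_eq with hik | rfl
        · have hi' : i ∈ Finset.Icc 1 k := by simp at hi ⊢; omega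
          rw [← h i hi']
          obtain ⟨q, hq⟩ := I.place_dvd (show i + 1 ≤ k + 1 by omega)
          rw [place_succ _ (Finset.mem_Icc.mp hi).1] at hq
          rw [digit, hq, mul_assoc, mul_assoc,
            Nat.add_mul_div_left _ _ (I.place_pos (by omega)), Nat.add_mul_mod_self_left, digit]
        · rw [digit, Nat.add_mul_div_left _ _ hp, Nat.div_eq_of_lt hν, zero_add,
            Nat.mod_eq_of_lt hlk]
  exact key I.d le_rfl

/-! ### The run of the algorithm -/

/-- The `ν`-th number listed by the algorithm. -/
def term (ν : ℕ) : ZMod I.M :=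
  ∑ i ∈ Finset.Icc 1 I.d, ((I.a i (I.digit i ν + 1)).val : ZMod I.M) * I.gaussM i

/-- Adding `Δ` replaces the residue for the digit `e` by the residue for the next digit, also if
the digit overflows. -/
theorem delta_eq {i e : ℕ} (he : e < I.kappa i) :
    I.delta i ((e + 1) % I.kappa i) = ((I.a i ((e + 1) % I.kappa i + 1)).val : ZMod I.M) * I.gaussM i -
      ((I.a i (e + 1)).val : ZMod I.M) * I.gaussM i := by
  rcases Nat.lt_or_ge (e + 1) (I.kappa i) with h | h
  · rw [Nat.mod_eq_of_lt h, delta, if_neg (by omega), sub_mul]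
  · obtain rfl' : e + 1 = I.kappa i := by omega
    rw [rfl', Nat.mod_self, delta, if_pos rfl, sub_mul]

/-- The inner loop performs the carries in the addition of `1` to `ν`, and ends at the highest digit
that changes. -/
theorem exists_mem_eval {ν : ℕ} (hν : ν + 1 < I.place (I.d + 1)) {μ : ℕ}
    (hμ : μ ∈ Finset.Icc 1 I.d) (hdvd : I.place μ ∣ ν + 1) {r : ℕ → ℕ}
    (hr : ∀ i ∈ Finset.Icc 1 μ, r i = I.digit i (ν + 1))
    (hr' : ∀ i ∈ Finset.Ioc μ I.d, r i = I.digit i ν) :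
    ∃ p ∈ StateTransition.eval I.whileStep (r, μ), p.2 ∈ Finset.Icc 1 I.d ∧
      I.place p.2 ∣ ν + 1 ∧ ¬ I.place (p.2 + 1) ∣ ν + 1 ∧
      ∀ i ∈ Finset.Icc 1 I.d, p.1 i = I.digit i (ν + 1) := by
  have hμ' := Finset.mem_Icc.mp hμ
  have hrμ := hr μ (by simp; omega)
  by_cases h0 : r μ = 0
  · have hd := (I.place_succ_dvd_iff hμ hdvd).mpr (hrμ ▸ h0)
    have hlt : μ < I.d := by
      by_contra hge
      obtain rfl : μ = I.d := by omega
      exact absurd (Nat.le_of_dvd (by omega) hd) (by omega)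
    obtain ⟨p, hp, h⟩ := exists_mem_eval hν (μ := μ + 1) (by simp; omega) hd
      (r := I.incr r (μ + 1))
      (fun i hi => by
        rcases eq_or_ne i (μ + 1) with rfl | hne
        · rw [incr, Function.update_self, hr' _ (by simp; omega), I.digit_succ_of_dvd hd]
        · rw [incr, Function.update_of_ne hne, hr i (by simp at hi ⊢; omega)])
      (fun i hi => by
        have hi' := Finset.mem_Ioc.mp hi
        rw [incr, Function.update_of_ne (by omega), hr' i (by simp; omega)])
    refine ⟨p, ?_, h⟩
    rw [StateTransition.mem_eval] at hp ⊢
    exact ⟨Relation.ReflTransGen.head (by simp [whileStep, h0]) hp.1, hp.2⟩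
  · have hnd : ¬ I.place (μ + 1) ∣ ν + 1 := by
      rwa [I.place_succ_dvd_iff hμ hdvd, ← hrμ]
    refine ⟨(r, μ), ?_, hμ, hdvd, hnd, fun i hi => ?_⟩
    · rw [StateTransition.mem_eval]
      exact ⟨Relation.ReflTransGen.refl, by simp [whileStep, h0]⟩
    · rcases Nat.lt_or_ge μ i with h | h
      · have hi' := Finset.mem_Icc.mp hi
        change r i = _
        rw [hr' i (by simp; omega), I.digit_succ_of_not_dvd fun h' =>
          hnd ((I.place_dvd (by omega)).trans h')]
      · exact hr i (by simp at hi ⊢; omega)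
termination_by I.d - μ

theorem mainStep_eq {ν : ℕ} (hν : ν + 1 < I.place (I.d + 1)) {r : ℕ → ℕ}
    (hr : ∀ i ∈ Finset.Icc 1 I.d, r i = I.digit i ν) :
    ∃ r', (∀ i ∈ Finset.Icc 1 I.d, r' i = I.digit i (ν + 1)) ∧
      I.mainStep (r, I.term ν) = Part.some (r', I.term (ν + 1)) := by
  have hd : 1 ≤ I.d := by
    by_contra h
    obtain h : I.d = 0 := by omega
    rw [h, zero_add, place_one] at hν
    omega
  obtain ⟨p, hp, hp2, hdvd, hnd, h⟩ := I.exists_mem_eval hν (μ := 1) (by simpa using hd)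
    (by simp [place_one]) (r := I.incr r 1)
    (fun i hi => by
      obtain rfl : i = 1 := by simpa using hi
      rw [incr, Function.update_self, hr _ (by simpa using hd),
        I.digit_succ_of_dvd (by simp [place_one])])
    (fun i hi => by
      have hi' := Finset.mem_Ioc.mp hi
      rw [incr, Function.update_of_ne (by omega), hr i (by simp; omega)])
  have hp2' := Finset.mem_Icc.mp hp2
  refine ⟨p.1, h, ?_⟩
  rw [mainStep, Part.eq_some_iff.mpr hp]
  change (Part.some p).bind _ = _
  rw [Part.bind_some]
  change Part.some _ = Part.some _
  congr 2
  change I.term ν + _ = _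
  rw [eq_comm, ← sub_eq_iff_eq_add', term, term, ← Finset.sum_sub_distrib]
  refine (Finset.sum_subset_zero_on_sdiff (Finset.Icc_subset_Icc_right hp2'.2)
    (fun i hi => ?_) (fun i hi => ?_)).symm
  · simp only [Finset.mem_sdiff, Finset.mem_Icc] at hi
    rw [I.digit_succ_of_not_dvd fun h' => hnd ((I.place_dvd (by omega)).trans h'), sub_self]
  · have hi' := Finset.mem_Icc.mp hi
    have hi2 : i ∈ Finset.Icc 1 I.d := by simp; omega
    rw [h i hi2, I.digit_succ_of_dvd ((I.place_dvd hi'.2).trans hdvd),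
      I.delta_eq (I.digit_lt hi2 ν)]

theorem mainLoop_eq (n ν : ℕ) (hν : ν + n < I.place (I.d + 1)) (r : ℕ → ℕ)
    (hr : ∀ i ∈ Finset.Icc 1 I.d, r i = I.digit i ν) :
    I.mainLoop n (r, I.term ν) = Part.some ((List.range' (ν + 1) n).map I.term) := by
  induction n generalizing ν r with
  | zero => rfl
  | succ n ih =>
    obtain ⟨r', hr', h⟩ := I.mainStep_eq (by omega) hr
    rw [mainLoop, h]
    change (Part.some _).bind _ = _
    rw [Part.bind_some, ih (ν + 1) (by omega) r' hr']
    change (Part.some _).bind _ = _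
    rw [Part.bind_some]
    rfl

theorem algorithm_eq : I.algorithm = Part.some ((List.range (I.place (I.d + 1))).map I.term) := by
  have hp := I.place_pos le_rfl
  have h1 : I.x1 = I.term 0 := by simp [x1, term, digit_zero]
  rw [algorithm, prod_kappa, h1, I.mainLoop_eq _ 0 (by omega) _ (by simp [digit_zero])]
  change (Part.some _).bind _ = _
  rw [Part.bind_some]
  change Part.some _ = _
  rw [← List.map_cons, List.range_eq_range']
  congr 2
  obtain ⟨P, hP⟩ := Nat.exists_eq_succ_of_ne_zero hp.ne'
  rw [hP]
  rfl

end CRTInput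

namespace CRTInput

variable (I : CRTInput)

/-! ### Chinese remaindering -/

theorem M_pos : 0 < I.M := Finset.prod_pos I.m_pos

theorem M_div_mul {i : ℕ} (hi : i ∈ Finset.Icc 1 I.d) : I.M / I.m i * I.m i = I.M :=
  Nat.div_mul_cancel (I.dvd_M hi)

theorem M_div_eq {i : ℕ} (hi : i ∈ Finset.Icc 1 I.d) :
    I.M / I.m i = ∏ j ∈ (Finset.Icc 1 I.d).erase i, I.m j := by
  rw [M, ← Finset.mul_prod_erase _ _ hi, Nat.mul_div_cancel_left _ (I.m_pos i hi)]

theorem coprime_M_div {i : ℕ} (hi : i ∈ Finset.Icc 1 I.d) : Nat.Coprime (I.M / I.m i) (I.m i) := by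
  rw [I.M_div_eq hi]
  refine Nat.Coprime.prod_left fun j hj => ?_
  rw [Finset.mem_erase] at hj
  exact I.coprime j hj.2 i hi hj.1

theorem dvd_M_div {i j : ℕ} (hi : i ∈ Finset.Icc 1 I.d) (hj : j ∈ Finset.Icc 1 I.d) (hij : i ≠ j) :
    I.m i ∣ I.M / I.m j := by
  rw [I.M_div_eq hj]
  exact Finset.dvd_prod_of_mem _ (Finset.mem_erase.mpr ⟨hij, hi⟩)

/-- An element of `ℤ/M` is determined by its images in the rings `ℤ/m i`. -/
theorem eq_of_castHom_eq {x y : ZMod I.M}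
    (h : ∀ i (hi : i ∈ Finset.Icc 1 I.d), ZMod.castHom (I.dvd_M hi) (ZMod (I.m i)) x =
      ZMod.castHom (I.dvd_M hi) (ZMod (I.m i)) y) : x = y := by
  have : NeZero I.M := ⟨I.M_pos.ne'⟩
  rw [← sub_eq_zero, ← ZMod.natCast_zmod_val (x - y), ZMod.natCast_eq_zero_iff]
  refine Finset.prod_dvd_of_isRelPrime (fun i hi j hj hij =>
    Nat.coprime_iff_isRelPrime.mp (I.coprime i hi j hj hij)) fun i hi => ?_
  rw [← ZMod.natCast_eq_zero_iff, ← map_natCast (ZMod.castHom (I.dvd_M hi) (ZMod (I.m i))),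
    ZMod.natCast_zmod_val, map_sub, h i hi, sub_self]

theorem gaussM_eq {i : ℕ} (hi : i ∈ Finset.Icc 1 I.d) :
    I.gaussM i = ((I.M / I.m i * I.c i : ℕ) : ZMod I.M) := by
  rw [gaussM, Nat.mul_div_right_comm (I.dvd_M hi)]

theorem castHom_gaussM {i j : ℕ} (hi : i ∈ Finset.Icc 1 I.d) (hj : j ∈ Finset.Icc 1 I.d) :
    ZMod.castHom (I.dvd_M hi) (ZMod (I.m i)) (I.gaussM j) = if i = j then 1 else 0 := by
  rw [I.gaussM_eq hj, map_natCast, Nat.cast_mul]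
  split_ifs with h
  · subst h
    have : NeZero (I.m i) := ⟨(I.m_pos i hi).ne'⟩
    rw [c, ZMod.natCast_zmod_val, ZMod.coe_mul_inv_eq_one _ (I.coprime_M_div hi)]
  · rw [(ZMod.natCast_eq_zero_iff _ _).mpr (I.dvd_M_div hi hj h), zero_mul]

theorem M_div_mul_gaussM {i : ℕ} (hi : i ∈ Finset.Icc 1 I.d) :
    ((I.M / I.m i : ℕ) : ZMod I.M) * I.gaussM i = (I.M / I.m i : ℕ) := by
  refine I.eq_of_castHom_eq fun j hj => ?_
  rw [map_mul, I.castHom_gaussM hj hi, map_natCast]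
  split_ifs with h
  · rw [mul_one]
  · rw [(ZMod.natCast_eq_zero_iff _ _).mpr (I.dvd_M_div hj hi h), zero_mul]

theorem m_mul_gaussM {i : ℕ} (hi : i ∈ Finset.Icc 1 I.d) :
    (I.m i : ZMod I.M) * I.gaussM i = 0 := by
  refine I.eq_of_castHom_eq fun j hj => ?_
  rw [map_mul, I.castHom_gaussM hj hi, map_natCast, map_zero]
  split_ifs with h
  · rw [h, ZMod.natCast_self, zero_mul]
  · rw [mul_zero]

theorem castHom_term {i : ℕ} (hi : i ∈ Finset.Icc 1 I.d) (ν : ℕ) :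
    ZMod.castHom (I.dvd_M hi) (ZMod (I.m i)) (I.term ν) = I.a i (I.digit i ν + 1) := by
  have : NeZero (I.m i) := ⟨(I.m_pos i hi).ne'⟩
  rw [term, map_sum, Finset.sum_eq_single_of_mem i hi fun j hj hji => by
    rw [map_mul, I.castHom_gaussM hi hj, if_neg hji.symm, mul_zero]]
  rw [map_mul, I.castHom_gaussM hi hi, if_pos rfl, mul_one, map_natCast, ZMod.natCast_zmod_val]

theorem nodup_terms : ((List.range (I.place (I.d + 1))).map I.term).Nodup := by
  refine List.Nodup.map_on (fun ν hν ν' hν' h => ?_) List.nodup_range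
  rw [List.mem_range] at hν hν'
  refine I.eq_of_digit_eq hν hν' fun i hi => ?_
  have h1 := congrArg (ZMod.castHom (I.dvd_M hi) (ZMod (I.m i))) h
  rw [I.castHom_term hi, I.castHom_term hi] at h1
  have h2 (ν) : I.digit i ν + 1 ∈ Set.Icc 1 (I.A i).card := ⟨by omega, I.digit_lt hi ν⟩
  exact Nat.succ.inj ((I.enum i hi).injOn (h2 ν) (h2 ν') h1)

theorem mem_terms (x : ZMod I.M) :
    x ∈ (List.range (I.place (I.d + 1))).map I.term ↔ x ∈ I.crtSet := by
  rw [List.mem_map]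
  constructor
  · rintro ⟨ν, -, rfl⟩
    exact ⟨fun i => I.a i (I.digit i ν + 1), fun i hi =>
      ⟨(I.enum i hi).mapsTo ⟨by omega, I.digit_lt hi ν⟩, I.castHom_term hi ν⟩⟩
  · rintro ⟨α, hα⟩
    have (i : ℕ) : ∃ l, i ∈ Finset.Icc 1 I.d → l < I.kappa i ∧ I.a i (l + 1) = α i := by
      by_cases hi : i ∈ Finset.Icc 1 I.d
      · obtain ⟨l, ⟨h1, h2⟩, h⟩ := (I.enum i hi).surjOn (hα i hi).1
        refine ⟨l - 1, fun _ => ⟨?_, ?_⟩⟩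
        · unfold kappa; omega
        · rwa [Nat.sub_add_cancel h1]
      · exact ⟨0, fun h => absurd h hi⟩
    choose l hl using this
    obtain ⟨ν, hν, h⟩ := I.exists_digit_eq (l := l) fun i hi => (hl i hi).1
    refine ⟨ν, List.mem_range.mpr hν, I.eq_of_castHom_eq fun i hi => ?_⟩
    rw [I.castHom_term hi, h i hi, (hl i hi).2, (hα i hi).2]

theorem ncard_crtSet : I.crtSet.ncard = I.place (I.d + 1) := by
  classical
  have : I.crtSet = ((List.range (I.place (I.d + 1))).map I.term).toFinset := by
    ext x
    rw [Finset.mem_coe, List.mem_toFinset, mem_terms]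
  rw [this, Set.ncard_coe_finset, List.toFinset_card_of_nodup I.nodup_terms, List.length_map,
    List.length_range]

end CRTInput

namespace CRTInput

variable (I : CRTInput)

/-! ### The input and the output of the machine -/

/-- The part of the input that belongs to the index `i`. -/
def block (i : ℕ) : Block where
  modulus := I.m i
  size := I.kappa i
  residues := (List.range (I.kappa i)).map fun j => (I.a i (j + 1)).val

/-- The input as a list of blocks. -/
def blocks : List Block := (List.range' 1 I.d).map I.block

theorem encode_eq : I.encode = I.blocks.flatMap Block.word := by
  simp [encode, blocks, block, Block.word, List.range'_eq_map_range, List.flatMap_map,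
    Function.comp_def, Nat.add_comm]

/-- The Gauss idempotent of a block. -/
def gauss (b : Block) : ZMod I.M :=
  ((I.M / b.modulus * (((I.M / b.modulus : ℕ) : ZMod b.modulus)⁻¹).val : ℕ) : ZMod I.M)

theorem gauss_block {i : ℕ} (hi : i ∈ Finset.Icc 1 I.d) : I.gauss (I.block i) = I.gaussM i :=
  (I.gaussM_eq hi).symm

/-- The sum of `term`, for a number system with the digits in `L`, the lowest one first. -/
def sumDigits : List ℕ → ℕ → ZMod I.M
  | [], _ => 0
  | i :: L, ν =>
    ((I.a i (ν % I.kappa i + 1)).val : ZMod I.M) * I.gaussM i + sumDigits L (ν / I.kappa i)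

/-- Dividing `ν` by a place value removes the lower digits. -/
theorem sumDigits_range' (n k ν : ℕ) (hk : 1 ≤ k) :
    I.sumDigits (List.range' k n) (ν / I.place k) = ∑ i ∈ Finset.Ico k (k + n),
      ((I.a i (I.digit i ν + 1)).val : ZMod I.M) * I.gaussM i := by
  induction n generalizing k with
  | zero => simp [sumDigits]
  | succ n ih =>
    rw [List.range'_succ, sumDigits, Nat.div_div_eq_div_mul, ← I.place_succ hk, ih _ (by omega),
      Finset.sum_eq_sum_Ico_succ_bot (show k < k + (n + 1) by omega), Nat.add_right_comm]
    rfl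

theorem flatMap_range {α : Type*} (f : ℕ → α) (a b : ℕ) :
    ((List.range a).flatMap fun q => (List.range b).map fun l => f (q * b + l)) =
      (List.range (b * a)).map f := by
  induction a with
  | zero => simp
  | succ a ih =>
    rw [List.range_succ, List.flatMap_append, ih, Nat.mul_succ, List.range_add, List.map_append]
    simp [Function.comp_def, Nat.mul_comm]

/-- Processing one more block adds a digit in the lowest place. -/
theorem foldr_shifts (L : List ℕ) (hL : ∀ i ∈ L, i ∈ Finset.Icc 1 I.d) :
    L.foldr (fun i ys => shifts I.M (I.gauss (I.block i)).val (I.block i).residues ys) [0] =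
      (List.range (L.map I.kappa).prod).map fun ν => (I.sumDigits L ν).val := by
  have : NeZero I.M := ⟨I.M_pos.ne'⟩
  induction L with
  | nil => simp [sumDigits]
  | cons i L ih =>
    have hi := hL i (by simp)
    rw [List.foldr_cons, ih fun j hj => hL j (by simp [hj]), List.map_cons, List.prod_cons,
      ← flatMap_range, shifts, List.flatMap_map, I.gauss_block hi]
    refine congrArg₂ _ (funext fun q => ?_) rfl
    simp only [block, List.map_map]
    refine List.map_congr_left fun l hl => ?_
    have hl' := List.mem_range.mp hl
    rw [Function.comp, Nat.add_mod_mod, sumDigits, Nat.mul_comm q, Nat.mul_add_mod,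
      Nat.mod_eq_of_lt hl', Nat.mul_add_div (I.kappa_pos hi), Nat.div_eq_of_lt hl', add_zero,
      ← ZMod.val_natCast, Nat.cast_add, Nat.cast_mul, ZMod.natCast_zmod_val, ZMod.natCast_zmod_val,
      add_comm]

theorem prod_range' (f : ℕ → ℕ) (k n : ℕ) :
    ((List.range' k n).map f).prod = ∏ i ∈ Finset.Ico k (k + n), f i := by
  induction n with
  | zero => simp
  | succ n ih =>
    rw [List.range'_1_concat, List.map_append, List.prod_append, ih, ← add_assoc,
      Finset.prod_Ico_succ_top (by omega)]
    simp

theorem mem_range' {i : ℕ} : i ∈ List.range' 1 I.d ↔ i ∈ Finset.Icc 1 I.d := by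
  rw [List.mem_range'_1, Finset.mem_Icc]
  omega

/-- The machine lists the same numbers as the algorithm, in the same order. -/
theorem combine_blocks :
    StackProg.combine I.gauss I.blocks =
      (List.range (I.place (I.d + 1))).map fun ν => (I.term ν).val := by
  rw [StackProg.combine, List.foldl_reverse, blocks, List.foldr_map,
    I.foldr_shifts _ fun i hi => I.mem_range'.mp hi, prod_range', add_comm 1]
  refine List.map_congr_left fun ν _ => ?_
  have := I.sumDigits_range' I.d 1 ν le_rfl
  rw [place_one, Nat.div_one] at this
  rw [this, term, add_comm 1, ← Finset.Ico_add_one_right_eq_Icc]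

theorem prod_modulus : (I.blocks.map Block.modulus).prod = I.M := by
  rw [blocks, List.map_map]
  refine (prod_range' I.m 1 I.d).trans ?_
  rw [M, add_comm 1, Finset.Ico_add_one_right_eq_Icc]

theorem exists_outputs : ∃ t ≤ 2 * StackProg.mainCost I.blocks (I.place (I.d + 1)),
    StackProg.machine.Outputs I.encode t
      (encodeResidues ((List.range (I.place (I.d + 1))).map I.term)) := by
  have hblock {p : Block → Prop} (h : ∀ i ∈ Finset.Icc 1 I.d, p (I.block i)) :
      ∀ b ∈ I.blocks, p b := by
    intro b hb
    obtain ⟨i, hi, rfl⟩ := List.mem_map.mp hb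
    exact h i (I.mem_range'.mp hi)
  obtain ⟨t, ht, h⟩ := StackProg.machine_outputs I.gauss I.blocks I.prod_modulus
    (hblock fun i hi => I.m_pos i hi) (hblock fun i hi => I.coprime_M_div hi)
    (hblock fun i hi => by rw [I.gauss_block hi]; exact I.M_div_mul_gaussM hi)
    (hblock fun i hi => by rw [I.gauss_block hi]; exact I.m_mul_gaussM hi)
  rw [combine_blocks, ← encode_eq, List.length_map, List.length_range] at *
  refine ⟨t, ht, ?_⟩
  rwa [List.flatMap_map, ← List.flatMap_map (f := I.term) (g := fun x => encodeNat x.val)] at h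

end CRTInput

namespace StackProg

/-! ### The number of steps -/

/-- The part of the cost of processing blocks that does not depend on the numbers on the list. -/
def fixedCost (n : ℕ) (bs : List Block) : ℕ :=
  (bs.map fun b => 109 * n + 31 + 6 * (b.residues.flatMap numWord).length + b.residues.length).sum

/-- If all blocks have several residues, the length of the list grows at least geometrically. -/
theorem blocksCost_le_of_two_le (n : ℕ) (bs : List Block) (y : ℕ)
    (h : ∀ b ∈ bs, 2 ≤ b.residues.length) :
    blocksCost n bs y + 20 * y ≤
      1 + fixedCost n bs + 20 * (y * (bs.map fun b => b.residues.length).prod) := by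
  induction bs generalizing y with
  | nil => simp [blocksCost, fixedCost]
  | cons b bs ih =>
    have h1 := ih (y * b.residues.length) fun b hb => h b (by simp [hb])
    have h2 := Nat.mul_le_mul_left y (h b (by simp))
    simp only [blocksCost, blockCost, fixedCost, List.map_cons, List.sum_cons, List.prod_cons,
      mul_assoc] at h1 ⊢
    omega

/-- If the numbers of residues increase, the blocks with a single residue come first, and they do
not change the length of the list. -/
theorem blocksCost_le (n : ℕ) (bs : List Block) (y : ℕ) (h : ∀ b ∈ bs, 1 ≤ b.residues.length)
    (hs : bs.Pairwise fun b b' => b.residues.length ≤ b'.residues.length) :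
    blocksCost n bs y + 20 * y ≤ 1 + fixedCost n bs + 10 * (y * bs.length) +
      20 * (y * (bs.map fun b => b.residues.length).prod) := by
  induction bs with
  | nil => simp [blocksCost, fixedCost]
  | cons b bs ih =>
    rw [List.pairwise_cons] at hs
    rcases (h b (by simp)).lt_or_eq with hb | hb
    · refine (blocksCost_le_of_two_le n (b :: bs) y fun b' hb' => ?_).trans (by omega)
      rcases List.mem_cons.mp hb' with rfl | hb'
      · exact hb
      · exact le_trans hb (hs.1 b' hb')
    · have h1 := ih (fun b hb => h b (by simp [hb])) hs.2
      simp only [blocksCost, blockCost, fixedCost, List.map_cons, List.sum_cons, List.prod_cons,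
        List.length_cons, mul_add, ← hb, mul_one, one_mul] at h1 ⊢
      omega

theorem two_pow_places_le (bs : List Block) (h : ∀ b ∈ bs, 0 < b.modulus) :
    2 ^ places bs ≤ (bs.map Block.modulus).prod := by
  induction bs with
  | nil => simp [places]
  | cons b bs ih =>
    have e : places (b :: bs) = (b.modulus.size - 1) + places bs := by simp [places]
    rw [List.map_cons, List.prod_cons, e, pow_add]
    refine Nat.mul_le_mul ?_ (ih fun b hb => h b (by simp [hb]))
    have := Nat.size_pos.mpr (h b (by simp))
    exact Nat.lt_size.mp (by omega)

end StackProg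

namespace CRTInput

open StackProg

variable (I : CRTInput)

theorem sum_range' (f : ℕ → ℕ) (k n : ℕ) :
    ((List.range' k n).map f).sum = ∑ i ∈ Finset.Ico k (k + n), f i := by
  induction n with
  | zero => simp
  | succ n ih =>
    rw [List.range'_1_concat, List.map_append, List.sum_append, ih, ← add_assoc,
      Finset.sum_Ico_succ_top (by omega)]
    simp

theorem sum_blocks (f : Block → ℕ) :
    (I.blocks.map f).sum = ∑ i ∈ Finset.Icc 1 I.d, f (I.block i) := by
  rw [blocks, List.map_map, sum_range', add_comm 1, Finset.Ico_add_one_right_eq_Icc]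
  rfl

theorem size_m_le {i : ℕ} (hi : i ∈ Finset.Icc 1 I.d) : (I.m i).size ≤ places I.blocks + 1 := by
  have := Finset.single_le_sum (f := fun i => (I.m i).size - 1) (fun _ _ => Nat.zero_le _) hi
  rw [places, sum_blocks]
  simp only [block]
  omega

theorem length_numWord_val_le {i : ℕ} (hi : i ∈ Finset.Icc 1 I.d) (x : ZMod (I.m i)) :
    (numWord x.val).length ≤ places I.blocks + 2 := by
  have : NeZero (I.m i) := ⟨(I.m_pos i hi).ne'⟩
  rw [length_numWord]
  exact Nat.succ_le_succ ((Nat.size_le_size (ZMod.val_lt x).le).trans (I.size_m_le hi))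

theorem length_residues_le {i : ℕ} (hi : i ∈ Finset.Icc 1 I.d) :
    ((I.block i).residues.flatMap numWord).length ≤ I.kappa i * (places I.blocks + 2) := by
  rw [List.length_flatMap]
  refine (List.sum_le_card_nsmul _ (places I.blocks + 2) fun x hx => ?_).trans_eq (by simp [block])
  simp only [block, List.map_map, List.mem_map] at hx
  obtain ⟨j, -, rfl⟩ := hx
  exact I.length_numWord_val_le hi _

theorem kappa_le {i : ℕ} (hi : i ∈ Finset.Icc 1 I.d) : I.kappa i ≤ I.m i := by
  have : NeZero (I.m i) := ⟨(I.m_pos i hi).ne'⟩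
  exact (Finset.card_le_univ _).trans_eq (ZMod.card _)

theorem length_word_le {i : ℕ} (hi : i ∈ Finset.Icc 1 I.d) :
    (I.block i).word.length ≤ 4 * (I.kappa i * (places I.blocks + 2)) := by
  have h1 := I.length_residues_le hi
  have h2 := I.size_m_le hi
  have h3 : (I.kappa i).size ≤ places I.blocks + 1 := (Nat.size_le_size (I.kappa_le hi)).trans h2
  have h4 : places I.blocks + 2 ≤ I.kappa i * (places I.blocks + 2) :=
    Nat.le_mul_of_pos_left _ (I.kappa_pos hi)
  have e : ((I.block i).residues.flatMap numWord).length =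
      ((I.block i).residues.flatMap encodeNat).length := by
    simp [List.length_flatMap, encodeNat, numWord]
  have h5 : (I.block i).word.length = (I.m i).size + 1 + ((I.kappa i).size + 1) +
      ((I.block i).residues.flatMap encodeNat).length + 1 := by
    simp only [Block.word, encodeNat, List.length_append, List.length_map, List.length_singleton,
      Nat.size_eq_bits_len]
    rfl
  omega

theorem length_encode_le : (I.blocks.flatMap Block.word).length ≤
    4 * ((∑ i ∈ Finset.Icc 1 I.d, I.kappa i) * (places I.blocks + 2)) := by
  rw [List.length_flatMap, sum_blocks, Finset.sum_mul, Finset.mul_sum]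
  exact Finset.sum_le_sum fun i hi => I.length_word_le hi

theorem d_le_sum_kappa : I.d ≤ ∑ i ∈ Finset.Icc 1 I.d, I.kappa i := by
  simpa using Finset.card_nsmul_le_sum (Finset.Icc 1 I.d) I.kappa 1 fun i hi => I.kappa_pos hi

theorem fixedCost_le (n : ℕ) : fixedCost n I.blocks.reverse ≤
    (∑ i ∈ Finset.Icc 1 I.d, I.kappa i) * (109 * n + 6 * places I.blocks + 44) := by
  rw [fixedCost, List.map_reverse, List.sum_reverse, sum_blocks, Finset.sum_mul]
  refine Finset.sum_le_sum fun i hi => ?_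
  have h1 := I.length_residues_le hi
  have h2 : 109 * n + 31 ≤ I.kappa i * (109 * n + 31) := Nat.le_mul_of_pos_left _ (I.kappa_pos hi)
  have h3 : (I.block i).residues.length = I.kappa i := by simp [block]
  have h4 : I.kappa i * (109 * n + 6 * places I.blocks + 44) = I.kappa i * (109 * n + 31) +
      6 * (I.kappa i * (places I.blocks + 2)) + I.kappa i := by ring
  omega

theorem mainCost_le : mainCost I.blocks (I.place (I.d + 1)) ≤
    ((∑ i ∈ Finset.Icc 1 I.d, I.kappa i) * (256 * places I.blocks + 336) +
      24 * I.place (I.d + 1) + 11) * (8 * places I.blocks + 12) := by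
  have hlen (i) : (I.block i).residues.length = I.kappa i := by simp [block]
  have hprod : (I.blocks.reverse.map fun b => b.residues.length).prod = I.place (I.d + 1) := by
    rw [List.map_reverse, List.prod_reverse, blocks, List.map_map, ← prod_kappa]
    simp only [Function.comp_def, hlen]
    rw [prod_range', add_comm 1, Finset.Ico_add_one_right_eq_Icc]
  have h := blocksCost_le (2 * places I.blocks + 2) I.blocks.reverse 1
    (fun b hb => by
      rw [List.mem_reverse] at hb
      obtain ⟨i, hi, rfl⟩ := List.mem_map.mp hb
      rw [hlen]
      exact I.kappa_pos (I.mem_range'.mp hi))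
    (by
      rw [List.pairwise_reverse, blocks, List.pairwise_map]
      refine (List.pairwise_lt_range' (s := 1) (n := I.d)).imp_of_mem fun hi hj hij => ?_
      rw [hlen, hlen]
      exact I.sorted _ (I.mem_range'.mp hi) _ (I.mem_range'.mp hj) hij.le)
  have hd : I.blocks.reverse.length = I.d := by simp [blocks]
  have h1 := I.d_le_sum_kappa
  have h2 := I.fixedCost_le (2 * places I.blocks + 2)
  have h3 := I.length_encode_le
  rw [hprod, hd] at h
  have e : unit (2 * places I.blocks + 2) = 8 * places I.blocks + 12 := by unfold unit; ring
  rw [mainCost, e]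
  refine Nat.mul_le_mul_right _ ?_
  generalize (∑ i ∈ Finset.Icc 1 I.d, I.kappa i) = K at *
  generalize places I.blocks = k at *
  have e1 : K * (256 * k + 336) = 256 * (K * k) + 336 * K := by ring
  have e2 : K * (109 * (2 * k + 2) + 6 * k + 44) = 224 * (K * k) + 262 * K := by ring
  have e3 : K * (k + 2) = K * k + 2 * K := by ring
  omega

/-- The bound for the running time. -/
theorem mainCost_le_mul_log (hM : 1 < I.M)
    (h : (∑ i ∈ Finset.Icc 1 I.d, (I.kappa i : ℝ)) * Real.log I.M ≤ (I.crtSet.ncard : ℝ)) :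
    (2 * mainCost I.blocks (I.place (I.d + 1)) : ℕ) ≤
      100000 * ((I.crtSet.ncard : ℝ) * Real.log I.M) := by
  set l := Real.log I.M with hl
  set k := places I.blocks with hk
  have hlog2 := Real.log_two_gt_d9
  have hkl : (k : ℝ) ≤ 2 * l := by
    have h1 : 2 ^ k ≤ I.M := I.prod_modulus ▸ two_pow_places_le I.blocks (fun b hb => by
      obtain ⟨i, hi, rfl⟩ := List.mem_map.mp hb
      exact I.m_pos i (I.mem_range'.mp hi))
    have h2 : ((2 : ℝ) ^ k) ≤ I.M := by exact_mod_cast h1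
    have h3 := Real.log_le_log (by positivity) h2
    rw [Real.log_pow] at h3
    nlinarith [(Nat.cast_nonneg k : (0 : ℝ) ≤ k)]
  have hl1 : 1 ≤ 2 * l := by
    have := Real.log_le_log two_pos (show (2 : ℝ) ≤ I.M by exact_mod_cast hM)
    linarith
  have hN : (1 : ℝ) ≤ I.crtSet.ncard := by
    rw [I.ncard_crtSet]
    exact_mod_cast I.place_pos le_rfl
  have h1 : ((2 * mainCost I.blocks (I.place (I.d + 1)) : ℕ) : ℝ) ≤
      2 * (((∑ i ∈ Finset.Icc 1 I.d, (I.kappa i : ℝ)) * (256 * k + 336) +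
      24 * I.crtSet.ncard + 11) * (8 * k + 12)) := by
    rw [I.ncard_crtSet]
    exact_mod_cast Nat.mul_le_mul_left 2 I.mainCost_le
  set K := ∑ i ∈ Finset.Icc 1 I.d, (I.kappa i : ℝ) with hK
  set N : ℝ := (I.crtSet.ncard : ℝ) with hNdef
  have hK0 : 0 ≤ K := Finset.sum_nonneg fun _ _ => Nat.cast_nonneg _
  have h2 : K * (256 * k + 336) + 24 * N + 11 ≤ 1219 * N := by
    have : K * (256 * k + 336) ≤ K * (1184 * l) := mul_le_mul_of_nonneg_left (by linarith) hK0
    nlinarith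
  have h3 : (8 * (k : ℝ) + 12) ≤ 40 * l := by linarith
  have h4 := mul_le_mul h2 h3 (by positivity) (by positivity)
  have : 0 ≤ N * l := by nlinarith
  linarith

end CRTInput

namespace MultitapeTM

/-! ### The number of symbols written by a machine -/

variable (T : MultitapeTM)

/-- The positions of the nonblank cells of a tape, relative to the head. -/
def nonblank {W : Type} (t : Turing.Tape (TapeCell W)) : Set ℤ := {i | t.nth i ≠ none}

theorem encard_nonblank_act_le {W : Type} (t : Turing.Tape (TapeCell W))
    (p : TapeCell W × Option Turing.Dir) :
    (nonblank (act t p)).encard ≤ (nonblank t).encard + 1 := by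
  have hw : (nonblank (t.write p.1)).encard ≤ (nonblank t).encard + 1 := by
    refine (Set.encard_le_encard fun i hi => ?_).trans (Set.encard_insert_le (nonblank t) 0)
    by_cases h : i = 0
    · exact Or.inl h
    · right
      simpa [nonblank, Turing.Tape.write_nth, h] using hi
  have hm {u : Turing.Tape (TapeCell W)} {f : ℤ → ℤ} (hf : f.Injective)
      (h : ∀ i, u.nth i = (t.write p.1).nth (f i)) :
      (nonblank u).encard ≤ (nonblank t).encard + 1 := by
    rw [← hf.encard_image]
    refine (Set.encard_le_encard ?_).trans hw
    rintro _ ⟨i, hi, rfl⟩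
    exact fun h' => hi ((h i).trans h')
  obtain ⟨s, _ | _ | _⟩ := p
  · exact hw
  · exact hm (sub_left_injective (b := 1)) (Turing.Tape.move_left_nth _)
  · exact hm (add_left_injective 1) (Turing.Tape.move_right_nth _)

theorem encard_nonblank_le {w : List IOSymbol} {t : ℕ} {c : T.Config}
    (h : (fun o => o.bind T.step)^[t] (some (T.init w)) = some c) :
    (nonblank (c.tape T.outTape)).encard ≤ t := by
  induction t generalizing c with
  | zero =>
    obtain rfl : T.init w = c := by simpa using h
    have : nonblank ((T.init w).tape T.outTape) = ∅ := by
      ext i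
      have : (default : Turing.Tape (TapeCell T.W)).nth i = none := by
        rcases i with (_ | i) | i <;> rfl
      simp [nonblank, init, T.in_ne_out.symm, this]
    simp [this]
  | succ t ih =>
    rw [Function.iterate_succ_apply'] at h
    obtain ⟨c', hc', hs⟩ := Option.bind_eq_some_iff.mp h
    obtain ⟨p, -, rfl⟩ := Option.map_eq_some_iff.mp hs
    refine (encard_nonblank_act_le _ _).trans ?_
    push_cast
    exact add_le_add_left (ih hc') 1

/-- A machine writes at most one symbol on its output tape in each step. -/
theorem Outputs.length_le {w v : List IOSymbol} {t : ℕ} (h : T.Outputs w t v) : v.length ≤ t := by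
  obtain ⟨c, hc, -, hv⟩ := h
  have h1 := T.encard_nonblank_le hc
  rw [hv] at h1
  have h2 : (((Finset.range v.length).map Nat.castEmbedding : Finset ℤ) : Set ℤ) ⊆
      nonblank (T.wordTape v) := by
    intro i hi
    obtain ⟨n, hn, rfl⟩ := by simpa using hi
    change (Turing.Tape.mk' _ _).nth (n : ℤ) ≠ none
    rw [Turing.Tape.mk'_nth_nat, Turing.ListBlank.nth_mk, List.getI_eq_getElem _ (by simpa using hn)]
    simp
  have h3 := (Set.encard_le_encard h2).trans h1
  rw [Set.encard_coe_eq_coe_finsetCard, Finset.card_map, Finset.card_range] at h3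
  exact_mod_cast h3

end MultitapeTM

namespace CRTInput

variable (I : CRTInput)

/-! ### The length of the output -/

/-- The integers representing `x` and `y` are congruent modulo a divisor of `M` if `x` and `y` have
the same image. -/
theorem val_modEq {e : ℕ} (he : e ∣ I.M) {x y : ZMod I.M}
    (h : ZMod.castHom he (ZMod e) x = ZMod.castHom he (ZMod e) y) : x.val ≡ y.val [MOD e] := by
  have : NeZero I.M := ⟨I.M_pos.ne'⟩
  rw [← ZMod.natCast_eq_natCast_iff, ← map_natCast (ZMod.castHom he (ZMod e)), ZMod.natCast_zmod_val,
    h, ← map_natCast (ZMod.castHom he (ZMod e)), ZMod.natCast_zmod_val]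

/-- If `A i` has two elements, each element of the set has a companion with a different residue
modulo `m i` and the same residue modulo `M / m i`. -/
theorem exists_companion {i : ℕ} (hi : i ∈ Finset.Icc 1 I.d) (hk : 2 ≤ I.kappa i) {x : ZMod I.M}
    (hx : x ∈ I.crtSet) : ∃ y ∈ I.crtSet, y ≠ x ∧ y.val ≡ x.val [MOD I.M / I.m i] := by
  have : NeZero (I.m i) := ⟨(I.m_pos i hi).ne'⟩
  obtain ⟨α, hα⟩ := hx
  obtain ⟨b, hb, hne⟩ := Finset.exists_mem_ne (show 1 < (I.A i).card from hk) (α i)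
  have key (j) (hj : j ∈ Finset.Icc 1 I.d) : ZMod.castHom (I.dvd_M hj) (ZMod (I.m j))
      (x + ((b.val : ZMod I.M) - ((α i).val : ZMod I.M)) * I.gaussM i) =
      Function.update α i b j := by
    rw [map_add, map_mul, I.castHom_gaussM hj hi, (hα j hj).2, map_sub, map_natCast, map_natCast]
    rcases eq_or_ne j i with rfl | hji
    · rw [Function.update_self, if_pos rfl, ZMod.natCast_zmod_val, ZMod.natCast_zmod_val]
      ring
    · rw [Function.update_of_ne hji, if_neg hji, mul_zero, add_zero]
  refine ⟨_, ⟨Function.update α i b, fun j hj => ⟨?_, key j hj⟩⟩, fun h => hne ?_,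
    I.val_modEq (Nat.div_dvd_of_dvd (I.dvd_M hi)) ?_⟩
  · rcases eq_or_ne j i with rfl | hji
    · rwa [Function.update_self]
    · rw [Function.update_of_ne hji]
      exact (hα j hj).1
  · have := key i hi
    rw [h, (hα i hi).2, Function.update_self] at this
    exact this.symm
  · rw [map_add, map_mul, I.gaussM_eq hi, Nat.cast_mul, map_mul, map_natCast, map_natCast,
      ZMod.natCast_self, zero_mul, mul_zero, add_zero]

/-- If `A i` has two elements, at least half of the elements of the set are at least `M / m i`. -/
theorem card_le_two_mul (S : Finset (ZMod I.M)) (hS : ∀ x, x ∈ S ↔ x ∈ I.crtSet) {i : ℕ}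
    (hi : i ∈ Finset.Icc 1 I.d) (hk : 2 ≤ I.kappa i) :
    S.card ≤ 2 * (S.filter fun x => I.M / I.m i ≤ x.val).card := by
  have : NeZero I.M := ⟨I.M_pos.ne'⟩
  have h (x) : ∃ y, x ∈ S → y ∈ S ∧ y ≠ x ∧ y.val ≡ x.val [MOD I.M / I.m i] := by
    by_cases hx : x ∈ S
    · obtain ⟨y, hy, h⟩ := I.exists_companion hi hk ((hS x).mp hx)
      exact ⟨y, fun _ => ⟨(hS y).mpr hy, h⟩⟩
    · exact ⟨x, fun h => absurd h hx⟩
  choose f hf using h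
  have hle : (S.filter fun x => ¬ I.M / I.m i ≤ x.val).card ≤
      (S.filter fun x => I.M / I.m i ≤ x.val).card := by
    refine Finset.card_le_card_of_injOn f (fun x hx => ?_) fun x hx y hy hxy => ?_
    · obtain ⟨hx, hlt⟩ := Finset.mem_filter.mp hx
      obtain ⟨h1, h2, h3⟩ := hf x hx
      refine Finset.mem_filter.mpr ⟨h1, ?_⟩
      by_contra hlt'
      exact h2 (ZMod.val_injective _ (h3.eq_of_lt_of_lt (by omega) (by omega)))
    · obtain ⟨hx, hlt⟩ := Finset.mem_filter.mp hx
      obtain ⟨hy, hlt'⟩ := Finset.mem_filter.mp hy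
      have h1 := (hf x hx).2.2.symm.trans (hxy ▸ (hf y hy).2.2)
      exact ZMod.val_injective _ (h1.eq_of_lt_of_lt (by omega) (by omega))
  have := Finset.card_filter_add_card_filter_not (s := S) (fun x => I.M / I.m i ≤ x.val)
  omega

/-- If there are no two moduli with several residues, then the set is small. -/
theorem card_le_sum_kappa (hM : 1 < I.M)
    (h : ∀ i ∈ Finset.Icc 1 I.d, ∀ j ∈ Finset.Icc 1 I.d, 2 ≤ I.kappa i → 2 ≤ I.kappa j → i = j) :
    I.place (I.d + 1) ≤ ∑ i ∈ Finset.Icc 1 I.d, I.kappa i := by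
  have h1 : 1 ∈ Finset.Icc 1 I.d := by
    by_contra h0
    have : Finset.Icc 1 I.d = ∅ := by
      simp at h0
      simp [h0]
    rw [M, this] at hM
    simp at hM
  rw [← prod_kappa, Finset.prod_eq_single_of_mem 1 h1 fun i hi hne => ?_]
  · exact Finset.single_le_sum (f := I.kappa) (fun _ _ => Nat.zero_le _) h1
  · have h2 := I.sorted 1 h1 i hi (Finset.mem_Icc.mp hi).1
    have h3 := I.kappa_pos hi
    have h4 := h i hi 1 h1
    unfold kappa at *
    omega

/-- If there are two moduli with several residues, then one of them is at most the square root of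
`M`. -/
theorem exists_le_div {i j : ℕ} (hi : i ∈ Finset.Icc 1 I.d) (hj : j ∈ Finset.Icc 1 I.d)
    (hki : 2 ≤ I.kappa i) (hkj : 2 ≤ I.kappa j) (hij : i ≠ j) :
    ∃ i ∈ Finset.Icc 1 I.d, 2 ≤ I.kappa i ∧ I.m i ≤ I.M / I.m i := by
  have hpos {i} (hi : i ∈ Finset.Icc 1 I.d) : 0 < I.M / I.m i :=
    Nat.div_pos (Nat.le_of_dvd I.M_pos (I.dvd_M hi)) (I.m_pos i hi)
  have h1 := Nat.le_of_dvd (hpos hj) (I.dvd_M_div hi hj hij)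
  have h2 := Nat.le_of_dvd (hpos hi) (I.dvd_M_div hj hi hij.symm)
  rcases le_total (I.m i) (I.m j) with h | h
  · exact ⟨i, hi, hki, h.trans h2⟩
  · exact ⟨j, hj, hkj, h.trans h1⟩

theorem log_le_size {x : ℕ} (hx : 0 < x) : Real.log x ≤ x.size := by
  have h1 : (x : ℝ) ≤ 2 ^ x.size := by exact_mod_cast (Nat.lt_size_self x).le
  have h2 := Real.log_le_log (by exact_mod_cast hx) h1
  rw [Real.log_pow] at h2
  have h3 : Real.log 2 ≤ 1 := Real.log_two_lt_d9.le.trans (by norm_num)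
  exact h2.trans (mul_le_of_le_one_right (Nat.cast_nonneg _) h3)

theorem mul_log_le_sum_size (hM : 1 < I.M)
    (h : (∑ i ∈ Finset.Icc 1 I.d, (I.kappa i : ℝ)) * Real.log I.M ≤ (I.crtSet.ncard : ℝ))
    (S : Finset (ZMod I.M)) (hS : ∀ x, x ∈ S ↔ x ∈ I.crtSet) :
    1 / 4 * ((I.crtSet.ncard : ℝ) * Real.log I.M) ≤ ((∑ x ∈ S, (x.val.size + 1) : ℕ) : ℝ) := by
  have hl : 0 < Real.log I.M := Real.log_pos (by exact_mod_cast hM)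
  have hcard : I.crtSet.ncard = S.card := by
    rw [← Set.ncard_coe_finset]
    congr
    ext x
    exact (hS x).symm
  by_cases h2 : ∀ i ∈ Finset.Icc 1 I.d, ∀ j ∈ Finset.Icc 1 I.d,
      2 ≤ I.kappa i → 2 ≤ I.kappa j → i = j
  · have h3 : (I.crtSet.ncard : ℝ) ≤ ∑ i ∈ Finset.Icc 1 I.d, (I.kappa i : ℝ) := by
      rw [I.ncard_crtSet]
      exact_mod_cast I.card_le_sum_kappa hM h2
    have h4 : (I.crtSet.ncard : ℝ) * Real.log I.M ≤ I.crtSet.ncard :=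
      (mul_le_mul_of_nonneg_right h3 hl.le).trans h
    have h5 : S.card ≤ ∑ x ∈ S, (x.val.size + 1) := by
      simpa using Finset.card_nsmul_le_sum S (fun x => x.val.size + 1) 1 fun x _ => by omega
    have h6 : (I.crtSet.ncard : ℝ) ≤ ((∑ x ∈ S, (x.val.size + 1) : ℕ) : ℝ) := by
      rw [hcard]
      exact_mod_cast h5
    have : 0 ≤ (I.crtSet.ncard : ℝ) * Real.log I.M := by positivity
    linarith
  · push Not at h2
    obtain ⟨i, hi, j, hj, hki, hkj, hij⟩ := h2
    obtain ⟨i, hi, hk, hle⟩ := I.exists_le_div hi hj hki hkj hij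
    set e := I.M / I.m i with he
    have he0 : 0 < e := (I.m_pos i hi).trans_le hle
    have h3 : I.M ≤ e * e := by
      rw [← I.M_div_mul hi]
      exact Nat.mul_le_mul_left _ hle
    have h4 : Real.log I.M ≤ 2 * Real.log e := by
      have := Real.log_le_log (by exact_mod_cast I.M_pos) (show (I.M : ℝ) ≤ e * e by exact_mod_cast h3)
      rw [Real.log_mul (by positivity) (by positivity)] at this
      linarith
    have h5 : (I.crtSet.ncard : ℝ) ≤ 2 * ((S.filter fun x => e ≤ x.val).card : ℝ) := by
      rw [hcard]
      exact_mod_cast I.card_le_two_mul S hS hi hk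
    have h6 : ((S.filter fun x => e ≤ x.val).card : ℝ) * (Real.log I.M / 2) ≤
        ∑ x ∈ S.filter fun x => e ≤ x.val, ((x.val.size + 1 : ℕ) : ℝ) := by
      rw [← nsmul_eq_mul]
      refine Finset.card_nsmul_le_sum _ _ _ fun x hx => ?_
      have hx' := (Finset.mem_filter.mp hx).2
      have h7 := log_le_size (he0.trans_le hx')
      have h8 := Real.log_le_log (by exact_mod_cast he0) (show (e : ℝ) ≤ x.val by exact_mod_cast hx')
      push_cast
      linarith
    have h7 : ∑ x ∈ S.filter fun x => e ≤ x.val, (x.val.size + 1) ≤ ∑ x ∈ S, (x.val.size + 1) :=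
      Finset.sum_le_sum_of_subset (Finset.filter_subset _ _)
    have h8 : (∑ x ∈ S.filter fun x => e ≤ x.val, ((x.val.size + 1 : ℕ) : ℝ)) ≤
        ((∑ x ∈ S, (x.val.size + 1) : ℕ) : ℝ) := by exact_mod_cast h7
    nlinarith

theorem length_encodeResidues (xs : List (ZMod I.M)) :
    (encodeResidues xs).length = (xs.map fun x => x.val.size + 1).sum := by
  simp [encodeResidues, encodeNat, List.length_flatMap, Nat.size_eq_bits_len]

theorem sum_size_le_length (xs : List (ZMod I.M)) :
    ∑ x ∈ xs.toFinset, (x.val.size + 1) ≤ (encodeResidues xs).length := by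
  have h : xs.toFinset = xs.dedup.toFinset := by
    ext
    simp
  rw [length_encodeResidues, h, List.sum_toFinset _ xs.nodup_dedup]
  exact (xs.dedup_sublist.map _).sum_le_sum fun _ _ => Nat.zero_le _

end CRTInput

theorem mainTheorem6 :
    -- the algorithm terminates and lists every element of the set exactly once
    (∀ I : CRTInput, ∃ xs : List (ZMod I.M),
      I.algorithm = Part.some xs ∧ xs.Nodup ∧ ∀ x, x ∈ xs ↔ x ∈ I.crtSet) ∧
    -- it runs on a multitape Turing machine within the claimed number of steps
    (∃ T : MultitapeTM,
      (∀ I : CRTInput, ∀ xs ∈ I.algorithm, ∃ t : ℕ, T.Outputs I.encode t (encodeResidues xs)) ∧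
      ∃ C : ℝ, ∀ I : CRTInput, 1 < I.M →
        (∑ i ∈ Finset.Icc 1 I.d, (I.kappa i : ℝ)) * Real.log I.M ≤ (I.crtSet.ncard : ℝ) →
        ∀ xs ∈ I.algorithm, ∃ t : ℕ, T.Outputs I.encode t (encodeResidues xs) ∧
          (t : ℝ) ≤ C * ((I.crtSet.ncard : ℝ) * Real.log I.M)) ∧
    -- no multitape Turing machine that lists the set is faster by more than a constant factor
    (∃ c : ℝ, 0 < c ∧ ∀ I : CRTInput, 1 < I.M →
      (∑ i ∈ Finset.Icc 1 I.d, (I.kappa i : ℝ)) * Real.log I.M ≤ (I.crtSet.ncard : ℝ) →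
      ∀ (T : MultitapeTM) (xs : List (ZMod I.M)) (t : ℕ), (∀ x, x ∈ xs ↔ x ∈ I.crtSet) →
        T.Outputs I.encode t (encodeResidues xs) →
        c * ((I.crtSet.ncard : ℝ) * Real.log I.M) ≤ (t : ℝ)) := by
  have halg (I : CRTInput) (xs) (h : xs ∈ I.algorithm) :
      xs = (List.range (I.place (I.d + 1))).map I.term := by
    rwa [I.algorithm_eq, Part.mem_some_iff] at h
  refine ⟨fun I => ⟨_, I.algorithm_eq, I.nodup_terms, I.mem_terms⟩,
    ⟨StackProg.machine, fun I xs hxs => ?_, 100000, fun I hM h xs hxs => ?_⟩,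
    1 / 4, by norm_num, fun I hM h T xs t hxs ht => ?_⟩
  · obtain ⟨t, -, ht⟩ := I.exists_outputs
    exact ⟨t, halg I xs hxs ▸ ht⟩
  · obtain ⟨t, hle, ht⟩ := I.exists_outputs
    exact ⟨t, halg I xs hxs ▸ ht,
      le_trans (by exact_mod_cast hle) (I.mainCost_le_mul_log hM h)⟩
  · refine (I.mul_log_le_sum_size hM h xs.toFinset fun x => by rw [List.mem_toFinset, hxs]).trans ?_
    exact_mod_cast (I.sum_size_le_length xs).trans ht.length_le
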